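/- **Setting.** There are $n\ge 1$ experts and $T$ days. An oblivious adversary fixes loss vectors $\ell_1,\dots,\ell_T\in[0,1]^n$. If an algorithm plays expert $i_t$ on day $t$, its regret is $\sum_{t=1}^T\ell_t(i_t)-\min_{e\in[n]}\sum_{t=1}^T\ell_t(e)$. **Hierarchical baseline algorithm.** Input: $k\ge1$, positive integer block sizes $T_0<T_1<\dots<T_k=T$ with $T_{i-1}\mid T_i$ for $1\le i\le k$, and a space parameter $m\ge 1$. Let $\epsilon=\log(T)/m$. The algorithm keeps buckets $B_0,\dots,B_{k-1}$ (initially empty) of entries (expert, arrival time, loss since arrival, weight), where one expert may have several entries, and for each $1\le i\le k-1$ a pair of external weights $(w_i,w_i')$, initially $(1,1)$. An entry $e'$ *$\epsilon$-dominates* an entry $e$ if $e'$ arrived before $e$ and the loss of $e'$ is at most $(1+\epsilon)$ times the loss of $e$. *Bucket update at time $t$.* Let $k'=\max\{i\le k-1: T_i\mid t\}$ and $\tau=\max\{t'\le t: T_{k'+1}\mid t'\}$. (1) For each $i\le k'$, remove simultaneously from $B_i$ all entries with arrival time at least $\tau+\frac12$ that are $\epsilon$-dominated by some entry of $B_i$;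 set the weights of the remaining entries of $B_i$ to $1$ and, if $i\ge1$, set $w_i=w_i'=1$. (2) For $i=k',k'-1,\dots,1$, add to $B_i$ a copy of every entry of $B_0,\dots,B_{i-1}$, with loss $0$, weight $1$ and distinct arrival times in $[t,t+\frac12)$. (3) For each $i\le k'$, add to $B_i$ entries for $m$ experts sampled independently and uniformly with replacement from $[n]$, with loss $0$, weight $1$ and distinct arrival times in $[t+\frac12,t+1)$. The distinct arrival times are chosen by an arbitrary fixed rule depending only on $t$, $i$ and the position of the new entry in the list of added entries. *Run.* Perform the bucket update at time $0$. On each day $t=1,\dots,T$: for each $i$ draw $e_i$ from $B_i$ with probability proportional to the weights; put $y_0=e_0$ and, for $i\ge1$, $y_i=e_i$ with probability $w_i/(w_i+w_i')$ and $y_i=y_{i-1}$ otherwise (all draws independent). Play $y_{k-1}$. Then add $\ell_t(e)$ to the loss of every entry of every bucket (with expert $e$), multiply the weight of every entry of $B_i$ by $\exp(-\sqrt{\log|B_i|/T_i}\;\ell_t(e))$, multiply $w_i$ by $\exp(-\sqrt{2/T_i}\;\ell_t(e_i))$ and $w_i'$ by $\exp(-\sqrt{2/T_i}\;\ell_t(y_{i-1}))$.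 If $T_0\mid t$, perform the bucket update at time $t$. **Theorem.** For all constants $\gamma>0$ and $a>0$ there are constants $C,K>0$ and $c\in\mathbb N$, depending only on $\gamma$ and $a$, such that for all $n,m,k\geq 1$ and block sizes as above with $m\le T^a$, every rule for the arrival times and every loss sequence $\ell_1,\dots,\ell_T\in[0,1]^n$, with probability at least $1-K\,T^{-\gamma}$ the regret of the hierarchical baseline algorithm is at most $$C(\log T)^c\left(\frac{T_k}{m}+\frac{T_k}{\sqrt{T_{k-1}}}+\frac nm\sum_{i=0}^{k-1}\frac{T_i}{\sqrt{T_{i-1}}}\right),\qquad\text{where } T_{-1}=1 .$$ -/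

import Mathlib

/-! The hierarchical baseline algorithm for the experts problem, as a probabilistic program in the
`PMF` monad. Experts are `Fin n`, days are `1, …, T`, buckets (levels) are `0, …, k - 1`, and the
block sizes are `Ts 0 < ⋯ < Ts k = T`; values of `Ts`, buckets and weights beyond these ranges are
never read. -/

namespace HierBaseline

noncomputable section

/-- A tuple (expert, arrival time, loss since arrival, internal weight) stored in a bucket. The same
expert may occur in several entries. -/
structure Entry (n : ℕ) where
  expert : Fin n
  arrival : ℝ
  loss : ℝ
  weight : ℝ

/-- The memory of the algorithm: the buckets and, for each `i`, the pair of external weights between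
levels `i` and `i + 1`: `big i` belongs to the pick of bucket `i + 1`, and `small i` to the
prediction of level `i`. -/
structure State (n : ℕ) where
  bucket : ℕ → List (Entry n)
  big : ℕ → ℝ
  small : ℕ → ℝ

/-- A choice of the unique arrival times: at time `t`, the `r`-th copy forwarded to bucket `i` gets
the arrival time `fwd t i r ∈ [t, t + 1/2)`, and the `r`-th new sample of bucket `i` gets
`smp t i r ∈ [t + 1/2, t + 1)`. -/
structure ArrivalRule where
  fwd : ℕ → ℕ → ℕ → ℝ
  smp : ℕ → ℕ → ℕ → ℝ
  fwd_injective : ∀ t i, Function.Injective (fwd t i)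
  smp_injective : ∀ t i, Function.Injective (smp t i)
  fwd_mem : ∀ t i r : ℕ, fwd t i r ∈ Set.Ico (t : ℝ) (t + 1 / 2)
  smp_mem : ∀ t i r : ℕ, smp t i r ∈ Set.Ico ((t : ℝ) + 1 / 2) (t + 1)

/-- `x'` `ε`-dominates `x`. -/
def Dominates {n : ℕ} (ε : ℝ) (x' x : Entry n) : Prop :=
  x'.arrival < x.arrival ∧ x'.loss ≤ (1 + ε) * x.loss

theorem sum_ofReal_ne_top {α : Type} (l : List (α × ℝ)) :
    ∑' j : Fin l.length, ENNReal.ofReal (l.get j).2 ≠ ⊤ := by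
  rw [tsum_fintype]
  exact ENNReal.sum_ne_top.2 fun _ _ => ENNReal.ofReal_ne_top

open Classical in
/-- Choose an item of the list with probability proportional to its weight. The value `d` is used
only if there is no item of positive weight, which does not happen in the algorithm. -/
def weightedChoice {α : Type} (d : α) (l : List (α × ℝ)) : PMF α :=
  if h : ∑' j : Fin l.length, ENNReal.ofReal (l.get j).2 ≠ 0 then
    (PMF.normalize (fun j : Fin l.length => ENNReal.ofReal (l.get j).2) h
      (sum_ofReal_ne_top l)).map fun j => (l.get j).1
  else PMF.pure d

/-- The random picks and predictions of the levels `0, …, i` on one day: the value at `j` is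
`(e_j, pred_j)`, where `e_j` is drawn from bucket `j` in proportion to the internal weights,
`pred_0 = e_0`, and `pred_(j+1)` is `e_(j+1)` or `pred_j`, chosen in proportion to the external
weights. (The values at levels above `i` are meaningless.) -/
def getPredictions {n : ℕ} [NeZero n] (s : State n) : ℕ → PMF (ℕ → Fin n × Fin n)
  | 0 => (weightedChoice 0 ((s.bucket 0).map fun x => (x.expert, x.weight))).map fun e _ => (e, e)
  | i + 1 =>
    (getPredictions s i).bind fun y =>
      (weightedChoice 0 ((s.bucket (i + 1)).map fun x => (x.expert, x.weight))).bind fun e =>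
        (weightedChoice e [(e, s.big i), ((y i).2, s.small i)]).map fun p =>
          Function.update y (i + 1) (e, p)

/-- Multiplicative weights updates after the losses `loss` of the day are observed. Bucket `i` runs
MWU over its entries with rate `√(log |B_i| / T_i)`. The external weights between the levels `i` and
`i + 1` run MWU with rate `√(2 / T_(i+1))` over two options: the pick of bucket `i + 1` and the
prediction of level `i`. -/
def updateWeights {n : ℕ} (Ts : ℕ → ℕ) (loss : Fin n → ℝ) (y : ℕ → Fin n × Fin n)
    (s : State n) : State n where
  bucket i := (s.bucket i).map fun x =>
    { x with
      loss := x.loss + loss x.expert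
      weight := x.weight *
        Real.exp (-(√(Real.log ((s.bucket i).length : ℝ) / (Ts i : ℝ)) * loss x.expert)) }
  big i := s.big i * Real.exp (-(√(2 / (Ts (i + 1) : ℝ)) * loss (y (i + 1)).1))
  small i := s.small i * Real.exp (-(√(2 / (Ts (i + 1) : ℝ)) * loss (y i).2))

/-- The largest level `i ≤ k - 1` whose block size divides `t`. -/
def topLevel (Ts : ℕ → ℕ) (k t : ℕ) : ℕ := Nat.findGreatest (fun i => Ts i ∣ t) (k - 1)

open Classical in
/-- Remove from a bucket all entries which arrived at time `τ + 1/2` or later and are dominated by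
some entry of the bucket, and set the weights of the remaining entries to `1`. -/
def evict {n : ℕ} (ε : ℝ) (τ : ℕ) (b : List (Entry n)) : List (Entry n) :=
  (b.filter fun x => ¬ ((τ : ℝ) + 1 / 2 ≤ x.arrival ∧ ∃ x' ∈ b, Dominates ε x' x)).map
    fun x => { x with weight := 1 }

/-- New entries with the given experts and arrival times, loss `0` and weight `1`. -/
def fresh {n : ℕ} (arr : ℕ → ℝ) (es : List (Fin n)) : List (Entry n) :=
  es.mapIdx fun r e => ⟨e, arr r, 0, 1⟩

/-- Update of the buckets `0, …, k'` at time `t`, where `k' = topLevel Ts k t`: eviction, reset of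
the weights, forwarding of all surviving experts of smaller buckets to larger ones, and sampling of
`m` new experts, uniformly and with replacement, for each of these buckets. -/
def updateBuckets {n : ℕ} [NeZero n] (A : ArrivalRule) (Ts : ℕ → ℕ) (k m t : ℕ) (s : State n) :
    PMF (State n) :=
  let ε : ℝ := Real.log (Ts k : ℝ) / (m : ℝ)
  let k' := topLevel Ts k t
  let τ := t / Ts (k' + 1) * Ts (k' + 1)
  let old : ℕ → List (Entry n) := fun i => evict ε τ (s.bucket i)
  let forwarded : ℕ → List (Fin n) := fun i =>
    (List.range i).flatMap fun j => (old j).map Entry.expert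
  (PMF.uniformOfFintype (Fin (k' + 1) → Fin m → Fin n)).map fun S =>
    { bucket := fun i =>
        if h : i < k' + 1 then
          old i ++ fresh (A.fwd t i) (forwarded i) ++ fresh (A.smp t i) (List.ofFn (S ⟨i, h⟩))
        else s.bucket i
      big := fun i => if i + 1 ≤ k' then 1 else s.big i
      small := fun i => if i + 1 ≤ k' then 1 else s.small i }

/-- Empty buckets and unit external weights. -/
def emptyState (n : ℕ) : State n where
  bucket _ := []
  big _ := 1
  small _ := 1

/-- The joint law of the memory after day `t` and of the sequence of experts played on the days
`1, …, t`, on the loss sequence `ℓ`. -/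
def run {n : ℕ} [NeZero n] (A : ArrivalRule) (Ts : ℕ → ℕ) (k m : ℕ) (ℓ : ℕ → Fin n → ℝ) :
    ℕ → PMF (State n × (ℕ → Fin n))
  | 0 => (updateBuckets A Ts k m 0 (emptyState n)).map fun s => (s, fun _ => 0)
  | t + 1 =>
    (run A Ts k m ℓ t).bind fun sp =>
      (getPredictions sp.1 (k - 1)).bind fun y =>
        let s := updateWeights Ts (ℓ (t + 1)) y sp.1
        (if Ts 0 ∣ t + 1 then updateBuckets A Ts k m (t + 1) s else PMF.pure s).map fun s' =>
          (s', Function.update sp.2 (t + 1) (y (k - 1)).2)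

/-- The law of the sequence of experts played by the hierarchical baseline algorithm on the days
`1, …, Ts k`. -/
def hierarchicalBaseline {n : ℕ} [NeZero n] (A : ArrivalRule) (Ts : ℕ → ℕ) (k m : ℕ)
    (ℓ : ℕ → Fin n → ℝ) : PMF (ℕ → Fin n) :=
  (run A Ts k m ℓ (Ts k)).map Prod.snd

/-- Regret over the days `1, …, T` of playing expert `p t` on day `t`. -/
def regret {n : ℕ} (ℓ : ℕ → Fin n → ℝ) (T : ℕ) (p : ℕ → Fin n) : ℝ :=
  ∑ t ∈ Finset.Icc 1 T, ℓ t (p t) - ⨅ e : Fin n, ∑ t ∈ Finset.Icc 1 T, ℓ t e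

/-- `T_(i-1)`, with the convention `T_(-1) = 1`. -/
def prevSize (Ts : ℕ → ℕ) : ℕ → ℕ
  | 0 => 1
  | i + 1 => Ts i

/-- `T_k / m + T_k / √T_(k-1) + (n / m) ∑_(i < k) T_i / √T_(i-1)`. -/
def regretBound (Ts : ℕ → ℕ) (k n m : ℕ) : ℝ :=
  (Ts k : ℝ) / m + (Ts k : ℝ) / √(prevSize Ts k : ℝ)
    + (n : ℝ) / m * ∑ i ∈ Finset.range k, (Ts i : ℝ) / √(prevSize Ts i : ℝ)

end

end HierBaseline

/-! # The regret of the hierarchical baseline algorithm -/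

namespace HierBaseline

noncomputable section

open scoped ENNReal

/-! ### Expectations over probability mass functions -/

section Expectation

variable {α β : Type*}

/-! Fix an expert `star` of least total loss and write `T = Ts k`, `ε = log T / m`. Chance enters
through three exponential supermartingales, controlling the losses of the picks, the losses of the
mixed predictions and the number of bad times. Outside the union of their tail events
(`toOuterMeasure_not_goodTraj_le`) the argument is deterministic.

Deterministic part. On a block of size `Ts i`, the picks of bucket `i` compete with every entry
present at the start of the block, and for `i ≥ 1` the prediction of level `i` competes both with
those picks and with the prediction of level `i - 1`, each up to `√(Ts i)` times logarithms. So the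
top prediction can be charged to the picks of one chosen level per day, if the choice respects
blocks (`sum_prediction_le`).

The choice comes from a walk on the times, used only in the analysis. At a visited time, the highest
updated bucket is sought that has an entry which will stay up to some time `v` and whose loss up to
`v` is within `1 + ε` of that of `star`; the walk jumps to the farthest such `v`. If there is none,
it moves on by `Ts 0`. During a jump with entry `z` of bucket `i`, higher buckets receive copies of
`z`, and a copy disappears only because of an entry that is within `1 + ε` of it. Induction over the
levels bounds the chosen picks by `(1 + ε) ^ (k - 1)` times the loss of `z`
(`sum_levelSum_le_of_survives`), hence by `(1 + ε) ^ k` times the loss of `star` in total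
(`sum_levelSum_le`). The overhead of order `1 / √(Ts j)` per day of level `j` is paid only inside
blocks of size `Ts (j + 1)` that start at a bad time, except at the top level, which pays every day.
With at most `Z` bad times per level this gives `Ts 0 * Z`, terms `Ts (j + 1) * Z / √(Ts j)`, and
`Ts k / √(Ts (k - 1))`.

Random part: `Z` is of order `n / m` times a logarithm. If the levels from `i` up to the updated top
level are bad, replacing any nonempty set of samples of level `i` by `star` lets the walk jump to
the very end: the earliest planted copy could be evicted only by an entry witnessing that level `i`
was not bad (`canJump_of_plant`). Counting the planted samples shows that `exp (m / n)` to the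
number of bad times, set to zero once the walk reaches the end, is a supermartingale
(`ev_potential_update_le`). -/

/-- The expectation of a nonnegative function. -/
def ev (μ : PMF α) (f : α → ℝ≥0∞) : ℝ≥0∞ := ∑' a, μ a * f a

theorem ev_pure (a : α) (f : α → ℝ≥0∞) : ev (PMF.pure a) f = f a := by
  unfold ev
  rw [tsum_eq_single a]
  · simp
  · intro b hb
    simp [hb]

theorem ev_bind (μ : PMF α) (κ : α → PMF β) (f : β → ℝ≥0∞) :
    ev (μ.bind κ) f = ev μ fun a => ev (κ a) f := by
  unfold ev
  simp only [PMF.bind_apply, ← ENNReal.tsum_mul_right, ← ENNReal.tsum_mul_left]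
  rw [ENNReal.tsum_comm]
  simp only [mul_assoc]

theorem ev_map (μ : PMF α) (g : α → β) (f : β → ℝ≥0∞) :
    ev (μ.map g) f = ev μ fun a => f (g a) := by
  rw [PMF.map, ev_bind]
  simp [ev_pure]

theorem ev_mono_support (μ : PMF α) {f g : α → ℝ≥0∞} (h : ∀ a ∈ μ.support, f a ≤ g a) :
    ev μ f ≤ ev μ g := by
  refine ENNReal.tsum_le_tsum fun a => ?_
  by_cases ha : μ a = 0
  · simp [ha]
  · exact mul_le_mul_right (h a ((PMF.mem_support_iff μ a).2 ha)) _

theorem ev_mono (μ : PMF α) {f g : α → ℝ≥0∞} (h : ∀ a, f a ≤ g a) : ev μ f ≤ ev μ g :=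
  ev_mono_support μ fun a _ => h a

theorem ev_const (μ : PMF α) (c : ℝ≥0∞) : ev μ (fun _ => c) = c := by
  unfold ev
  rw [ENNReal.tsum_mul_right, PMF.tsum_coe, one_mul]

theorem ev_le_one (μ : PMF α) (f : α → ℝ≥0∞) (h : ∀ a, f a ≤ 1) : ev μ f ≤ 1 :=
  (ev_mono μ h).trans (ev_const μ 1).le

theorem ev_const_mul (μ : PMF α) (c : ℝ≥0∞) (f : α → ℝ≥0∞) :
    ev μ (fun a => c * f a) = c * ev μ f := by
  unfold ev
  rw [← ENNReal.tsum_mul_left]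
  exact tsum_congr fun a => by ring

theorem ev_mul_const (μ : PMF α) (c : ℝ≥0∞) (f : α → ℝ≥0∞) :
    ev μ (fun a => f a * c) = ev μ f * c := by
  simp only [mul_comm _ c, ev_const_mul]

theorem ev_add (μ : PMF α) (f g : α → ℝ≥0∞) :
    ev μ (fun a => f a + g a) = ev μ f + ev μ g := by
  unfold ev
  rw [← ENNReal.tsum_add]
  exact tsum_congr fun a => by ring

theorem ev_uniform [Fintype α] [Nonempty α] (f : α → ℝ≥0∞) :
    ev (PMF.uniformOfFintype α) f = (∑ a, f a) / Fintype.card α := by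
  unfold ev
  rw [tsum_fintype, ENNReal.div_eq_inv_mul, Finset.mul_sum]
  simp

/-- Markov's inequality. -/
theorem mul_toOuterMeasure_le_ev (μ : PMF α) (f : α → ℝ≥0∞) (c : ℝ≥0∞) (s : Set α)
    (h : ∀ a ∈ s, c ≤ f a) : c * μ.toOuterMeasure s ≤ ev μ f := by
  rw [PMF.toOuterMeasure_apply, ← ENNReal.tsum_mul_left]
  refine ENNReal.tsum_le_tsum fun a => ?_
  by_cases ha : a ∈ s
  · rw [Set.indicator_of_mem ha, mul_comm]
    exact mul_le_mul_right (h a ha) _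
  · simp [ha]

/-- Chernoff's form of Markov's inequality, used for the losses of picks and predictions. -/
theorem toOuterMeasure_le_of_ev_exp_le_one (μ : PMF α) (φ : α → ℝ) (Γ : ℝ)
    (h : ev μ (fun a => ENNReal.ofReal (Real.exp (φ a))) ≤ 1) :
    μ.toOuterMeasure {a | Γ < φ a} ≤ ENNReal.ofReal (Real.exp (-Γ)) := by
  have h1 := (mul_toOuterMeasure_le_ev μ (fun a => ENNReal.ofReal (Real.exp (φ a)))
    (ENNReal.ofReal (Real.exp Γ)) {a | Γ < φ a} fun a ha =>
      ENNReal.ofReal_le_ofReal (Real.exp_le_exp.2 (le_of_lt ha))).trans h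
  have h2 : ENNReal.ofReal (Real.exp (-Γ)) * ENNReal.ofReal (Real.exp Γ) = 1 := by
    rw [← ENNReal.ofReal_mul (Real.exp_pos _).le, ← Real.exp_add]
    simp
  calc μ.toOuterMeasure {a | Γ < φ a}
      = ENNReal.ofReal (Real.exp (-Γ)) *
          (ENNReal.ofReal (Real.exp Γ) * μ.toOuterMeasure {a | Γ < φ a}) := by
        rw [← mul_assoc, h2, one_mul]
    _ ≤ ENNReal.ofReal (Real.exp (-Γ)) * 1 := by gcongr
    _ = _ := mul_one _

/-- The mean of a function with values in the unit interval. -/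
def mean (μ : PMF α) (X : α → ℝ) : ℝ := (ev μ fun a => ENNReal.ofReal (X a)).toReal

theorem ev_ofReal_le_one (μ : PMF α) (X : α → ℝ) (hX : ∀ a, X a ≤ 1) :
    ev μ (fun a => ENNReal.ofReal (X a)) ≤ 1 :=
  ev_le_one μ _ fun a => ENNReal.ofReal_le_one.2 (hX a)

theorem mean_nonneg (μ : PMF α) (X : α → ℝ) : 0 ≤ mean μ X := ENNReal.toReal_nonneg

theorem mean_le_one (μ : PMF α) (X : α → ℝ) (hX : ∀ a, X a ≤ 1) : mean μ X ≤ 1 := by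
  have := ENNReal.toReal_mono ENNReal.one_ne_top (ev_ofReal_le_one μ X hX)
  simpa [mean] using this

theorem exp_mul_le_of_mem_Icc {x c : ℝ} (hx : x ∈ Set.Icc (0 : ℝ) 1) :
    Real.exp (c * x) ≤ 1 + x * (Real.exp c - 1) := by
  have := convexOn_exp.2 (Set.mem_univ (0 : ℝ)) (Set.mem_univ c) (sub_nonneg.2 hx.2) hx.1 (by ring)
  simp only [smul_eq_mul, mul_zero, zero_add, Real.exp_zero, mul_one] at this
  rw [mul_comm c x]
  linarith

theorem exp_sub_one_le {c : ℝ} (h0 : 0 ≤ c) (h1 : c ≤ 1) : Real.exp c - 1 ≤ c + c ^ 2 := by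
  have h := Real.abs_exp_sub_one_sub_id_le (x := c) (by rw [abs_of_nonneg h0]; exact h1)
  linarith [le_abs_self (Real.exp c - 1 - c)]

/-- A moment generating function bound for functions with values in the unit interval. -/
theorem ev_exp_le_one (μ : PMF α) (X : α → ℝ) (hX : ∀ a, X a ∈ Set.Icc (0 : ℝ) 1) {c : ℝ}
    (h0 : 0 ≤ c) (h1 : c ≤ 1) :
    ev μ (fun a => ENNReal.ofReal (Real.exp (c * X a - (c + c ^ 2) * mean μ X))) ≤ 1 := by
  have he : 0 ≤ Real.exp c - 1 := by linarith [Real.add_one_le_exp c]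
  have hmean : ev μ (fun a => ENNReal.ofReal (X a)) = ENNReal.ofReal (mean μ X) := by
    rw [mean, ENNReal.ofReal_toReal]
    exact ((ev_ofReal_le_one μ X fun a => (hX a).2).trans_lt ENNReal.one_lt_top).ne
  have hm := mean_nonneg μ X
  calc ev μ (fun a => ENNReal.ofReal (Real.exp (c * X a - (c + c ^ 2) * mean μ X)))
      ≤ ev μ (fun a => (1 + ENNReal.ofReal (X a) * ENNReal.ofReal (Real.exp c - 1)) *
          ENNReal.ofReal (Real.exp (-((c + c ^ 2) * mean μ X)))) := by
        refine ev_mono μ fun a => ?_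
        rw [← ENNReal.ofReal_mul (hX a).1, ← ENNReal.ofReal_one,
          ← ENNReal.ofReal_add zero_le_one (mul_nonneg (hX a).1 he),
          ← ENNReal.ofReal_mul (add_nonneg zero_le_one (mul_nonneg (hX a).1 he)),
          sub_eq_add_neg, Real.exp_add]
        exact ENNReal.ofReal_le_ofReal
          (mul_le_mul_of_nonneg_right (exp_mul_le_of_mem_Icc (hX a)) (Real.exp_pos _).le)
    _ = (1 + ENNReal.ofReal (mean μ X) * ENNReal.ofReal (Real.exp c - 1)) *
          ENNReal.ofReal (Real.exp (-((c + c ^ 2) * mean μ X))) := by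
        rw [ev_mul_const, ev_add, ev_const, ev_mul_const, hmean]
    _ ≤ 1 := by
        rw [← ENNReal.ofReal_mul hm, ← ENNReal.ofReal_one,
          ← ENNReal.ofReal_add zero_le_one (mul_nonneg hm he),
          ← ENNReal.ofReal_mul (add_nonneg zero_le_one (mul_nonneg hm he))]
        refine ENNReal.ofReal_le_ofReal ?_
        have h2 : 1 + mean μ X * (Real.exp c - 1) ≤ Real.exp ((c + c ^ 2) * mean μ X) := by
          have := Real.add_one_le_exp ((c + c ^ 2) * mean μ X)
          nlinarith [mul_le_mul_of_nonneg_left (exp_sub_one_le h0 h1) hm]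
        calc _ ≤ Real.exp ((c + c ^ 2) * mean μ X) * Real.exp (-((c + c ^ 2) * mean μ X)) :=
              mul_le_mul_of_nonneg_right h2 (Real.exp_pos _).le
          _ = 1 := by rw [← Real.exp_add]; simp

end Expectation

/-! ### Multiplicative weights -/

/-- Follows from `exp x ≥ 1 + x + x ^ 2 / 2` because the two quadratics multiply to `1 + x ^ 4 / 4 ≥
1`. -/
theorem exp_neg_le_quadratic {x : ℝ} (hx : 0 ≤ x) : Real.exp (-x) ≤ 1 - x + x ^ 2 / 2 := by
  have h := Real.quadratic_le_exp_of_nonneg hx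
  have h1 : Real.exp (-x) * Real.exp x = 1 := by rw [← Real.exp_add]; simp
  have h2 : 0 ≤ 1 - x + x ^ 2 / 2 := by nlinarith [sq_nonneg (x - 1)]
  have h3 : 1 ≤ (1 - x + x ^ 2 / 2) * Real.exp x := by
    nlinarith [mul_le_mul_of_nonneg_left h h2, sq_nonneg (x ^ 2)]
  by_contra hlt
  push Not at hlt
  nlinarith [mul_lt_mul_of_pos_right hlt (Real.exp_pos x)]

section Hedge

variable {ι : Type*} [Fintype ι] (η : ℝ) (ℓ : ℕ → ι → ℝ)

/-- The expected loss of the multiplicative weights algorithm on day `d`. -/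
def hedgeLoss (d : ℕ) : ℝ :=
  (∑ x, Real.exp (-(η * ∑ u ∈ Finset.range d, ℓ u x)) * ℓ d x) /
    ∑ x, Real.exp (-(η * ∑ u ∈ Finset.range d, ℓ u x))

theorem hedge_potential_succ [Nonempty ι] (hη : 0 ≤ η) (hℓ : ∀ d x, ℓ d x ∈ Set.Icc (0 : ℝ) 1)
    (d : ℕ) :
    ∑ x, Real.exp (-(η * ∑ u ∈ Finset.range (d + 1), ℓ u x)) ≤
      (∑ x, Real.exp (-(η * ∑ u ∈ Finset.range d, ℓ u x))) *
        Real.exp (-(η * hedgeLoss η ℓ d) + η ^ 2 / 2) := by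
  set w : ι → ℝ := fun x => Real.exp (-(η * ∑ u ∈ Finset.range d, ℓ u x)) with hw
  have hWpos : 0 < ∑ x, w x := Finset.sum_pos (fun x _ => Real.exp_pos _) Finset.univ_nonempty
  have hm : hedgeLoss η ℓ d * ∑ x, w x = ∑ x, w x * ℓ d x := div_mul_cancel₀ _ hWpos.ne'
  calc ∑ x, Real.exp (-(η * ∑ u ∈ Finset.range (d + 1), ℓ u x))
      ≤ ∑ x, w x * (1 - η * ℓ d x + η ^ 2 / 2) := by
        refine Finset.sum_le_sum fun x _ => ?_
        rw [Finset.sum_range_succ, mul_add, neg_add, Real.exp_add]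
        refine mul_le_mul_of_nonneg_left ?_ (Real.exp_pos _).le
        refine (exp_neg_le_quadratic (mul_nonneg hη (hℓ d x).1)).trans ?_
        have : ℓ d x ^ 2 ≤ 1 := pow_le_one₀ (hℓ d x).1 (hℓ d x).2
        nlinarith [mul_le_mul_of_nonneg_left this (sq_nonneg η)]
    _ = (∑ x, w x) * (1 - η * hedgeLoss η ℓ d + η ^ 2 / 2) := by
        have : ∑ x, w x * (1 - η * ℓ d x + η ^ 2 / 2) =
            (∑ x, w x) * (1 + η ^ 2 / 2) - η * ∑ x, w x * ℓ d x := by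
          rw [Finset.mul_sum, Finset.sum_mul, ← Finset.sum_sub_distrib]
          exact Finset.sum_congr rfl fun x _ => by ring
        rw [this, ← hm]
        ring
    _ ≤ _ := by
        refine mul_le_mul_of_nonneg_left ?_ hWpos.le
        linarith [Real.add_one_le_exp (-(η * hedgeLoss η ℓ d) + η ^ 2 / 2)]

/-- The total weight is at least the weight of `e` and shrinks daily by the factor of
`hedge_potential_succ`; compare logarithms. Everything stays multiplied by `η`, since the rate is
zero for a bucket with one entry. -/
theorem hedge_regret (hη : 0 ≤ η) (hℓ : ∀ d x, ℓ d x ∈ Set.Icc (0 : ℝ) 1) (D : ℕ) (e : ι) :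
    η * ∑ d ∈ Finset.range D, hedgeLoss η ℓ d ≤
      η * ∑ d ∈ Finset.range D, ℓ d e + Real.log (Fintype.card ι) + η ^ 2 / 2 * D := by
  have : Nonempty ι := ⟨e⟩
  have key : ∀ D : ℕ, ∑ x, Real.exp (-(η * ∑ u ∈ Finset.range D, ℓ u x)) ≤
      (Fintype.card ι : ℝ) *
        Real.exp (-(η * ∑ d ∈ Finset.range D, hedgeLoss η ℓ d) + η ^ 2 / 2 * D) := by
    intro D
    induction D with
    | zero => simp
    | succ D ih =>
      refine (hedge_potential_succ η ℓ hη hℓ D).trans ?_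
      refine (mul_le_mul_of_nonneg_right ih (Real.exp_pos _).le).trans (le_of_eq ?_)
      rw [mul_assoc, ← Real.exp_add, Finset.sum_range_succ]
      congr 2
      push_cast
      ring
  have h1 : Real.exp (-(η * ∑ u ∈ Finset.range D, ℓ u e)) ≤ _ :=
    (Finset.single_le_sum (f := fun x => Real.exp (-(η * ∑ u ∈ Finset.range D, ℓ u x)))
      (fun x _ => (Real.exp_pos _).le) (Finset.mem_univ e)).trans (key D)
  have hc : (0 : ℝ) < Fintype.card ι := by exact_mod_cast Fintype.card_pos
  have h2 := Real.log_le_log (Real.exp_pos _) h1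
  rw [Real.log_exp, Real.log_mul hc.ne' (Real.exp_pos _).ne', Real.log_exp] at h2
  linarith

end Hedge

/-! ### Block sizes -/

/-- The hypotheses on the block sizes `Ts 0, …, Ts k`. -/
structure Sizes (Ts : ℕ → ℕ) (k : ℕ) : Prop where
  k_pos : 0 < k
  pos_zero : 0 < Ts 0
  lt_succ : ∀ i < k, Ts i < Ts (i + 1)
  dvd_succ : ∀ i < k, Ts i ∣ Ts (i + 1)

/-- The start of the block of size `Ts (topLevel Ts k t + 1)` containing `t`. -/
def blockStart (Ts : ℕ → ℕ) (k t : ℕ) : ℕ :=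
  t / Ts (topLevel Ts k t + 1) * Ts (topLevel Ts k t + 1)

namespace Sizes

set_option linter.unusedSectionVars false

variable {Ts : ℕ → ℕ} {k : ℕ} (hS : Sizes Ts k)

include hS

theorem pos {i : ℕ} (hi : i ≤ k) : 0 < Ts i := by
  induction i with
  | zero => exact hS.pos_zero
  | succ i ih => exact (Nat.zero_le _).trans_lt (hS.lt_succ i hi)

theorem dvd_of_le {i j : ℕ} (hij : i ≤ j) (hj : j ≤ k) : Ts i ∣ Ts j := by
  induction j, hij using Nat.le_induction with
  | base => exact dvd_rfl
  | succ j _ ih => exact (ih (by omega)).trans (hS.dvd_succ j hj)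

theorem topLevel_lt (t : ℕ) : topLevel Ts k t < k :=
  (Nat.findGreatest_le (k - 1)).trans_lt (Nat.sub_lt hS.k_pos one_pos)

theorem le_topLevel {i t : ℕ} (hi : i < k) (h : Ts i ∣ t) : i ≤ topLevel Ts k t :=
  Nat.le_findGreatest (by omega) h

theorem topLevel_dvd {t : ℕ} (h : Ts 0 ∣ t) : Ts (topLevel Ts k t) ∣ t :=
  Nat.findGreatest_spec (P := fun i => Ts i ∣ t) (Nat.zero_le _) h

theorem dvd_of_le_topLevel {i t : ℕ} (h : Ts 0 ∣ t) (hi : i ≤ topLevel Ts k t) : Ts i ∣ t :=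
  (hS.dvd_of_le hi (hS.topLevel_lt t).le).trans (hS.topLevel_dvd h)

theorem zero_dvd_of_dvd {i t : ℕ} (hi : i ≤ k) (h : Ts i ∣ t) : Ts 0 ∣ t :=
  (hS.dvd_of_le (Nat.zero_le i) hi).trans h

/-- If the top level of `v` were below `j`, then `p` would be a multiple of the block size defining
`blockStart Ts k v`, which would force that start to be at least `p`. -/
theorem dvd_of_blockStart_lt {j p v : ℕ} (hj : j < k) (hv : Ts 0 ∣ v) (hp : Ts j ∣ p)
    (hpv : p ≤ v) (h : blockStart Ts k v < p) : Ts j ∣ v := by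
  by_contra hne
  have hlt : topLevel Ts k v < j := by
    by_contra hle
    exact hne (hS.dvd_of_le_topLevel hv (not_lt.1 hle))
  have hd : Ts (topLevel Ts k v + 1) ∣ p := (hS.dvd_of_le hlt hj.le).trans hp
  obtain ⟨c, hc⟩ := hd
  have hpos := hS.pos (i := topLevel Ts k v + 1) (by omega)
  have : c ≤ v / Ts (topLevel Ts k v + 1) := by
    rw [Nat.le_div_iff_mul_le hpos, mul_comm, ← hc]
    exact hpv
  have h2 : c * Ts (topLevel Ts k v + 1) ≤ blockStart Ts k v := Nat.mul_le_mul_right _ this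
  rw [mul_comm] at h2
  omega

theorem div_eq_of_blockStart_le {w v : ℕ} (h : blockStart Ts k v ≤ w) (hwv : w ≤ v) :
    w / Ts (topLevel Ts k v + 1) = v / Ts (topLevel Ts k v + 1) := by
  have hpos := hS.pos (i := topLevel Ts k v + 1) (hS.topLevel_lt v)
  refine le_antisymm (Nat.div_le_div_right hwv) ?_
  rw [Nat.le_div_iff_mul_le hpos]
  exact h

/-- A proper multiple is at least the double. This makes `k` logarithmic in `Ts k`. -/
theorem two_pow_le {i : ℕ} (hi : i ≤ k) : 2 ^ i ≤ Ts i := by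
  induction i with
  | zero => exact hS.pos_zero
  | succ i ih =>
    obtain ⟨c, hc⟩ := hS.dvd_succ i hi
    have h1 := hS.lt_succ i hi
    have h2 := ih (by omega)
    have h3 : 2 ≤ c := by
      by_contra hlt
      have : c = 0 ∨ c = 1 := by omega
      rcases this with rfl | rfl <;> simp at hc <;> omega
    rw [hc, pow_succ]
    exact Nat.mul_le_mul h2 h3

end Sizes

theorem add_le_of_dvd_of_lt {d a b : ℕ} (ha : d ∣ a) (hb : d ∣ b) (h : a < b) : a + d ≤ b := by
  obtain ⟨x, rfl⟩ := ha
  obtain ⟨y, rfl⟩ := hb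
  have : x < y := lt_of_mul_lt_mul_left h (Nat.zero_le d)
  calc d * x + d = d * (x + 1) := by ring
    _ ≤ d * y := Nat.mul_le_mul_left d this

/-! ### Evictions on the level of sets -/

section Evictions

variable {n : ℕ} (Ts : ℕ → ℕ) (k : ℕ) (ε : ℝ) (ℓ : ℕ → Fin n → ℝ)

/-- The loss of expert `e` on the days `a + 1, …, b`. -/
def cumLoss (a b : ℕ) (e : Fin n) : ℝ := ∑ x ∈ Finset.Ico a b, ℓ (x + 1) e

theorem cumLoss_add {a b c : ℕ} (hab : a ≤ b) (hbc : b ≤ c) (e : Fin n) :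
    cumLoss ℓ a b e + cumLoss ℓ b c e = cumLoss ℓ a c e :=
  Finset.sum_Ico_consecutive _ hab hbc

theorem cumLoss_nonneg (hℓ : ∀ t e, 0 ≤ ℓ t e) (a b : ℕ) (e : Fin n) : 0 ≤ cumLoss ℓ a b e :=
  Finset.sum_nonneg fun _ _ => hℓ _ _

theorem cumLoss_mono_left (hℓ : ∀ t e, 0 ≤ ℓ t e) {a b : ℕ} (hab : a ≤ b) (c : ℕ) (e : Fin n) :
    cumLoss ℓ b c e ≤ cumLoss ℓ a c e :=
  Finset.sum_le_sum_of_subset_of_nonneg (Finset.Ico_subset_Ico_left hab) fun _ _ _ => hℓ _ _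

/-- The entries (expert, arrival time) of `X` which survive the eviction at time `t`. -/
def keep (t : ℕ) (X : Set (Fin n × ℝ)) : Set (Fin n × ℝ) :=
  {x | x ∈ X ∧ ¬ ((blockStart Ts k t : ℝ) + 1 / 2 ≤ x.2 ∧ ∃ x' ∈ X, x'.2 < x.2 ∧
    cumLoss ℓ ⌊x'.2⌋₊ t x'.1 ≤ (1 + ε) * cumLoss ℓ ⌊x.2⌋₊ t x.1)}

open Classical in
/-- The evolution of the content `X` of bucket `i` from time `s` to time `s + d` if no entries are
added. -/
def evolve (i s : ℕ) (X : Set (Fin n × ℝ)) : ℕ → Set (Fin n × ℝ)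
  | 0 => X
  | d + 1 =>
    if Ts i ∣ s + d + 1 then keep Ts k ε ℓ (s + d + 1) (evolve i s X d) else evolve i s X d

/-- Only earlier arrivals dominate, so the fate of the entries arrived before `c` is independent of
all later ones. Both the prediction of survival by `evolve` and the planting argument rest on this.
-/
theorem keep_sep (t : ℕ) (X : Set (Fin n × ℝ)) (c : ℝ) :
    keep Ts k ε ℓ t {x ∈ X | x.2 < c} = {x ∈ keep Ts k ε ℓ t X | x.2 < c} := by
  ext x
  simp only [keep, Set.mem_ofPred_eq]
  constructor
  · rintro ⟨⟨hx, hc⟩, h⟩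
    exact ⟨⟨hx, fun ⟨h1, x', hx', h2, h3⟩ => h ⟨h1, x', ⟨hx', h2.trans hc⟩, h2, h3⟩⟩, hc⟩
  · rintro ⟨⟨hx, h⟩, hc⟩
    exact ⟨⟨hx, hc⟩, fun ⟨h1, x', hx', h2, h3⟩ => h ⟨h1, x', hx'.1, h2, h3⟩⟩

theorem evolve_sep (i s : ℕ) (X : Set (Fin n × ℝ)) (c : ℝ) (d : ℕ) :
    evolve Ts k ε ℓ i s {x ∈ X | x.2 < c} d = {x ∈ evolve Ts k ε ℓ i s X d | x.2 < c} := by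
  induction d with
  | zero => rfl
  | succ d ih =>
    simp only [evolve]
    split_ifs
    · rw [ih, keep_sep]
    · exact ih

/-- `X t i` is the content of bucket `i` after the updates at time `t`. -/
structure BucketPath (X : ℕ → ℕ → Set (Fin n × ℝ)) : Prop where
  arrival_mem : ∀ t < Ts k, ∀ i < k, ∀ x ∈ X t i, x.2 ∈ Set.Ico (0 : ℝ) (t + 1)
  stay : ∀ t, t + 1 < Ts k → ∀ i < k, ¬ Ts i ∣ t + 1 → X (t + 1) i = X t i
  mem_and_lt_iff : ∀ t, t + 1 < Ts k → ∀ i < k, Ts i ∣ t + 1 →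
    ∀ x, x ∈ X (t + 1) i ∧ x.2 < (t + 1 : ℕ) ↔ x ∈ keep Ts k ε ℓ (t + 1) (X t i)
  forward : ∀ t, t + 1 < Ts k → ∀ i < k, Ts i ∣ t + 1 → ∀ j < i,
    ∀ x ∈ keep Ts k ε ℓ (t + 1) (X t j), ∃ r ∈ Set.Ico ((t + 1 : ℕ) : ℝ) ((t + 1 : ℕ) + 1 / 2),
      (x.1, r) ∈ X (t + 1) i

namespace BucketPath

variable {Ts k ε ℓ} {X : ℕ → ℕ → Set (Fin n × ℝ)} (hX : BucketPath Ts k ε ℓ X)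

include hX

/-- Entries added at a time arrive no earlier than that time, so an old entry that is present now
has never been absent in between. -/
theorem persist {i w w' : ℕ} (hi : i < k) (hw : w ≤ w') (hw' : w' < Ts k) {x : Fin n × ℝ}
    (hx : x ∈ X w' i) (hlt : x.2 < w + 1) : x ∈ X w i := by
  induction w', hw using Nat.le_induction with
  | base => exact hx
  | succ t hwt ih =>
    refine ih (by omega) ?_
    by_cases hd : Ts i ∣ t + 1
    · refine ((hX.mem_and_lt_iff t hw' i hi hd x).1 ⟨hx, hlt.trans_le ?_⟩).1
      push_cast
      have : (w : ℝ) ≤ t := by exact_mod_cast hwt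
      linarith
    · rwa [hX.stay t hw' i hi hd] at hx

theorem mem_evolve_iff {i w d : ℕ} (hi : i < k) (hd : w + d < Ts k) (x : Fin n × ℝ) :
    x ∈ evolve Ts k ε ℓ i w (X w i) d ↔ x ∈ X (w + d) i ∧ x.2 < w + 1 := by
  induction d generalizing x with
  | zero =>
    exact ⟨fun h => ⟨h, (hX.arrival_mem w hd i hi x h).2⟩, fun h => h.1⟩
  | succ d ih =>
    have ih' := ih (by omega)
    have hset : evolve Ts k ε ℓ i w (X w i) d = {x ∈ X (w + d) i | x.2 < w + 1} := Set.ext ih'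
    simp only [evolve]
    split_ifs with hdvd
    · rw [hset, keep_sep]
      simp only [Set.mem_ofPred_eq]
      have h := hX.mem_and_lt_iff (w + d) hd i hi hdvd x
      have hle : (w : ℝ) + 1 ≤ ((w + d + 1 : ℕ) : ℝ) := by push_cast; linarith [d.cast_nonneg (α := ℝ)]
      constructor
      · rintro ⟨h1, h2⟩
        exact ⟨(h.2 h1).1, h2⟩
      · rintro ⟨h1, h2⟩
        exact ⟨h.1 ⟨h1, h2.trans_le hle⟩, h2⟩
    · rw [ih', ← hX.stay (w + d) hd i hi hdvd]
      rfl

/-- An entry which leaves a bucket does so because it is dominated. -/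
theorem exists_dominator {i w v : ℕ} (hi : i < k) (hv : v ≤ Ts k) {x : Fin n × ℝ}
    (hx : x ∈ X w i) (hlt : ∃ w', w ≤ w' ∧ w' < v ∧ x ∉ X w' i) :
    ∃ w', w < w' ∧ w' < v ∧ Ts i ∣ w' ∧ (blockStart Ts k w' : ℝ) + 1 / 2 ≤ x.2 ∧
      ∃ z ∈ X (w' - 1) i, z.2 < x.2 ∧
        cumLoss ℓ ⌊z.2⌋₊ w' z.1 ≤ (1 + ε) * cumLoss ℓ ⌊x.2⌋₊ w' x.1 := by
  classical
  set w' := Nat.find hlt with hw'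
  obtain ⟨h1, h2, h3⟩ := Nat.find_spec hlt
  rw [← hw'] at h1 h2 h3
  have hne : w ≠ w' := fun h => h3 (h ▸ hx)
  obtain ⟨t, ht⟩ : ∃ t, w' = t + 1 := ⟨w' - 1, by omega⟩
  have hxt : x ∈ X t i := by
    by_contra hnot
    exact Nat.find_min hlt (m := t) (by omega) ⟨by omega, by omega, hnot⟩
  rw [ht] at h1 h2 h3
  have hd : Ts i ∣ t + 1 := by
    by_contra hnd
    rw [hX.stay t (by omega) i hi hnd] at h3
    exact h3 hxt
  have hk : x ∉ keep Ts k ε ℓ (t + 1) (X t i) := fun h =>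
    h3 ((hX.mem_and_lt_iff t (by omega) i hi hd x).2 h).1
  obtain ⟨h4, z, hz, h5, h6⟩ := not_not.1 fun h => hk ⟨hxt, h⟩
  exact ⟨t + 1, by omega, h2, hd, h4, z, hz, h5, h6⟩

end BucketPath

end Evictions

/-! ### Comparing with a surviving entry -/

section Comparison

variable {n : ℕ} {Ts : ℕ → ℕ} {k : ℕ} {ε : ℝ} {ℓ : ℕ → Fin n → ℝ}

open Classical in
/-- Assign to day `x + 1` the value `q j x`, where `j` is the smallest level with `U (j + 1) x`,
and `0` if `U 0 x`. -/
def levelSum (k : ℕ) (U : ℕ → ℕ → Prop) (q : ℕ → ℕ → ℝ) (x : ℕ) : ℝ :=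
  ∑ j ∈ Finset.range k, if U (j + 1) x ∧ ¬ U j x then q j x else 0

/-- A decreasing family of unions of blocks: the days `x + 1` with `U j x` form a union of blocks of
size `Ts j`. -/
structure Nested (Ts : ℕ → ℕ) (k : ℕ) (U : ℕ → ℕ → Prop) : Prop where
  top : ∀ x, U k x
  mono : ∀ j < k, ∀ x < Ts k, U j x → U (j + 1) x
  congr : ∀ j ≤ k, ∀ x y, x / Ts j = y / Ts j → U j x → U j y

namespace Nested

variable {U : ℕ → ℕ → Prop} (hU : Nested Ts k U)

include hU

theorem mono_le {i j x : ℕ} (hij : i ≤ j) (hj : j ≤ k) (hx : x < Ts k) (h : U i x) : U j x := by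
  induction j, hij using Nat.le_induction with
  | base => exact h
  | succ j _ ih => exact hU.mono j hj x hx (ih (by omega))

/-- If `U i` held at `x`, it would hold at the start of the block of `x`. That start is a multiple
of `Ts i` in `[u, x]`: it is either `u` itself or one of the excluded interior times. -/
theorem not_of_block (hS : Sizes Ts k) {i u v u₀ v₀ x : ℕ} (hi : i < k)
    (hU₀ : ∀ x, u₀ < x → x < v₀ → ∀ l < k, Ts l ∣ x → ¬ U l x) (hu : u₀ ≤ u) (hv : v ≤ v₀)
    (hdu : Ts i ∣ u) (h : ¬ U i u) (hux : u ≤ x) (hxv : x < v) : ¬ U i x := by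
  intro hUx
  have hpos := hS.pos hi.le
  have hb : U i (x / Ts i * Ts i) := hU.congr i hi.le x _
    (by rw [Nat.mul_div_cancel _ hpos]) hUx
  have hub : u ≤ x / Ts i * Ts i := by
    obtain ⟨c, rfl⟩ := hdu
    rw [mul_comm]
    exact Nat.mul_le_mul_right _ ((Nat.le_div_iff_mul_le hpos).2 (by rwa [mul_comm]))
  have hbx : x / Ts i * Ts i ≤ x := Nat.div_mul_le_self _ _
  rcases hub.eq_or_lt with h' | h'
  · exact h (h' ▸ hb)
  · exact hU₀ _ (by omega) (by omega) i hi (dvd_mul_left _ _) hb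

theorem levelSum_eq {q : ℕ → ℕ → ℝ} {i x : ℕ} (hi : i < k) (hx : x < Ts k) (h1 : U (i + 1) x)
    (h2 : ¬ U i x) : levelSum k U q x = q i x := by
  unfold levelSum
  rw [Finset.sum_eq_single i]
  · simp [h1, h2]
  · intro j hj hne
    rw [if_neg]
    rintro ⟨h3, h4⟩
    rcases lt_or_gt_of_ne hne with h | h
    · exact h2 (hU.mono_le (by omega) hi.le hx h3)
    · exact h4 (hU.mono_le (by omega) (Finset.mem_range.1 hj).le hx h1)
  · intro h
    exact absurd (Finset.mem_range.2 hi) h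

theorem levelSum_eq_zero {q : ℕ → ℕ → ℝ} {x : ℕ} (hx : x < Ts k) (h : U 0 x) :
    levelSum k U q x = 0 := by
  refine Finset.sum_eq_zero fun j hj => if_neg ?_
  rintro ⟨-, h2⟩
  exact h2 (hU.mono_le (Nat.zero_le j) (Finset.mem_range.1 hj).le hx h)

end Nested

variable (hS : Sizes Ts k) {X : ℕ → ℕ → Set (Fin n × ℝ)} (hX : BucketPath Ts k ε ℓ X)
  {U : ℕ → ℕ → Prop} (hU : Nested Ts k U) {q : ℕ → ℕ → ℝ}
  (hq : ∀ j < k, ∀ b, Ts j ∣ b → b < Ts k → ∀ z ∈ X b j,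
    ∑ x ∈ Finset.Ico b (b + Ts j), q j x ≤ cumLoss ℓ b (b + Ts j) z.1)

include hS hU hq in
theorem sum_levelSum_le_of_const {i u v : ℕ} (hi : i < k) (huv : u ≤ v) (hv : v ≤ Ts k)
    (hdu : Ts i ∣ u) (hdv : Ts i ∣ v) (hlev : ∀ x, u ≤ x → x < v → U (i + 1) x ∧ ¬ U i x)
    {z : Fin n × ℝ} (hz : ∀ w, u ≤ w → w < v → z ∈ X w i) :
    ∑ x ∈ Finset.Ico u v, levelSum k U q x ≤ cumLoss ℓ u v z.1 := by
  obtain ⟨d, hd⟩ : ∃ d, v = u + d * Ts i := by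
    obtain ⟨c, hc⟩ := Nat.dvd_sub hdv hdu
    exact ⟨c, by rw [mul_comm, ← hc]; omega⟩
  have hpos := hS.pos hi.le
  clear hdv
  induction d generalizing v with
  | zero => simp [hd, cumLoss]
  | succ d ih =>
    have hv' : v = (u + d * Ts i) + Ts i := by rw [hd]; ring
    set w := u + d * Ts i with hw
    have huw : u ≤ w := by omega
    have h1 := ih (v := w) huw (by omega) (fun x h1 h2 => hlev x h1 (by omega))
      (fun x h1 h2 => hz x h1 (by omega)) rfl
    have h2 := hq i hi w (hdu.add (dvd_mul_left _ _)) (by omega) z (hz w huw (by omega))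
    rw [← hv'] at h2
    rw [← Finset.sum_Ico_consecutive _ huw (by omega : w ≤ v),
      ← cumLoss_add ℓ huw (by omega : w ≤ v)]
    refine add_le_add h1 (le_trans (le_of_eq ?_) h2)
    refine Finset.sum_congr rfl fun x hx => ?_
    rw [Finset.mem_Ico] at hx
    obtain ⟨h3, h4⟩ := hlev x (by omega) hx.2
    exact hU.levelSum_eq hi (by omega) h3 h4

include hS hX hU hq in
/-- While an entry `z` stays in bucket `i`, the levels above `i` compete with `z` through its
forwarded copies and the entries which evict them. -/
theorem sum_levelSum_le_of_survives (hε : 0 ≤ ε) (hℓ : ∀ t e, 0 ≤ ℓ t e) {u₀ v₀ : ℕ}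
    (hv₀ : v₀ ≤ Ts k) (hU₀ : ∀ x, u₀ < x → x < v₀ → ∀ l < k, Ts l ∣ x → ¬ U l x) (p : ℕ) :
    ∀ i u v : ℕ, ∀ z : Fin n × ℝ, i < k → k - 1 - i ≤ p → u₀ ≤ u → u < v → v ≤ v₀ → Ts i ∣ u →
      Ts i ∣ v → (v = Ts k ∨ blockStart Ts k v ≤ u) → U (i + 1) u → ¬ U i u →
      (∀ w, u ≤ w → w < v → z ∈ X w i) →
      ∑ x ∈ Finset.Ico u v, levelSum k U q x ≤ (1 + ε) ^ p * cumLoss ℓ u v z.1 := by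
  have hε1 : (1 : ℝ) ≤ 1 + ε := by linarith
  induction p with
  | zero =>
    intro i u v z hi hp hu huv hv hdu hdv _ h1 h2 hz
    rw [pow_zero, one_mul]
    refine sum_levelSum_le_of_const hS hU hq hi huv.le (hv.trans hv₀) hdu hdv (fun x hx1 hx2 => ?_) hz
    have hik : i + 1 = k := by omega
    exact ⟨hik ▸ hU.top x, hU.not_of_block hS hi hU₀ hu hv hdu h2 hx1 hx2⟩
  | succ p ih =>
    intro i u v z hi hp hu huv hv hdu hdv hstr h1 h2 hz
    have hpos := hS.pos hi.le
    have hpos1 := hS.pos (i := i + 1) hi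
    have hnotU : ∀ x, u ≤ x → x < v → ¬ U i x := fun x hx1 hx2 =>
      hU.not_of_block hS hi hU₀ hu hv hdu h2 hx1 hx2
    -- The end of the block of size `Ts (i + 1)` containing `u`. Before `s` the chosen level is `i`,
    -- so `z` itself is the competitor; from `s` on its forwarded copies take over.
    set s := u / Ts (i + 1) * Ts (i + 1) + Ts (i + 1) with hs
    have hus : u < s := by
      rw [hs, ← Nat.succ_mul, ← Nat.div_lt_iff_lt_mul hpos1]
      exact Nat.lt_succ_self _
    have hsame : ∀ x, u ≤ x → x < s → U (i + 1) x := by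
      intro x hx1 hx2
      refine hU.congr (i + 1) hi u x (le_antisymm (Nat.div_le_div_right hx1) ?_) h1
      rw [hs, ← Nat.succ_mul, ← Nat.div_lt_iff_lt_mul hpos1] at hx2
      omega
    have hds : Ts (i + 1) ∣ s := (dvd_mul_left _ _).add dvd_rfl
    have hdsi : Ts i ∣ s := (hS.dvd_succ i hi).trans hds
    have hcn := cumLoss_nonneg ℓ hℓ
    have hpow : (1 : ℝ) ≤ (1 + ε) ^ (p + 1) := one_le_pow₀ hε1
    rcases le_or_gt v s with hvs | hsv
    · refine (sum_levelSum_le_of_const hS hU hq hi huv.le (hv.trans hv₀) hdu hdv (fun x hx1 hx2 =>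
        ⟨hsame x hx1 (by omega), hnotU x hx1 hx2⟩) hz).trans ?_
      exact le_mul_of_one_le_left (hcn _ _ _) hpow
    have hik : i + 1 < k := by
      by_contra hge
      have hk : i + 1 = k := by omega
      rw [hk] at hds
      have := Nat.le_of_dvd (by omega) hds
      omega
    have hfirst : ∑ x ∈ Finset.Ico u s, levelSum k U q x ≤
        (1 + ε) ^ (p + 1) * cumLoss ℓ u s z.1 := by
      refine (sum_levelSum_le_of_const hS hU hq hi hus.le (by omega) hdu hdsi (fun x hx1 hx2 =>
        ⟨hsame x hx1 (by omega), hnotU x hx1 (by omega)⟩)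
        fun w hw1 hw2 => hz w hw1 (by omega)).trans ?_
      exact le_mul_of_one_le_left (hcn _ _ _) hpow
    -- The rest is cut into stretches. Each starts at a time `w` when `z` is copied into bucket
    -- `topLevel Ts k w`, and ends when that copy is evicted, or at `v`. The invariant on `U` says
    -- that this bucket is the level chosen at `w`.
    have hrest : ∀ c w, v - w ≤ c → s ≤ w → w ≤ v → Ts (i + 1) ∣ w →
        (w < v → U (topLevel Ts k w + 1) w) →
        ∑ x ∈ Finset.Ico w v, levelSum k U q x ≤ (1 + ε) ^ (p + 1) * cumLoss ℓ w v z.1 := by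
      intro c
      induction c with
      | zero =>
        intro w h3 _ h5 _ _
        have : w = v := by omega
        simp [this, cumLoss]
      | succ c ihc =>
        intro w h3 hsw hwv hdw hUw
        rcases hwv.eq_or_lt with rfl | hwv
        · simp [cumLoss]
        replace hUw := hUw hwv
        have hw0 : Ts 0 ∣ w := hS.zero_dvd_of_dvd hi hdw
        have hij : i + 1 ≤ topLevel Ts k w := hS.le_topLevel hik hdw
        have hjk := hS.topLevel_lt w
        have hjw := hS.topLevel_dvd hw0
        set j := topLevel Ts k w with hj
        have hnUj : ¬ U j w := hU₀ w (by omega) (by omega) j hjk hjw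
        obtain ⟨t, ht⟩ : ∃ t, w = t + 1 := ⟨w - 1, by omega⟩
        have hzt : z ∈ keep Ts k ε ℓ (t + 1) (X t i) := by
          refine (hX.mem_and_lt_iff t (by omega) i hi (ht ▸ hS.dvd_of_le_topLevel hw0 (by omega)) z).1
            ⟨ht ▸ hz w (by omega) hwv, ?_⟩
          refine (hX.arrival_mem u (by omega) i hi z (hz u le_rfl huv)).2.trans_le ?_
          rw [← ht]
          exact_mod_cast (by omega : u + 1 ≤ w)
        obtain ⟨r, hr, hxr⟩ := hX.forward t (by omega) j hjk (ht ▸ hjw) i (by omega) z hzt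
        rw [← ht] at hr hxr
        have hfl : ⌊r⌋₊ = w := by
          rw [Nat.floor_eq_iff ((Nat.cast_nonneg w).trans hr.1)]
          exact ⟨hr.1, hr.2.trans (by linarith)⟩
        by_cases hsurv : ∀ w', w ≤ w' → w' < v → (z.1, r) ∈ X w' j
        · have hjv : Ts j ∣ v := by
            rcases hstr with rfl | hstr
            · exact hS.dvd_of_le hjk.le le_rfl
            · exact hS.dvd_of_blockStart_lt hjk (hS.zero_dvd_of_dvd hi.le hdv) hjw hwv.le (by omega)
          refine (ih j w v (z.1, r) hjk (by omega) (by omega) hwv hv hjw hjv ?_ hUw hnUj hsurv).trans ?_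
          · exact hstr.imp_right fun h => by omega
          · exact mul_le_mul_of_nonneg_right (pow_le_pow_right₀ hε1 (Nat.le_succ p)) (hcn _ _ _)
        · push Not at hsurv
          obtain ⟨w', hw1, hw2, hdw', htau, y, hy, hyr, hyl⟩ :=
            hX.exists_dominator hjk (hv.trans hv₀) hxr hsurv
          -- Eviction spares arrivals before `blockStart + 1 / 2`, while the copy arrived before `w
          -- + 1 / 2`. So `w` and `w'` share a block of size `Ts (topLevel Ts k w' + 1)`, which
          -- carries the invariant over to `w'`.
          have htau' : blockStart Ts k w' ≤ w := by
            have : (blockStart Ts k w' : ℝ) < w := by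
              have := hr.2
              simp only at htau
              linarith
            exact_mod_cast this.le
          have hylt : y.2 < (w : ℝ) + 1 := by
            have := hr.2
            simp only at hyr
            linarith
          have hymem : ∀ x, w ≤ x → x < w' → y ∈ X x j := by
            intro x hx1 hx2
            refine hX.persist hjk (by omega : x ≤ w' - 1) (by omega) hy (hylt.trans_le ?_)
            have : (w : ℝ) ≤ x := by exact_mod_cast hx1
            linarith
          have hyfl : ⌊y.2⌋₊ ≤ w := by
            have h0 := (hX.arrival_mem w (by omega) j hjk y (hymem w le_rfl hw1)).1
            exact Nat.lt_succ_iff.1 ((Nat.floor_lt h0).2 (by push_cast; exact hylt))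
          -- The evicting entry `y` may be older than the copy; dropping its losses before `w` only
          -- helps.
          have hyz : cumLoss ℓ w w' y.1 ≤ (1 + ε) * cumLoss ℓ w w' z.1 := by
            refine (cumLoss_mono_left ℓ hℓ hyfl w' y.1).trans ?_
            simpa only [hfl] using hyl
          have h4 : ∑ x ∈ Finset.Ico w w', levelSum k U q x ≤
              (1 + ε) ^ (p + 1) * cumLoss ℓ w w' z.1 := by
            refine (ih j w w' y hjk (by omega) (by omega) hw1 (by omega) hjw hdw' (Or.inr htau')
              hUw hnUj hymem).trans ?_
            rw [pow_succ, mul_assoc]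
            exact mul_le_mul_of_nonneg_left hyz (by positivity)
          have hw'0 : Ts 0 ∣ w' := hS.zero_dvd_of_dvd hjk.le hdw'
          have hjl : j ≤ topLevel Ts k w' := hS.le_topLevel hjk hdw'
          have h5 := ihc w' (by omega) (by omega) hw2.le
            ((hS.dvd_of_le hij hjk.le).trans hdw') fun _ => by
              refine hU.congr _ (hS.topLevel_lt w') w w'
                (hS.div_eq_of_blockStart_le htau' hw1.le) ?_
              exact hU.mono_le (by omega) (hS.topLevel_lt w') (by omega) hUw
          rw [← Finset.sum_Ico_consecutive _ hw1.le hw2.le, ← cumLoss_add ℓ hw1.le hw2.le, mul_add]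
          exact add_le_add h4 h5
    have hlast := hrest (v - s) s le_rfl le_rfl hsv.le hds fun _ => by
      have hl : i + 1 ≤ topLevel Ts k s := hS.le_topLevel hik hds
      rcases (Nat.succ_le_of_lt (hS.topLevel_lt s)).eq_or_lt with h | h
      · rw [← Nat.succ_eq_add_one, h]
        exact hU.top s
      -- Hence `s - 1` and `s` lie in one block of this size, and `U` passes from the first block to
      -- `s`.
      have hnd : ¬ Ts (topLevel Ts k s + 1) ∣ s := fun hd => by
        have := hS.le_topLevel h hd
        omega
      have hprev : U (topLevel Ts k s + 1) (s - 1) :=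
        hU.mono_le (by omega) (hS.topLevel_lt s) (by omega) (hsame (s - 1) (by omega) (by omega))
      refine hU.congr _ (hS.topLevel_lt s) (s - 1) s ?_ hprev
      obtain ⟨t, ht⟩ : ∃ t, s = t + 1 := ⟨s - 1, by omega⟩
      rw [ht] at hnd ⊢
      rw [Nat.add_sub_cancel, Nat.succ_div_of_not_dvd hnd]
    rw [← Finset.sum_Ico_consecutive _ hus.le hsv.le, ← cumLoss_add ℓ hus.le hsv.le, mul_add]
    exact add_le_add hfirst hlast

end Comparison

/-! ### The walk over good intervals -/

section Walk

variable {n : ℕ} (Ts : ℕ → ℕ) (k : ℕ) (ε : ℝ) (ℓ : ℕ → Fin n → ℝ) (star : Fin n)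

/-- Some entry of bucket `i` with content `Y` at time `s` stays up to time `v` and competes with
`star` on the days `s + 1, …, v`. -/
def CanJump (i s : ℕ) (Y : Set (Fin n × ℝ)) (v : ℕ) : Prop :=
  s < v ∧ v ≤ Ts k ∧ Ts i ∣ v ∧ (v = Ts k ∨ blockStart Ts k v ≤ s) ∧
    ∃ x ∈ evolve Ts k ε ℓ i s Y (v - 1 - s),
      cumLoss ℓ s v x.1 ≤ (1 + ε) * cumLoss ℓ s v star

/-- No entry of bucket `i` with content `Y` competes with `star` from time `s` on. -/
def Bad (i s : ℕ) (Y : Set (Fin n × ℝ)) : Prop := ∀ v, ¬ CanJump Ts k ε ℓ star i s Y v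

open Classical in
/-- The position of the walk after a visit of time `t` with bucket contents `Y`. -/
def nextPos (t : ℕ) (Y : ℕ → Set (Fin n × ℝ)) : ℕ :=
  if ∀ j ≤ topLevel Ts k t, Bad Ts k ε ℓ star j t (Y j) then t + Ts 0
  else Nat.findGreatest
    (CanJump Ts k ε ℓ star
      (Nat.findGreatest (fun j => ¬ Bad Ts k ε ℓ star j t (Y j)) (topLevel Ts k t)) t
      (Y (Nat.findGreatest (fun j => ¬ Bad Ts k ε ℓ star j t (Y j)) (topLevel Ts k t)))) (Ts k)

/-- The first time visited by the walk which is at least `t`. -/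
def pos (X : ℕ → ℕ → Set (Fin n × ℝ)) : ℕ → ℕ
  | 0 => 0
  | t + 1 => if pos X t = t then nextPos Ts k ε ℓ star t (X t) else pos X t

/-- The time `s` is visited and the levels from `i` up to the top level are bad. -/
def BadTime (X : ℕ → ℕ → Set (Fin n × ℝ)) (i s : ℕ) : Prop :=
  Ts i ∣ s ∧ pos Ts k ε ℓ star X s = s ∧
    ∀ j, i ≤ j → j ≤ topLevel Ts k s → Bad Ts k ε ℓ star j s (X s j)

variable {Ts k ε ℓ star}

theorem nextPos_cases (t : ℕ) (Y : ℕ → Set (Fin n × ℝ)) :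
    ((∀ j ≤ topLevel Ts k t, Bad Ts k ε ℓ star j t (Y j)) ∧
        nextPos Ts k ε ℓ star t Y = t + Ts 0) ∨
      ∃ i ≤ topLevel Ts k t,
        (∀ j, i < j → j ≤ topLevel Ts k t → Bad Ts k ε ℓ star j t (Y j)) ∧
        CanJump Ts k ε ℓ star i t (Y i) (nextPos Ts k ε ℓ star t Y) := by
  classical
  by_cases h : ∀ j ≤ topLevel Ts k t, Bad Ts k ε ℓ star j t (Y j)
  · exact Or.inl ⟨h, if_pos h⟩
  · refine Or.inr ?_
    have hdef : nextPos Ts k ε ℓ star t Y = _ := if_neg h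
    push Not at h
    obtain ⟨j, hj, hbad⟩ := h
    set i := Nat.findGreatest (fun j => ¬ Bad Ts k ε ℓ star j t (Y j)) (topLevel Ts k t) with hi
    have hib : ¬ Bad Ts k ε ℓ star i t (Y i) :=
      Nat.findGreatest_spec (P := fun j => ¬ Bad Ts k ε ℓ star j t (Y j)) hj hbad
    refine ⟨i, Nat.findGreatest_le _, fun j h1 h2 => ?_, ?_⟩
    · exact not_not.1 (Nat.findGreatest_is_greatest h1 h2)
    · rw [hdef]
      unfold Bad at hib
      push Not at hib
      obtain ⟨v, hv⟩ := hib
      exact Nat.findGreatest_spec (P := CanJump Ts k ε ℓ star i t (Y i)) hv.2.1 hv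

/-- When all higher levels are bad the walk uses level `i`, and it takes the farthest jump available
there. -/
theorem nextPos_eq_of_canJump {t i : ℕ} {Y : ℕ → Set (Fin n × ℝ)} (hi : i ≤ topLevel Ts k t)
    (hbad : ∀ j, i < j → j ≤ topLevel Ts k t → Bad Ts k ε ℓ star j t (Y j))
    (hjump : CanJump Ts k ε ℓ star i t (Y i) (Ts k)) : nextPos Ts k ε ℓ star t Y = Ts k := by
  classical
  have hib : ¬ Bad Ts k ε ℓ star i t (Y i) := fun h => h _ hjump
  have hdef : nextPos Ts k ε ℓ star t Y = _ := if_neg fun h => hib (h i hi)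
  have hfind : Nat.findGreatest (fun j => ¬ Bad Ts k ε ℓ star j t (Y j)) (topLevel Ts k t) = i := by
    rw [Nat.findGreatest_eq_iff]
    exact ⟨hi, fun _ => hib, fun j h1 h2 h3 => h3 (hbad j h1 h2)⟩
  rw [hdef, hfind]
  exact le_antisymm (Nat.findGreatest_le _) (Nat.le_findGreatest le_rfl hjump)

/-- The walk is adapted: whether `t` is visited is decided before the samples of time `t` are drawn.
-/
theorem pos_congr {X X' : ℕ → ℕ → Set (Fin n × ℝ)} {t : ℕ} (h : ∀ u < t, X u = X' u) :
    pos Ts k ε ℓ star X t = pos Ts k ε ℓ star X' t := by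
  induction t with
  | zero => rfl
  | succ t ih => simp only [pos, ih fun u hu => h u (by omega), h t (by omega)]

theorem BadTime.congr {X X' : ℕ → ℕ → Set (Fin n × ℝ)} {i s : ℕ} (h : ∀ u ≤ s, X u = X' u)
    (hb : BadTime Ts k ε ℓ star X i s) : BadTime Ts k ε ℓ star X' i s := by
  obtain ⟨h1, h2, h3⟩ := hb
  refine ⟨h1, ?_, ?_⟩
  · rw [← pos_congr fun u hu => h u hu.le]
    exact h2
  · rw [← h s le_rfl]
    exact h3

variable (hS : Sizes Ts k) (X : ℕ → ℕ → Set (Fin n × ℝ))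

set_option linter.unusedSectionVars false

include hS

theorem lt_nextPos (t : ℕ) (Y : ℕ → Set (Fin n × ℝ)) : t < nextPos Ts k ε ℓ star t Y := by
  rcases nextPos_cases (ε := ε) (ℓ := ℓ) (star := star) (k := k) (Ts := Ts) t Y with
    ⟨-, h⟩ | ⟨i, -, -, h⟩
  · rw [h]
    exact Nat.lt_add_of_pos_right hS.pos_zero
  · exact h.1

theorem pos_eq_nextPos {u t : ℕ} (hu : pos Ts k ε ℓ star X u = u) (h1 : u < t)
    (h2 : t ≤ nextPos Ts k ε ℓ star u (X u)) :
    pos Ts k ε ℓ star X t = nextPos Ts k ε ℓ star u (X u) := by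
  induction t, h1 using Nat.le_induction with
  | base => simp only [pos, hu, if_true]
  | succ t h1 ih =>
    have := ih (by omega)
    simp only [pos]
    rw [if_neg (by omega), this]

theorem exists_visited_le (t : ℕ) : ∃ u ≤ t, pos Ts k ε ℓ star X u = u ∧
    (u < t → t ≤ nextPos Ts k ε ℓ star u (X u) ∧
      pos Ts k ε ℓ star X t = nextPos Ts k ε ℓ star u (X u)) := by
  induction t with
  | zero => exact ⟨0, le_rfl, rfl, fun h => absurd h (lt_irrefl _)⟩
  | succ t ih =>
    obtain ⟨u, hu, hv, h⟩ := ih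
    by_cases ht : pos Ts k ε ℓ star X t = t
    · refine ⟨t, Nat.le_succ t, ht, fun _ => ⟨lt_nextPos hS t (X t), ?_⟩⟩
      simp only [pos, ht, if_true]
    · have hut : u < t := lt_of_le_of_ne hu fun h => ht (h ▸ hv)
      obtain ⟨h1, h2⟩ := h hut
      refine ⟨u, by omega, hv, fun _ => ⟨by omega, ?_⟩⟩
      simp only [pos]
      rw [if_neg ht, h2]

theorem nextPos_le_of_visited {u t : ℕ} (hu : pos Ts k ε ℓ star X u = u)
    (ht : pos Ts k ε ℓ star X t = t) (hut : u < t) : nextPos Ts k ε ℓ star u (X u) ≤ t := by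
  by_contra h
  have := pos_eq_nextPos hS X hu hut (by omega)
  omega

theorem nextPos_visited {u : ℕ} (hu : pos Ts k ε ℓ star X u = u) :
    pos Ts k ε ℓ star X (nextPos Ts k ε ℓ star u (X u)) = nextPos Ts k ε ℓ star u (X u) :=
  pos_eq_nextPos hS X hu (lt_nextPos hS u (X u)) le_rfl

theorem dvd_pos (t : ℕ) : Ts 0 ∣ pos Ts k ε ℓ star X t := by
  induction t with
  | zero => exact dvd_zero _
  | succ t ih =>
    simp only [pos]
    split_ifs with ht
    · rcases nextPos_cases (ε := ε) (ℓ := ℓ) (star := star) (k := k) (Ts := Ts) t (X t) with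
        ⟨-, h⟩ | ⟨i, hi, -, h⟩
      · rw [h]
        exact (ht ▸ ih).add dvd_rfl
      · exact hS.zero_dvd_of_dvd (hi.trans (hS.topLevel_lt t).le) h.2.2.1
    · exact ih

theorem visited_dvd {t : ℕ} (ht : pos Ts k ε ℓ star X t = t) : Ts 0 ∣ t := by
  have := dvd_pos (ε := ε) (ℓ := ℓ) (star := star) hS X t
  rwa [ht] at this

/-- The walk visits the start of every block in the interior of which it stops. -/
theorem badTime_parent {u j : ℕ} (hu : pos Ts k ε ℓ star X u = u) (huT : u < Ts k) (hj : j < k)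
    (hlev : topLevel Ts k u < j) : BadTime Ts k ε ℓ star X j (u / Ts j * Ts j) := by
  have hjpos := hS.pos hj.le
  set p := u / Ts j * Ts j with hp
  have hpu : p ≤ u := Nat.div_mul_le_self _ _
  have hup : u < p + Ts j := by
    rw [hp, ← Nat.succ_mul, ← Nat.div_lt_iff_lt_mul hjpos]
    exact Nat.lt_succ_self _
  have hdp : Ts j ∣ p := dvd_mul_left _ _
  have hne : p ≠ u := fun h => by
    have := hS.le_topLevel hj (h ▸ hdp)
    omega
  have hnot : ∀ v, p < v → v ≤ u → ¬ Ts j ∣ v := by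
    intro v h1 h2 h3
    have := add_le_of_dvd_of_lt hdp h3 h1
    omega
  -- A jump over `p` starts before `p` and lands at some `v ≤ u`. Its block condition makes `v` a
  -- multiple of `Ts j`, but there is none in `(p, u]`.
  have hpv : pos Ts k ε ℓ star X p = p := by
    obtain ⟨w, hwp, hw, h⟩ := exists_visited_le (ε := ε) (ℓ := ℓ) (star := star) hS X p
    rcases hwp.eq_or_lt with rfl | hlt
    · exact hw
    obtain ⟨h1, h2⟩ := h hlt
    rcases h1.eq_or_lt with h3 | h3
    · rw [h2, ← h3]
    exfalso
    have h4 := nextPos_le_of_visited hS X hw hu (by omega)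
    rcases nextPos_cases (ε := ε) (ℓ := ℓ) (star := star) (k := k) (Ts := Ts) w (X w) with
      ⟨-, h5⟩ | ⟨i, hi, -, h5⟩
    · have := add_le_of_dvd_of_lt (visited_dvd hS X hw) (hS.zero_dvd_of_dvd hj.le hdp) hlt
      omega
    · set v := nextPos Ts k ε ℓ star w (X w) with hv
      obtain ⟨-, -, h6, h7, -⟩ := h5
      have hik : i < k := hi.trans_lt (hS.topLevel_lt w)
      rcases h7 with h7 | h7
      · omega
      · exact hnot v h3 h4 (hS.dvd_of_blockStart_lt hj (hS.zero_dvd_of_dvd hik.le h6) hdp h3.le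
          (by omega))
  refine ⟨hdp, hpv, fun i hi1 hi2 => ?_⟩
  rcases nextPos_cases (ε := ε) (ℓ := ℓ) (star := star) (k := k) (Ts := Ts) p (X p) with
    ⟨h5, -⟩ | ⟨i', hi', h5, h6⟩
  · exact h5 i hi2
  -- A jump from `p` at a level at least `j` would land at a multiple of `Ts j` in `(p, u]`.
  · refine h5 i ?_ hi2
    by_contra hle
    have h7 := nextPos_le_of_visited hS X hpv hu (by omega)
    have hik : i' < k := hi'.trans_lt (hS.topLevel_lt p)
    exact hnot _ h6.1 h7 ((hS.dvd_of_le (by omega) hik.le).trans h6.2.2.1)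

/-- The days lying in a block of size `Ts j` whose start is bad at level `j`. -/
def BadDay (Ts : ℕ → ℕ) (k : ℕ) (ε : ℝ) (ℓ : ℕ → Fin n → ℝ) (star : Fin n)
    (X : ℕ → ℕ → Set (Fin n × ℝ)) (j x : ℕ) : Prop :=
  j < k → BadTime Ts k ε ℓ star X j (x / Ts j * Ts j)

/-- A bad start of a small block either starts the larger block as well, or lies in its interior,
where `badTime_parent` applies. At level `k` the condition `j < k` fails, so every day counts as bad
there. -/
theorem badDay_nested : Nested Ts k (BadDay Ts k ε ℓ star X) where
  top x h := absurd h (lt_irrefl _)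
  mono j hj x hx h hj1 := by
    have hb := h hj
    have hjpos := hS.pos hj.le
    have hdvd := hS.dvd_succ j hj
    set b := x / Ts j * Ts j with hbdef
    have hbx : b ≤ x := Nat.div_mul_le_self _ _
    have hblock : b / Ts (j + 1) = x / Ts (j + 1) := by
      obtain ⟨c, hc⟩ := hdvd
      rw [hc, ← Nat.div_div_eq_div_mul, ← Nat.div_div_eq_div_mul, hbdef,
        Nat.mul_div_cancel _ hjpos]
    rw [← hblock]
    have hb0 := visited_dvd hS X hb.2.1
    by_cases hd : Ts (j + 1) ∣ b
    · rw [Nat.div_mul_cancel hd]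
      exact ⟨hd, hb.2.1, fun i h1 h2 => hb.2.2 i (by omega) h2⟩
    · refine badTime_parent hS X hb.2.1 (by omega) hj1 ?_
      by_contra hle
      exact hd (hS.dvd_of_le_topLevel hb0 (by omega))
  congr j _ x y hxy h hj := by
    rw [← hxy]
    exact h hj

/-- The levels chosen by the walk compete with `star`. -/
theorem sum_levelSum_le (hX : BucketPath Ts k ε ℓ X) {q : ℕ → ℕ → ℝ}
    (hq : ∀ j < k, ∀ b, Ts j ∣ b → b < Ts k → ∀ z ∈ X b j,
      ∑ x ∈ Finset.Ico b (b + Ts j), q j x ≤ cumLoss ℓ b (b + Ts j) z.1)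
    (hε : 0 ≤ ε) (hℓ : ∀ t e, 0 ≤ ℓ t e) :
    ∑ x ∈ Finset.range (Ts k), levelSum k (BadDay Ts k ε ℓ star X) q x ≤
      (1 + ε) ^ k * cumLoss ℓ 0 (Ts k) star := by
  have hε1 : (1 : ℝ) ≤ 1 + ε := by linarith
  have hcn := cumLoss_nonneg ℓ hℓ
  have hU := badDay_nested (ε := ε) (ℓ := ℓ) (star := star) hS X
  have main : ∀ c u, Ts k - u ≤ c → u ≤ Ts k → pos Ts k ε ℓ star X u = u →
      ∑ x ∈ Finset.Ico u (Ts k), levelSum k (BadDay Ts k ε ℓ star X) q x ≤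
        (1 + ε) ^ k * cumLoss ℓ u (Ts k) star := by
    intro c
    induction c with
    | zero =>
      intro u h1 h2 _
      have : u = Ts k := by omega
      simp [this, cumLoss]
    | succ c ih =>
      intro u h1 h2 hu
      rcases h2.eq_or_lt with rfl | huT
      · simp [cumLoss]
      have hu0 := visited_dvd hS X hu
      have hlt := lt_nextPos (ε := ε) (ℓ := ℓ) (star := star) hS u (X u)
      have hnv := nextPos_visited hS X hu
      set v := nextPos Ts k ε ℓ star u (X u) with hv
      suffices hsuff : v ≤ Ts k ∧ ∑ x ∈ Finset.Ico u v,
          levelSum k (BadDay Ts k ε ℓ star X) q x ≤ (1 + ε) ^ k * cumLoss ℓ u v star by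
        rw [← Finset.sum_Ico_consecutive _ hlt.le hsuff.1, ← cumLoss_add ℓ hlt.le hsuff.1, mul_add]
        exact add_le_add hsuff.2 (ih v (by omega) hsuff.1 hnv)
      rcases nextPos_cases (ε := ε) (ℓ := ℓ) (star := star) (k := k) (Ts := Ts) u (X u) with
        ⟨h5, h6⟩ | ⟨i, hi, h5, h6⟩
      · have h7 : u + Ts 0 ≤ Ts k :=
          add_le_of_dvd_of_lt hu0 (hS.dvd_of_le (Nat.zero_le k) le_rfl) huT
        rw [← hv] at h6
        refine ⟨h6 ▸ h7, ?_⟩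
        -- All updated levels are bad: the next `Ts 0` days lie in `BadDay` at level `0` and are
        -- assigned the value `0`. Their actual loss is charged separately.
        rw [Finset.sum_eq_zero]
        · exact mul_nonneg (by positivity) (hcn _ _ _)
        intro x hx
        rw [Finset.mem_Ico] at hx
        refine hU.levelSum_eq_zero (by omega) fun _ => ?_
        have : x / Ts 0 * Ts 0 = u := by
          have hx2 : x < u + Ts 0 := h6 ▸ hx.2
          obtain ⟨d, hd⟩ := hu0
          rw [mul_comm] at hd
          rw [hd] at hx hx2 ⊢
          congr 1
          exact Nat.div_eq_of_lt_le hx.1 (by rw [Nat.succ_mul]; exact hx2)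
        rw [this]
        exact ⟨hu0, hu, fun j _ hj => h5 j hj⟩
      · rw [← hv] at h6
        obtain ⟨-, h7, h8, h9, z, hz, hzl⟩ := h6
        have hik : i < k := hi.trans_lt (hS.topLevel_lt u)
        refine ⟨h7, ?_⟩
        have hdu := hS.dvd_of_le_topLevel hu0 hi
        rw [hX.mem_evolve_iff hik (by omega)] at hz
        have hzX : ∀ w, u ≤ w → w < v → z ∈ X w i := by
          intro w hw1 hw2
          refine hX.persist hik (by omega : w ≤ u + (v - 1 - u)) (by omega) hz.1
            (hz.2.trans_le ?_)
          have : (u : ℝ) ≤ w := by exact_mod_cast hw1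
          linarith
        have hunvisited : ∀ x, u < x → x < v → ∀ l < k, Ts l ∣ x →
            ¬ BadDay Ts k ε ℓ star X l x := by
          intro x hx1 hx2 l hl hdl hbad
          have hb := (hbad hl).2.1
          rw [Nat.div_mul_cancel hdl] at hb
          have := nextPos_le_of_visited hS X hu hb hx1
          omega
        -- If `i` is the top level, the surrounding block is bad because the walk stops in its
        -- interior; otherwise level `i + 1` and the levels above it are bad at `u` itself.
        have hUi : BadDay Ts k ε ℓ star X (i + 1) u := by
          intro hi1
          rcases hi.eq_or_lt with heq | hilt
          · exact badTime_parent hS X hu huT hi1 (by omega)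
          · have hd := hS.dvd_of_le_topLevel hu0 hilt
            rw [Nat.div_mul_cancel hd]
            exact ⟨hd, hu, fun j hj1 hj2 => h5 j hj1 hj2⟩
        have hnUi : ¬ BadDay Ts k ε ℓ star X i u := by
          intro hbad
          have hb := (hbad hik).2.2
          rw [Nat.div_mul_cancel hdu] at hb
          refine hb i le_rfl hi v ⟨hlt, h7, h8, h9, z, ?_, hzl⟩
          rw [hX.mem_evolve_iff hik (by omega)]
          exact hz
        have h10 := sum_levelSum_le_of_survives hS hX hU hq hε hℓ h7 hunvisited (k - 1) i u v z hik
          (by omega) le_rfl hlt le_rfl hdu h8 h9 hUi hnUi hzX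
        refine h10.trans ?_
        -- At most `k - 1` factors come from evicted copies, and one more from the entry `z` against
        -- `star`.
        have hk : k = (k - 1) + 1 := by have := hS.k_pos; omega
        calc (1 + ε) ^ (k - 1) * cumLoss ℓ u v z.1
            ≤ (1 + ε) ^ (k - 1) * ((1 + ε) * cumLoss ℓ u v star) := by gcongr
          _ = (1 + ε) ^ (k - 1 + 1) * cumLoss ℓ u v star := by ring
          _ = (1 + ε) ^ k * cumLoss ℓ u v star := by rw [← hk]
  rw [Finset.range_eq_Ico]
  exact main (Ts k) 0 (by omega) (Nat.zero_le _) rfl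

end Walk

/-! ### Combining the levels -/

section Mixing

theorem sum_range_le_of_blocks {f g : ℕ → ℝ} {d N : ℕ} (hd : d ∣ N)
    (h : ∀ b, d ∣ b → b < N →
      ∑ x ∈ Finset.Ico b (b + d), f x ≤ ∑ x ∈ Finset.Ico b (b + d), g x) :
    ∑ x ∈ Finset.range N, f x ≤ ∑ x ∈ Finset.range N, g x := by
  rcases Nat.eq_zero_or_pos d with rfl | hpos
  · rw [zero_dvd_iff.1 hd]
    simp
  obtain ⟨c, rfl⟩ := hd
  have key : ∀ c' ≤ c, ∑ x ∈ Finset.range (d * c'), f x ≤ ∑ x ∈ Finset.range (d * c'), g x := by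
    intro c' hc'
    induction c' with
    | zero => simp
    | succ c' ih =>
      have h1 := ih (by omega)
      have h2 := h (d * c') (dvd_mul_right _ _) (Nat.mul_lt_mul_of_pos_left hc' hpos)
      rw [mul_add, mul_one, ← Finset.sum_range_add_sum_Ico f (Nat.le_add_right (d * c') d),
        ← Finset.sum_range_add_sum_Ico g (Nat.le_add_right (d * c') d)]
      exact add_le_add h1 h2
  exact key c le_rfl

variable {Ts : ℕ → ℕ} {k : ℕ} (hS : Sizes Ts k) {U : ℕ → ℕ → Prop} (hU : Nested Ts k U)

theorem div_eq_of_mem_block {d b x : ℕ} (hd : d ∣ b) (h1 : b ≤ x) (h2 : x < b + d) :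
    b / d = x / d := by
  obtain ⟨c, rfl⟩ := hd
  have hpos : 0 < d := by omega
  rw [Nat.mul_div_cancel_left _ hpos]
  refine (Nat.div_eq_of_lt_le (by rwa [mul_comm]) ?_).symm
  rw [Nat.succ_mul, mul_comm c d]
  exact h2

include hU in
theorem Nested.iff_of_mem_block {i j b x : ℕ} (hS : Sizes Ts k) (hij : i ≤ j) (hj : j ≤ k)
    (hd : Ts i ∣ b) (h1 : b ≤ x) (h2 : x < b + Ts i) : U j x ↔ U j b := by
  have h3 := div_eq_of_mem_block hd h1 h2
  obtain ⟨c, hc⟩ := hS.dvd_of_le hij hj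
  have h4 : b / Ts j = x / Ts j := by
    rw [hc, ← Nat.div_div_eq_div_mul, ← Nat.div_div_eq_div_mul, h3]
  exact ⟨hU.congr j hj x b h4.symm, hU.congr j hj b x h4⟩

open Classical in
include hS hU in
/-- The prediction of the top level competes with the picks of the chosen levels. -/
theorem sum_prediction_le {E Y : ℕ → ℕ → ℝ} {ρ : ℕ → ℝ} (hE : ∀ x, E 0 x ≤ 1)
    (hY0 : ∀ x < Ts k, Y 0 x = E 0 x)
    (hYE : ∀ j, j + 1 < k → ∀ b, Ts (j + 1) ∣ b → b < Ts k →
      ∑ x ∈ Finset.Ico b (b + Ts (j + 1)), Y (j + 1) x ≤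
        ∑ x ∈ Finset.Ico b (b + Ts (j + 1)), (E (j + 1) x + ρ (j + 1)))
    (hYY : ∀ j, j + 1 < k → ∀ b, Ts (j + 1) ∣ b → b < Ts k →
      ∑ x ∈ Finset.Ico b (b + Ts (j + 1)), Y (j + 1) x ≤
        ∑ x ∈ Finset.Ico b (b + Ts (j + 1)), (Y j x + ρ (j + 1)))
    (hρ : 0 ≤ ρ 0) :
    ∑ x ∈ Finset.range (Ts k), Y (k - 1) x ≤
      ∑ x ∈ Finset.range (Ts k), ((if U 0 x then 1 else 0) +
        ∑ j ∈ Finset.range k, ((if U (j + 1) x ∧ ¬ U j x then E j x else 0) +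
          if U (j + 1) x then ρ j else 0)) := by
  have key : ∀ i < k, ∑ x ∈ Finset.range (Ts k), (if U (i + 1) x then Y i x else 0) ≤
      ∑ x ∈ Finset.range (Ts k), ((if U 0 x then 1 else 0) +
        ∑ j ∈ Finset.range (i + 1), ((if U (j + 1) x ∧ ¬ U j x then E j x else 0) +
          if U (j + 1) x then ρ j else 0)) := by
    intro i
    induction i with
    | zero =>
      intro _
      -- Days with `U 0` are charged the trivial loss `1`; on the others the prediction of level `0`
      -- is its pick.
      refine Finset.sum_le_sum fun x hx => ?_
      rw [Finset.mem_range] at hx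
      have := hE x
      simp only [zero_add, Finset.sum_range_one, hY0 x hx]
      by_cases h0 : U 0 x <;> by_cases h1 : U 1 x <;> simp [h0, h1] <;> linarith
    | succ i ih =>
      intro hi
      -- Both predicates are constant on blocks of size `Ts (i + 1)`, so on each block one can
      -- follow the lower prediction if `U (i + 1)` holds and the own pick if not.
      have hstep : ∑ x ∈ Finset.range (Ts k), (if U (i + 2) x then Y (i + 1) x else 0) ≤
          ∑ x ∈ Finset.range (Ts k), ((if U (i + 1) x then Y i x else 0) +
            ((if U (i + 2) x ∧ ¬ U (i + 1) x then E (i + 1) x else 0) +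
              if U (i + 2) x then ρ (i + 1) else 0)) := by
        refine sum_range_le_of_blocks (d := Ts (i + 1)) (hS.dvd_of_le hi.le le_rfl) fun b hb hbT => ?_
        have hU1 : ∀ x ∈ Finset.Ico b (b + Ts (i + 1)), (U (i + 1) x ↔ U (i + 1) b) := by
          intro x hx
          rw [Finset.mem_Ico] at hx
          exact hU.iff_of_mem_block hS le_rfl hi.le hb hx.1 hx.2
        have hU2 : ∀ x ∈ Finset.Ico b (b + Ts (i + 1)), (U (i + 2) x ↔ U (i + 2) b) := by
          intro x hx
          rw [Finset.mem_Ico] at hx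
          exact hU.iff_of_mem_block hS (Nat.le_succ _) hi hb hx.1 hx.2
        rw [Finset.sum_congr rfl fun x hx => if_congr (hU2 x hx) rfl rfl,
          Finset.sum_congr rfl fun x hx => congrArg₂ (· + ·) (if_congr (hU1 x hx) rfl rfl)
            (congrArg₂ (· + ·) (if_congr (and_congr (hU2 x hx) (not_congr (hU1 x hx))) rfl rfl)
              (if_congr (hU2 x hx) rfl rfl))]
        have hmono := hU.mono (i + 1) hi b hbT
        by_cases h2 : U (i + 2) b
        · by_cases h1 : U (i + 1) b
          · simpa [h1, h2] using hYY i hi b hb hbT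
          · simpa [h1, h2] using hYE i hi b hb hbT
        · have h1 : ¬ U (i + 1) b := fun h => h2 (hmono h)
          simp [h1, h2]
      refine hstep.trans ?_
      rw [Finset.sum_add_distrib]
      refine (add_le_add_left (ih (by omega)) _).trans (le_of_eq ?_)
      rw [← Finset.sum_add_distrib]
      refine Finset.sum_congr rfl fun x _ => ?_
      rw [Finset.sum_range_succ _ (i + 1), add_assoc]
  have hk : k - 1 + 1 = k := by have := hS.k_pos; omega
  have h := key (k - 1) (by omega)
  rw [hk] at h
  simpa only [hU.top, if_true] using h

open Classical in
/-- The number of days in bad blocks is bounded by the number of bad block starts. -/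
theorem card_badDay_le {n : ℕ} {ε : ℝ} {ℓ : ℕ → Fin n → ℝ} {star : Fin n}
    (hS : Sizes Ts k) (X : ℕ → ℕ → Set (Fin n × ℝ)) {j : ℕ} (hj : j < k) :
    ∑ x ∈ Finset.range (Ts k), (if BadDay Ts k ε ℓ star X j x then (1 : ℝ) else 0) ≤
      Ts j * ((Finset.range (Ts k)).filter fun s => BadTime Ts k ε ℓ star X j s).card := by
  have hU := badDay_nested (ε := ε) (ℓ := ℓ) (star := star) hS X
  have h1 : ∑ x ∈ Finset.range (Ts k), (if BadDay Ts k ε ℓ star X j x then (1 : ℝ) else 0) ≤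
      ∑ x ∈ Finset.range (Ts k), if BadTime Ts k ε ℓ star X j x then (Ts j : ℝ) else 0 := by
    refine sum_range_le_of_blocks (d := Ts j) (hS.dvd_of_le hj.le le_rfl) fun b hb hbT => ?_
    have hpos := hS.pos hj.le
    rw [Finset.sum_congr rfl fun x hx => if_congr (hU.iff_of_mem_block hS le_rfl hj.le hb
      (Finset.mem_Ico.1 hx).1 (Finset.mem_Ico.1 hx).2) rfl rfl]
    have hiff : BadDay Ts k ε ℓ star X j b ↔ BadTime Ts k ε ℓ star X j b := by
      unfold BadDay
      rw [Nat.div_mul_cancel hb]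
      exact ⟨fun h => h hj, fun h _ => h⟩
    calc ∑ x ∈ Finset.Ico b (b + Ts j), (if BadDay Ts k ε ℓ star X j b then (1 : ℝ) else 0)
        = if BadTime Ts k ε ℓ star X j b then (Ts j : ℝ) else 0 := by
          rw [Finset.sum_const, if_congr hiff rfl rfl]
          simp
      _ ≤ _ := Finset.single_le_sum
          (f := fun x => if BadTime Ts k ε ℓ star X j x then (Ts j : ℝ) else 0)
          (fun x _ => by positivity) (Finset.mem_Ico.2 ⟨le_rfl, by omega⟩)
  refine h1.trans (le_of_eq ?_)
  rw [← Finset.sum_filter, Finset.sum_const, nsmul_eq_mul, mul_comm]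

end Mixing

/-! ### The total loss on a good trajectory -/

section TotalLoss

variable {n : ℕ} {Ts : ℕ → ℕ} {k : ℕ} {ε : ℝ} {ℓ : ℕ → Fin n → ℝ} {star : Fin n}

open Classical in
-- Level `j` pays `ρ j` for the mixing and `ρ j` for its picks against the bucket, whence the factor
-- `2`, and only on days with `U (j + 1)`. The term `Ts 0 * Z` bounds the number of days with `U 0`.
theorem total_loss_le (hS : Sizes Ts k) {X : ℕ → ℕ → Set (Fin n × ℝ)}
    (hX : BucketPath Ts k ε ℓ X) (hε : 0 ≤ ε) (hℓ : ∀ t e, 0 ≤ ℓ t e)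
    {E Y : ℕ → ℕ → ℝ} {ρ : ℕ → ℝ} {Z : ℝ} (hρ : ∀ j, 0 ≤ ρ j) (hE : ∀ x, E 0 x ≤ 1)
    (hEX : ∀ j < k, ∀ b, Ts j ∣ b → b < Ts k → ∀ z ∈ X b j,
      ∑ x ∈ Finset.Ico b (b + Ts j), (E j x - ρ j) ≤ cumLoss ℓ b (b + Ts j) z.1)
    (hY0 : ∀ x < Ts k, Y 0 x = E 0 x)
    (hYE : ∀ j, j + 1 < k → ∀ b, Ts (j + 1) ∣ b → b < Ts k →
      ∑ x ∈ Finset.Ico b (b + Ts (j + 1)), Y (j + 1) x ≤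
        ∑ x ∈ Finset.Ico b (b + Ts (j + 1)), (E (j + 1) x + ρ (j + 1)))
    (hYY : ∀ j, j + 1 < k → ∀ b, Ts (j + 1) ∣ b → b < Ts k →
      ∑ x ∈ Finset.Ico b (b + Ts (j + 1)), Y (j + 1) x ≤
        ∑ x ∈ Finset.Ico b (b + Ts (j + 1)), (Y j x + ρ (j + 1)))
    (hZ : ∀ j < k,
      (((Finset.range (Ts k)).filter fun s => BadTime Ts k ε ℓ star X j s).card : ℝ) ≤ Z) :
    ∑ x ∈ Finset.range (Ts k), Y (k - 1) x ≤
      (1 + ε) ^ k * cumLoss ℓ 0 (Ts k) star + Ts 0 * Z +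
        ∑ j ∈ Finset.range k, 2 * ρ j * (if j + 1 < k then Ts (j + 1) * Z else Ts k) := by
  have hU := badDay_nested (ε := ε) (ℓ := ℓ) (star := star) hS X
  set U := BadDay Ts k ε ℓ star X with hUdef
  have hcount : ∀ j < k, ∑ x ∈ Finset.range (Ts k), (if U j x then (1 : ℝ) else 0) ≤ Ts j * Z :=
    fun j hj => (card_badDay_le hS X hj).trans
      (mul_le_mul_of_nonneg_left (hZ j hj) (Nat.cast_nonneg _))
  have hcount' : ∀ j < k, ∑ x ∈ Finset.range (Ts k), (if U (j + 1) x then (1 : ℝ) else 0) ≤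
      if j + 1 < k then Ts (j + 1) * Z else (Ts k : ℝ) := by
    intro j hj
    split_ifs with h
    · exact hcount (j + 1) h
    · calc ∑ x ∈ Finset.range (Ts k), (if U (j + 1) x then (1 : ℝ) else 0)
          ≤ ∑ x ∈ Finset.range (Ts k), (1 : ℝ) :=
            Finset.sum_le_sum fun x _ => by split_ifs <;> norm_num
        _ = Ts k := by simp
  refine (sum_prediction_le hS hU hE hY0 hYE hYY (hρ 0)).trans ?_
  have hpoint : ∀ x, ((if U 0 x then (1 : ℝ) else 0) +
      ∑ j ∈ Finset.range k, ((if U (j + 1) x ∧ ¬ U j x then E j x else 0) +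
        if U (j + 1) x then ρ j else 0)) ≤
      (if U 0 x then (1 : ℝ) else 0) + levelSum k U (fun j x => E j x - ρ j) x +
        ∑ j ∈ Finset.range k, 2 * ρ j * (if U (j + 1) x then (1 : ℝ) else 0) := by
    intro x
    rw [add_assoc, levelSum, ← Finset.sum_add_distrib]
    refine add_le_add_right (Finset.sum_le_sum fun j _ => ?_) _
    have := hρ j
    by_cases h1 : U (j + 1) x <;> by_cases h0 : U j x <;> simp [h0, h1] <;> linarith
  refine (Finset.sum_le_sum fun x _ => hpoint x).trans ?_
  rw [Finset.sum_add_distrib, Finset.sum_add_distrib, Finset.sum_comm (s := Finset.range (Ts k))]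
  have h1 := hcount 0 hS.k_pos
  have h2 := sum_levelSum_le (star := star) hS X hX hEX hε hℓ
  have h3 : ∑ j ∈ Finset.range k, ∑ x ∈ Finset.range (Ts k),
      2 * ρ j * (if U (j + 1) x then (1 : ℝ) else 0) ≤
      ∑ j ∈ Finset.range k, 2 * ρ j * (if j + 1 < k then Ts (j + 1) * Z else (Ts k : ℝ)) := by
    refine Finset.sum_le_sum fun j hj => ?_
    rw [← Finset.mul_sum]
    exact mul_le_mul_of_nonneg_left (hcount' j (Finset.mem_range.1 hj))
      (mul_nonneg zero_le_two (hρ j))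
  linarith

end TotalLoss

/-! ### Planting the comparator among the samples -/

section Planting

variable {n : ℕ} {Ts : ℕ → ℕ} {k : ℕ} {ε : ℝ} {ℓ : ℕ → Fin n → ℝ} {star : Fin n}

/-- The entries with experts `S r` and arrival times `arr r`. -/
def sampleSet {m : ℕ} (S : Fin m → Fin n) (arr : Fin m → ℝ) : Set (Fin n × ℝ) :=
  Set.range fun r => (S r, arr r)

/-- Replace the samples in the slots `R` by `star`. -/
def plant {ι α : Type*} [DecidableEq ι] (star : α) (R : Finset ι) (S : ι → α) : ι → α :=
  fun r => if r ∈ R then star else S r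

theorem plant_empty {ι α : Type*} [DecidableEq ι] (star : α) (S : ι → α) :
    plant star ∅ S = S := by
  funext r
  simp [plant]

/-- Consider the earliest planted copy of `star`. The entries arrived before it are those of the
unplanted bucket and evolve in the same way. One that evicts the copy would compete with `star` up
to that time and so permit a jump in the unplanted bucket, contradicting badness. Hence the copy
stays to the end. -/
theorem canJump_of_plant (hS : Sizes Ts k) (hε : 0 ≤ ε) (hℓ : ∀ t e, 0 ≤ ℓ t e) {m i t : ℕ}
    (hi : i < k) (ht : t < Ts k) {base : Set (Fin n × ℝ)} {arr : Fin m → ℝ}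
    (harr : ∀ r, arr r ∈ Set.Ico ((t : ℝ) + 1 / 2) (t + 1))
    {S : Fin m → Fin n} (hbad : Bad Ts k ε ℓ star i t (base ∪ sampleSet S arr))
    {R : Finset (Fin m)} (hR : R.Nonempty) :
    CanJump Ts k ε ℓ star i t (base ∪ sampleSet (plant star R S) arr) (Ts k) := by
  obtain ⟨r₀, hr₀, hmin⟩ := R.exists_min_image arr hR
  set Y := base ∪ sampleSet S arr with hY
  set Y' := base ∪ sampleSet (plant star R S) arr with hY'
  have hsub : {x ∈ Y' | x.2 < arr r₀} ⊆ {x ∈ Y | x.2 < arr r₀} := by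
    rintro x ⟨hx | ⟨r, rfl⟩, hlt⟩
    · exact ⟨Or.inl hx, hlt⟩
    · refine ⟨Or.inr ⟨r, ?_⟩, hlt⟩
      have hr : r ∉ R := fun hr => absurd (hmin r hr) (not_le.2 hlt)
      simp [plant, hr]
  have hsub' : {x ∈ Y | x.2 < arr r₀} ⊆ {x ∈ Y' | x.2 < arr r₀} := by
    rintro x ⟨hx | ⟨r, rfl⟩, hlt⟩
    · exact ⟨Or.inl hx, hlt⟩
    · refine ⟨Or.inr ⟨r, ?_⟩, hlt⟩
      have hr : r ∉ R := fun hr => absurd (hmin r hr) (not_le.2 hlt)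
      simp [plant, hr]
  have heq : {x ∈ Y' | x.2 < arr r₀} = {x ∈ Y | x.2 < arr r₀} := hsub.antisymm hsub'
  have hev : ∀ d, {x ∈ evolve Ts k ε ℓ i t Y' d | x.2 < arr r₀} =
      {x ∈ evolve Ts k ε ℓ i t Y d | x.2 < arr r₀} := by
    intro d
    rw [← evolve_sep, heq, evolve_sep]
  have hfl : ⌊arr r₀⌋₊ = t := by
    have h0 := harr r₀
    have ht0 := Nat.cast_nonneg (α := ℝ) t
    rw [Nat.floor_eq_iff (by linarith [h0.1])]
    exact ⟨by linarith [h0.1], h0.2⟩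
  have hmem : ∀ d, t + d < Ts k → (star, arr r₀) ∈ evolve Ts k ε ℓ i t Y' d := by
    intro d
    induction d with
    | zero =>
      intro _
      refine Or.inr ⟨r₀, ?_⟩
      simp [plant, hr₀]
    | succ d ih =>
      intro hd
      have ih' := ih (by omega)
      simp only [evolve]
      split_ifs with hdvd
      · refine ⟨ih', ?_⟩
        rintro ⟨htau, x', hx', hlt, hdom⟩
        have hx'Y : x' ∈ evolve Ts k ε ℓ i t Y d := by
          have : x' ∈ {x ∈ evolve Ts k ε ℓ i t Y' d | x.2 < arr r₀} := ⟨hx', hlt⟩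
          rw [hev] at this
          exact this.1
        refine hbad (t + d + 1) ⟨by omega, by omega, hdvd, Or.inr ?_, x', ?_, ?_⟩
        · have : (blockStart Ts k (t + d + 1) : ℝ) < t + 1 := by
            have := (harr r₀).2
            simp only at htau
            linarith
          exact Nat.lt_succ_iff.1 (by exact_mod_cast this)
        · have : t + d + 1 - 1 - t = d := by omega
          rw [this]
          exact hx'Y
        · simp only [hfl] at hdom
          refine (cumLoss_mono_left ℓ hℓ ?_ _ _).trans hdom
          refine Nat.lt_succ_iff.1 ((Nat.floor_lt' (Nat.succ_ne_zero t)).2 ?_)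
          push_cast
          simp only at hlt
          exact hlt.trans (harr r₀).2
      · exact ih'
  refine ⟨ht, le_rfl, hS.dvd_of_le hi.le le_rfl, Or.inl rfl, _, hmem _ (by omega), ?_⟩
  exact le_mul_of_one_le_left (cumLoss_nonneg ℓ hℓ _ _ _) (by linarith)

/-- Planting `star` where it already is changes nothing, yet it would make the bucket good. -/
theorem ne_star_of_bad (hS : Sizes Ts k) (hε : 0 ≤ ε) (hℓ : ∀ t e, 0 ≤ ℓ t e) {m i t : ℕ}
    (hi : i < k) (ht : t < Ts k) {base : Set (Fin n × ℝ)} {arr : Fin m → ℝ}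
    (harr : ∀ r, arr r ∈ Set.Ico ((t : ℝ) + 1 / 2) (t + 1))
    {S : Fin m → Fin n} (hbad : Bad Ts k ε ℓ star i t (base ∪ sampleSet S arr)) (r : Fin m) :
    S r ≠ star := by
  intro h
  have h1 := canJump_of_plant hS hε hℓ hi ht harr hbad (Finset.singleton_nonempty r)
  have h2 : plant star {r} S = S := by
    funext r'
    by_cases hr : r' = r
    · simp [plant, hr, h]
    · simp [plant, hr]
  rw [h2] at h1
  exact hbad _ h1

open Classical in
-- Allowing one more slot multiplies the family of planted samples by at least `card α / (card α -
-- 1)`: the new configurations, with `star` in that slot, are disjoint from the old ones, and at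
-- most `card α - 1` old ones map to the same new one.
theorem card_mul_pow_le_of_plant {κ ι α : Type*} [Fintype κ] [DecidableEq κ] [Fintype ι]
    [DecidableEq ι] [Fintype α] (i : κ)
    (star : α) (B : Finset (κ → ι → α)) (hB : ∀ S ∈ B, ∀ r, S i r ≠ star) (M : Finset ι)
    (G : Finset (κ → ι → α))
    (hG : ∀ S ∈ B, ∀ R ⊆ M, Function.update S i (plant star R (S i)) ∈ G) :
    B.card * Fintype.card α ^ M.card ≤ G.card * (Fintype.card α - 1) ^ M.card := by
  set C : Finset ι → Finset (κ → ι → α) := fun M => Finset.univ.filter fun S => ∃ S₀ ∈ B, ∃ R ⊆ M,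
    S = Function.update S₀ i (plant star R (S₀ i)) with hC
  suffices h : B.card * Fintype.card α ^ M.card ≤ (C M).card * (Fintype.card α - 1) ^ M.card by
    refine h.trans (Nat.mul_le_mul_right _ (Finset.card_le_card fun S hS => ?_))
    obtain ⟨S₀, h0, R, hR, rfl⟩ := (Finset.mem_filter.1 hS).2
    exact hG S₀ h0 R hR
  clear hG
  induction M using Finset.induction_on with
  | empty =>
    simp only [Finset.card_empty, pow_zero, mul_one]
    refine Finset.card_le_card fun S hS => ?_
    simp only [hC, Finset.mem_filter, Finset.mem_univ, true_and]
    refine ⟨S, hS, ∅, subset_rfl, ?_⟩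
    rw [plant_empty, Function.update_eq_self]
  | insert r M hr ih =>
    set φ : (κ → ι → α) → κ → ι → α := fun S => Function.update S i (plant star {r} (S i)) with hφ
    have hne : ∀ S ∈ C M, S i r ≠ star := by
      intro S hS
      simp only [hC, Finset.mem_filter, Finset.mem_univ, true_and] at hS
      obtain ⟨S₀, h0, R, hR, rfl⟩ := hS
      have : r ∉ R := fun h => hr (hR h)
      simpa [plant, this] using hB S₀ h0 r
    have himage : (C M).card ≤ (Fintype.card α - 1) * ((C M).image φ).card := by
      refine Finset.card_le_mul_card_image _ _ fun T _ => ?_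
      rw [← Finset.card_univ, ← Finset.card_erase_of_mem (Finset.mem_univ star)]
      refine Finset.card_le_card_of_injOn (fun S => S i r) ?_ ?_
      · intro S hS
        rw [Finset.mem_coe, Finset.mem_filter] at hS
        simpa using hne S hS.1
      · intro S hS S' hS' heq
        rw [Finset.mem_coe, Finset.mem_filter] at hS hS'
        have h1 : φ S = φ S' := hS.2.trans hS'.2.symm
        funext j s
        have h2 := congrFun (congrFun h1 j) s
        by_cases hj : j = i
        · subst hj
          by_cases hs : s = r
          · subst hs
            exact heq
          · simpa [hφ, plant, hs] using h2
        · simpa [hφ, hj] using h2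
    have hdisj : Disjoint (C M) ((C M).image φ) := by
      rw [Finset.disjoint_left]
      intro S hS hS'
      obtain ⟨S', _, rfl⟩ := Finset.mem_image.1 hS'
      exact hne _ hS (by simp [hφ, plant])
    have hsub : C M ∪ (C M).image φ ⊆ C (insert r M) := by
      intro S hS
      rcases Finset.mem_union.1 hS with h | h
      · simp only [hC, Finset.mem_filter, Finset.mem_univ, true_and] at h ⊢
        obtain ⟨S₀, h0, R, hR, rfl⟩ := h
        exact ⟨S₀, h0, R, hR.trans (Finset.subset_insert _ _), rfl⟩
      · obtain ⟨S', hS', rfl⟩ := Finset.mem_image.1 h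
        simp only [hC, Finset.mem_filter, Finset.mem_univ, true_and] at hS' ⊢
        obtain ⟨S₀, h0, R, hR, rfl⟩ := hS'
        refine ⟨S₀, h0, insert r R, Finset.insert_subset_insert _ hR, ?_⟩
        funext j s
        by_cases hj : j = i
        · subst hj
          by_cases hs : s = r
          · simp [hφ, plant, hs]
          · simp [hφ, plant, hs]
        · simp [hφ, hj]
    have hcard : (C M).card + ((C M).image φ).card ≤ (C (insert r M)).card := by
      rw [← Finset.card_union_of_disjoint hdisj]
      exact Finset.card_le_card hsub
    rw [Finset.card_insert_of_notMem hr, pow_succ, pow_succ, ← mul_assoc]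
    have hα : Fintype.card α = (Fintype.card α - 1) + 1 :=
      (Nat.sub_add_cancel (Fintype.card_pos_iff.2 ⟨star⟩)).symm
    set N := Fintype.card α - 1 with hN
    calc B.card * Fintype.card α ^ M.card * Fintype.card α
        ≤ ((C M).card * N ^ M.card) * Fintype.card α := Nat.mul_le_mul_right _ ih
      _ = (N * (C M).card + (C M).card) * N ^ M.card := by rw [hα]; ring
      _ ≤ (N * (C M).card + N * ((C M).image φ).card) * N ^ M.card :=
          Nat.mul_le_mul_right _ (Nat.add_le_add_left himage _)
      _ = ((C M).card + ((C M).image φ).card) * (N ^ M.card * N) := by ring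
      _ ≤ (C (insert r M)).card * (N ^ M.card * N) := Nat.mul_le_mul_right _ hcard

open Classical in
/-- If planting `star` in a nonempty set of slots turns the set `B` of samples into the set `D`,
then the potential which grows by the factor `exp (m / n)` on `B` and vanishes on `D` does not grow
in expectation. -/
theorem ev_uniform_le_of_plant {κ : Type} [Fintype κ] [DecidableEq κ] [NeZero n] {m : ℕ} (i : κ) (star : Fin n)
    (B D : (κ → Fin m → Fin n) → Prop) (hB : ∀ S, B S → ∀ r, S i r ≠ star)
    (hBD : ∀ S, B S → ∀ R : Finset (Fin m), R.Nonempty →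
      D (Function.update S i (plant star R (S i))))
    (hdisj : ∀ S, B S → ¬ D S) (F : (κ → Fin m → Fin n) → ℝ≥0∞) (c : ℝ≥0∞)
    (hFB : ∀ S, B S → F S ≤ c * ENNReal.ofReal (Real.exp (m / n))) (hFD : ∀ S, D S → F S = 0)
    (hF : ∀ S, ¬ B S → F S ≤ c) :
    ev (PMF.uniformOfFintype (κ → Fin m → Fin n)) F ≤ c := by
  set bs : Finset (κ → Fin m → Fin n) := Finset.univ.filter B with hbs
  set ds : Finset (κ → Fin m → Fin n) := Finset.univ.filter D with hds
  have hn : (0 : ℝ) < n := by exact_mod_cast Nat.pos_of_ne_zero (NeZero.ne n)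
  have h1 := card_mul_pow_le_of_plant i star bs
    (fun S hS => hB S (Finset.mem_filter.1 hS).2) (Finset.univ : Finset (Fin m)) (bs ∪ ds) (by
      intro S hS R _
      have hBS := (Finset.mem_filter.1 hS).2
      rcases R.eq_empty_or_nonempty with rfl | hR
      · refine Finset.mem_union_left _ ?_
        rwa [plant_empty, Function.update_eq_self]
      · exact Finset.mem_union_right _ (Finset.mem_filter.2 ⟨Finset.mem_univ _, hBD S hBS R hR⟩))
  have h3 : bs.card * n ^ m ≤ (bs.card + ds.card) * (n - 1) ^ m := by
    rw [Fintype.card_fin, Finset.card_univ, Fintype.card_fin] at h1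
    exact h1.trans (Nat.mul_le_mul_right _ (Finset.card_union_le bs ds))
  -- The counting bound together with `(n - 1) * exp (1 / n) ≤ n`, raised to the power `m`.
  have h4 : (bs.card : ℝ) * Real.exp (m / n) ≤ bs.card + ds.card := by
    have h5 : (bs.card : ℝ) * (n : ℝ) ^ m ≤ (bs.card + ds.card) * ((n : ℝ) - 1) ^ m := by
      have : ((n - 1 : ℕ) : ℝ) = (n : ℝ) - 1 := by
        rw [Nat.cast_sub (Nat.pos_of_ne_zero (NeZero.ne n)), Nat.cast_one]
      rw [← this]
      exact_mod_cast h3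
    have h6 : ((n : ℝ) - 1) ^ m * Real.exp (m / n) ≤ (n : ℝ) ^ m := by
      have h7 : ((n : ℝ) - 1) * Real.exp (1 / n) ≤ n := by
        have h8 : 1 - 1 / (n : ℝ) ≤ Real.exp (-(1 / n)) := Real.one_sub_le_exp_neg _
        have h9 : Real.exp (-(1 / (n : ℝ))) * Real.exp (1 / n) = 1 := by
          rw [← Real.exp_add]; simp
        have h10 : (n : ℝ) - 1 = n * (1 - 1 / n) := by field_simp
        calc ((n : ℝ) - 1) * Real.exp (1 / n) = n * ((1 - 1 / n) * Real.exp (1 / n)) := by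
              rw [h10]; ring
          _ ≤ n * (Real.exp (-(1 / n)) * Real.exp (1 / n)) := by gcongr
          _ = n := by rw [h9, mul_one]
      have h8 : 0 ≤ (n : ℝ) - 1 := by
        have : (1 : ℝ) ≤ n := by exact_mod_cast Nat.pos_of_ne_zero (NeZero.ne n)
        linarith
      have h9 : Real.exp ((m : ℝ) / n) = Real.exp (1 / n) ^ m := by
        rw [← Real.exp_nat_mul]
        congr 1
        ring
      rw [h9, ← mul_pow]
      exact pow_le_pow_left₀ (by positivity) h7 m
    have hnm : (0 : ℝ) < (n : ℝ) ^ m := pow_pos hn m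
    refine le_of_mul_le_mul_right ?_ hnm
    calc (bs.card : ℝ) * Real.exp (m / n) * (n : ℝ) ^ m
        = ((bs.card : ℝ) * (n : ℝ) ^ m) * Real.exp (m / n) := by ring
      _ ≤ ((bs.card + ds.card) * ((n : ℝ) - 1) ^ m) * Real.exp (m / n) := by gcongr
      _ = (bs.card + ds.card) * (((n : ℝ) - 1) ^ m * Real.exp (m / n)) := by ring
      _ ≤ (bs.card + ds.card) * (n : ℝ) ^ m := by gcongr
  have h5 : ∑ S, F S ≤ c * Fintype.card (κ → Fin m → Fin n) := by
    -- Pointwise `F ≤ c * G`; by the previous count, the gain on `B` is paid for by the loss on `D`,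
    -- so `G` averages to at most `1`.
    set G : (κ → Fin m → Fin n) → ℝ := fun S => (1 - if D S then 1 else 0) +
      (if B S then 1 else 0) * (Real.exp (m / n) - 1) with hG
    have hexp : 0 ≤ Real.exp ((m : ℝ) / n) - 1 := by
      have := Real.one_le_exp (x := (m : ℝ) / n) (by positivity)
      linarith
    have hG0 : ∀ S, 0 ≤ G S := by
      intro S
      simp only [hG]
      split_ifs <;> linarith
    have hFG : ∀ S, F S ≤ c * ENNReal.ofReal (G S) := by
      intro S
      by_cases hb : B S
      · have := hdisj S hb
        simpa [hG, hb, this] using hFB S hb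
      · by_cases hd : D S
        · rw [hFD S hd]
          exact zero_le
        · simpa [hG, hb, hd] using hF S hb
    have hsum : ∑ S, G S ≤ Fintype.card (κ → Fin m → Fin n) := by
      have e1 : ∑ S : κ → Fin m → Fin n, (if D S then (1 : ℝ) else 0) = ds.card := by
        rw [Finset.sum_boole]
      have e2 : ∑ S : κ → Fin m → Fin n, (if B S then (1 : ℝ) else 0) = bs.card := by
        rw [Finset.sum_boole]
      simp only [hG]
      rw [Finset.sum_add_distrib, Finset.sum_sub_distrib, ← Finset.sum_mul, e1, e2]
      simp only [Finset.sum_const, Finset.card_univ, nsmul_eq_mul, mul_one]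
      linarith
    calc ∑ S, F S ≤ ∑ S, c * ENNReal.ofReal (G S) := Finset.sum_le_sum fun S _ => hFG S
      _ = c * ENNReal.ofReal (∑ S, G S) := by
          rw [← Finset.mul_sum, ENNReal.ofReal_sum_of_nonneg fun S _ => hG0 S]
      _ ≤ c * ENNReal.ofReal (Fintype.card (κ → Fin m → Fin n)) := by gcongr
      _ = c * Fintype.card (κ → Fin m → Fin n) := by rw [ENNReal.ofReal_natCast]
  rw [ev_uniform]
  exact ENNReal.div_le_of_le_mul h5

end Planting

/-! ### Trajectories of the algorithm -/

section Trajectory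

variable {n : ℕ} [NeZero n] (A : ArrivalRule) (Ts : ℕ → ℕ) (k m : ℕ) (ℓ : ℕ → Fin n → ℝ)

/-- The state after the bucket update at time `t` with samples `S`. -/
def bucketUpdate (t : ℕ) (s : State n) (S : Fin (topLevel Ts k t + 1) → Fin m → Fin n) :
    State n where
  bucket i :=
    if h : i < topLevel Ts k t + 1 then
      evict (Real.log (Ts k : ℝ) / (m : ℝ)) (blockStart Ts k t) (s.bucket i) ++
        fresh (A.fwd t i) ((List.range i).flatMap fun j =>
          (evict (Real.log (Ts k : ℝ) / (m : ℝ)) (blockStart Ts k t) (s.bucket j)).map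
            Entry.expert) ++
        fresh (A.smp t i) (List.ofFn (S ⟨i, h⟩))
    else s.bucket i
  big i := if i + 1 ≤ topLevel Ts k t then 1 else s.big i
  small i := if i + 1 ≤ topLevel Ts k t then 1 else s.small i

theorem updateBuckets_eq (t : ℕ) (s : State n) :
    updateBuckets A Ts k m t s =
      (PMF.uniformOfFintype (Fin (topLevel Ts k t + 1) → Fin m → Fin n)).map
        (bucketUpdate A Ts k m t s) := rfl

/-- The states after the days `0, 1, …` and the picks and predictions on the days `1, 2, …`. -/
abbrev Traj (n : ℕ) : Type := (ℕ → State n) × (ℕ → ℕ → Fin n × Fin n)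

/-- The law of the state after day `t + 1`, if the predictions on that day are `y`. -/
def nextState (t : ℕ) (y : ℕ → Fin n × Fin n) (s : State n) : PMF (State n) :=
  if Ts 0 ∣ t + 1 then updateBuckets A Ts k m (t + 1) (updateWeights Ts (ℓ (t + 1)) y s)
  else PMF.pure (updateWeights Ts (ℓ (t + 1)) y s)

/-- Extend a trajectory by day `t + 1`. -/
def trajStep (t : ℕ) (h : Traj n) : PMF (Traj n) :=
  (getPredictions (h.1 t) (k - 1)).bind fun y =>
    (nextState A Ts k m ℓ t y (h.1 t)).map fun s' =>
      (Function.update h.1 (t + 1) s', Function.update h.2 (t + 1) y)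

/-- The law of the trajectory up to day `t`. -/
def runTraj : ℕ → PMF (Traj n)
  | 0 => (updateBuckets A Ts k m 0 (emptyState n)).map fun s => (fun _ => s, fun _ _ => (0, 0))
  | t + 1 => (runTraj t).bind (trajStep A Ts k m ℓ t)

theorem run_eq_map_runTraj (t : ℕ) :
    run A Ts k m ℓ t =
      (runTraj A Ts k m ℓ t).map fun h => (h.1 t, fun u => (h.2 u (k - 1)).2) := by
  induction t with
  | zero =>
    simp only [run, runTraj, PMF.map_comp]
    rfl
  | succ t ih =>
    simp only [run, runTraj, ih, PMF.map_bind, PMF.bind_map]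
    congr 1
    funext h
    simp only [Function.comp, trajStep, PMF.map_bind, PMF.map_comp]
    congr 1
    funext y
    simp only [nextState]
    congr 1
    funext s'
    simp only [Function.comp, Function.update_self, Prod.mk.injEq, true_and]
    funext u
    by_cases hu : u = t + 1
    · subst hu
      simp
    · simp [hu]

theorem hierarchicalBaseline_eq :
    hierarchicalBaseline A Ts k m ℓ =
      (runTraj A Ts k m ℓ (Ts k)).map fun h u => (h.2 u (k - 1)).2 := by
  rw [hierarchicalBaseline, run_eq_map_runTraj, PMF.map_comp]
  rfl

theorem ev_runTraj_le (f : ℕ → Traj n → ℝ≥0∞) (c : ℝ≥0∞)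
    (h0 : ev (runTraj A Ts k m ℓ 0) (f 0) ≤ c) (T : ℕ)
    (hstep : ∀ t < T, ∀ h, ev (trajStep A Ts k m ℓ t h) (f (t + 1)) ≤ f t h) :
    ev (runTraj A Ts k m ℓ T) (f T) ≤ c := by
  induction T with
  | zero => exact h0
  | succ T ih =>
    rw [runTraj, ev_bind]
    exact (ev_mono _ fun h => hstep T (Nat.lt_succ_self T) h).trans
      (ih fun t ht => hstep t (by omega))

/-- The deterministic relations between consecutive states of a trajectory. -/
structure Consistent (T : ℕ) (h : Traj n) : Prop where
  init : ∃ S, h.1 0 = bucketUpdate A Ts k m 0 (emptyState n) S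
  update : ∀ t < T, Ts 0 ∣ t + 1 → ∃ S, h.1 (t + 1) =
    bucketUpdate A Ts k m (t + 1) (updateWeights Ts (ℓ (t + 1)) (h.2 (t + 1)) (h.1 t)) S
  noUpdate : ∀ t < T, ¬ Ts 0 ∣ t + 1 →
    h.1 (t + 1) = updateWeights Ts (ℓ (t + 1)) (h.2 (t + 1)) (h.1 t)
  pick_zero : ∀ t < T, (h.2 (t + 1) 0).1 = (h.2 (t + 1) 0).2

theorem getPredictions_zero_eq (s : State n) (i : ℕ) :
    ∀ y ∈ (getPredictions s i).support, (y 0).1 = (y 0).2 := by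
  induction i with
  | zero =>
    intro y hy
    simp only [getPredictions, PMF.support_map, Set.mem_image] at hy
    obtain ⟨e, -, rfl⟩ := hy
    rfl
  | succ i ih =>
    intro y hy
    simp only [getPredictions, PMF.mem_support_bind_iff, PMF.support_map, Set.mem_image] at hy
    obtain ⟨y', hy', e, -, p, -, rfl⟩ := hy
    simpa using ih y' hy'

theorem consistent_of_mem_support (T : ℕ) :
    ∀ h ∈ (runTraj A Ts k m ℓ T).support, Consistent A Ts k m ℓ T h := by
  induction T with
  | zero =>
    intro h hh
    simp only [runTraj, updateBuckets_eq, PMF.support_map, Set.mem_image] at hh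
    obtain ⟨s, ⟨S, -, rfl⟩, rfl⟩ := hh
    exact ⟨⟨S, rfl⟩, fun t ht => absurd ht (Nat.not_lt_zero t),
      fun t ht => absurd ht (Nat.not_lt_zero t), fun t ht => absurd ht (Nat.not_lt_zero t)⟩
  | succ T ih =>
    intro h hh
    simp only [runTraj, trajStep, PMF.mem_support_bind_iff, PMF.support_map, Set.mem_image] at hh
    obtain ⟨g, hg, y, hy, s, hs, rfl⟩ := hh
    have hc := ih g hg
    have hold : ∀ t ≤ T, Function.update g.1 (T + 1) s t = g.1 t := fun t ht =>
      Function.update_of_ne (by omega) _ _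
    have hold2 : ∀ t < T, Function.update g.2 (T + 1) y (t + 1) = g.2 (t + 1) := fun t ht =>
      Function.update_of_ne (by omega) _ _
    refine ⟨?_, fun t ht hd => ?_, fun t ht hd => ?_, fun t ht => ?_⟩
    · simpa only [hold 0 (Nat.zero_le _)] using hc.init
    · rcases (Nat.lt_succ_iff.1 ht).eq_or_lt with rfl | hlt
      · simp only [Function.update_self, hold t le_rfl]
        rw [nextState, if_pos hd, updateBuckets_eq, PMF.support_map] at hs
        obtain ⟨S, -, hS⟩ := hs
        exact ⟨S, hS.symm⟩
      · simpa only [hold t hlt.le, hold (t + 1) hlt, hold2 t hlt] using hc.update t hlt hd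
    · rcases (Nat.lt_succ_iff.1 ht).eq_or_lt with rfl | hlt
      · simp only [Function.update_self, hold t le_rfl]
        rw [nextState, if_neg hd, PMF.support_pure, Set.mem_singleton_iff] at hs
        exact hs
      · simpa only [hold t hlt.le, hold (t + 1) hlt, hold2 t hlt] using hc.noUpdate t hlt hd
    · rcases (Nat.lt_succ_iff.1 ht).eq_or_lt with rfl | hlt
      · simp only [Function.update_self]
        exact getPredictions_zero_eq _ _ y hy
      · simpa only [hold2 t hlt] using hc.pick_zero t hlt

/-- An exponential supermartingale over the days `b + 1, …, c`. -/
theorem ev_exp_sum_le_one (ψ : ℕ → State n → (ℕ → Fin n × Fin n) → ℝ)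
    (hψ : ∀ u s, ev (getPredictions s (k - 1)) (fun y => ENNReal.ofReal (Real.exp (ψ u s y))) ≤ 1)
    (b c T : ℕ) (hc : c ≤ T) :
    ev (runTraj A Ts k m ℓ T) (fun h => ENNReal.ofReal
      (Real.exp (∑ x ∈ Finset.Ico b c, ψ (x + 1) (h.1 x) (h.2 (x + 1))))) ≤ 1 := by
  -- The exponent is restricted to the past of `t`, so one step adds at most one factor, of
  -- conditional mean at most `1`.
  set f : ℕ → Traj n → ℝ≥0∞ := fun t h => ENNReal.ofReal
    (Real.exp (∑ x ∈ (Finset.Ico b c).filter (· < t), ψ (x + 1) (h.1 x) (h.2 (x + 1)))) with hf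
  have hT : ∀ h : Traj n, ENNReal.ofReal
      (Real.exp (∑ x ∈ Finset.Ico b c, ψ (x + 1) (h.1 x) (h.2 (x + 1)))) = f T h := by
    intro h
    rw [hf]
    simp only
    rw [Finset.filter_true_of_mem]
    intro x hx
    have := (Finset.mem_Ico.1 hx).2
    omega
  simp only [hT]
  refine ev_runTraj_le A Ts k m ℓ f 1 ?_ T fun t _ h => ?_
  · simp only [hf, Nat.not_lt_zero, Finset.filter_false, Finset.sum_empty, Real.exp_zero,
      ENNReal.ofReal_one]
    exact (ev_const _ 1).le
  · rw [trajStep, ev_bind]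
    simp only [ev_map]
    have hsame : ∀ y s', ∑ x ∈ (Finset.Ico b c).filter (· < t),
        ψ (x + 1) (Function.update h.1 (t + 1) s' x) (Function.update h.2 (t + 1) y (x + 1)) =
        ∑ x ∈ (Finset.Ico b c).filter (· < t), ψ (x + 1) (h.1 x) (h.2 (x + 1)) := by
      intro y s'
      refine Finset.sum_congr rfl fun x hx => ?_
      have := (Finset.mem_filter.1 hx).2
      rw [Function.update_of_ne (by omega), Function.update_of_ne (by omega)]
    by_cases ht : t ∈ Finset.Ico b c
    · have hsplit : (Finset.Ico b c).filter (· < t + 1) =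
          insert t ((Finset.Ico b c).filter (· < t)) := by
        ext x
        simp only [Finset.mem_filter, Finset.mem_insert, Finset.mem_Ico] at ht ⊢
        omega
      simp only [hf, hsplit]
      have hnot : t ∉ (Finset.Ico b c).filter (· < t) := by simp
      simp only [Finset.sum_insert hnot, hsame, Function.update_self, Real.exp_add]
      have : ∀ s' : State n, Function.update h.1 (t + 1) s' t = h.1 t := fun s' =>
        Function.update_of_ne (by omega) _ _
      simp only [this, ENNReal.ofReal_mul (Real.exp_pos _).le]
      simp only [ev_const, ev_mul_const]
      calc _ ≤ 1 * _ := mul_le_mul_left (hψ (t + 1) (h.1 t)) _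
        _ = _ := one_mul _
    · have hsplit : (Finset.Ico b c).filter (· < t + 1) = (Finset.Ico b c).filter (· < t) := by
        ext x
        simp only [Finset.mem_filter, Finset.mem_Ico] at ht ⊢
        omega
      simp only [hf, hsplit, hsame, ev_const]
      exact le_rfl

end Trajectory

/-! ### Concentration of the losses of picks and predictions -/

section Concentration

variable {n : ℕ} [NeZero n]

/-- The law of the pick from bucket `i`. -/
def pickLaw (s : State n) (i : ℕ) : PMF (Fin n) :=
  weightedChoice 0 ((s.bucket i).map fun x => (x.expert, x.weight))

/-- The law of the prediction of level `j + 1`, given the prediction `p` of level `j` and the pick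
`e` from bucket `j + 1`. -/
def mixLaw (s : State n) (j : ℕ) (p e : Fin n) : PMF (Fin n) :=
  weightedChoice e [(e, s.big j), (p, s.small j)]

theorem ev_getPredictions_pick (s : State n) {i j : ℕ} (hj : j ≤ i) (f : Fin n → ℝ≥0∞) :
    ev (getPredictions s i) (fun y => f (y j).1) = ev (pickLaw s j) f := by
  induction i with
  | zero =>
    obtain rfl : j = 0 := by omega
    simp only [getPredictions, ev_map]
    rfl
  | succ i ih =>
    simp only [getPredictions, ev_bind, ev_map]
    rcases hj.eq_or_lt with rfl | hlt
    · simp only [Function.update_self, ev_const]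
      rfl
    · have hne : j ≠ i + 1 := by omega
      simp only [Function.update_of_ne hne, ev_const]
      exact ih (by omega)

theorem ev_getPredictions_mix_le (s : State n) {i j : ℕ} (hj : j + 1 ≤ i)
    (f : Fin n → Fin n → Fin n → ℝ≥0∞) (hf : ∀ p e, ev (mixLaw s j p e) (f p e) ≤ 1) :
    ev (getPredictions s i) (fun y => f (y j).2 (y (j + 1)).1 (y (j + 1)).2) ≤ 1 := by
  induction i with
  | zero => omega
  | succ i ih =>
    simp only [getPredictions, ev_bind, ev_map]
    rcases hj.eq_or_lt with heq | hlt
    · obtain rfl : j = i := by omega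
      have hne : j ≠ j + 1 := by omega
      simp only [Function.update_self, Function.update_of_ne hne]
      exact ev_le_one _ _ fun y => ev_le_one _ _ fun e => hf (y j).2 e
    · have h1 : j ≠ i + 1 := by omega
      have h2 : j + 1 ≠ i + 1 := by omega
      simp only [Function.update_of_ne h1, Function.update_of_ne h2, ev_const]
      exact ih (by omega)

variable (A : ArrivalRule) (Ts : ℕ → ℕ) (k m : ℕ) (ℓ : ℕ → Fin n → ℝ)
  (hℓ : ∀ t e, ℓ t e ∈ Set.Icc (0 : ℝ) 1)

include hℓ in
theorem pick_concentration {i : ℕ} (hi : i < k) {c : ℝ} (h0 : 0 ≤ c) (h1 : c ≤ 1) {b d T : ℕ}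
    (hd : d ≤ T) (Γ : ℝ) :
    (runTraj A Ts k m ℓ T).toOuterMeasure {h | Γ < ∑ x ∈ Finset.Ico b d,
      (c * ℓ (x + 1) (h.2 (x + 1) i).1 -
        (c + c ^ 2) * mean (pickLaw (h.1 x) i) (ℓ (x + 1)))} ≤
      ENNReal.ofReal (Real.exp (-Γ)) := by
  refine toOuterMeasure_le_of_ev_exp_le_one _ _ _ (ev_exp_sum_le_one A Ts k m ℓ
    (fun u s y => c * ℓ u (y i).1 - (c + c ^ 2) * mean (pickLaw s i) (ℓ u)) (fun u s => ?_) b d T hd)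
  exact (ev_getPredictions_pick s (Nat.le_sub_one_of_lt hi) fun e => ENNReal.ofReal
    (Real.exp (c * ℓ u e - (c + c ^ 2) * mean (pickLaw s i) (ℓ u)))).le.trans
      (ev_exp_le_one _ _ (hℓ u) h0 h1)

include hℓ in
-- The conditioning includes the realized pick and lower prediction, so the conditional mean is the
-- loss of a two-option multiplicative weights algorithm against realized losses.
theorem mix_concentration {j : ℕ} (hj : j + 1 < k) {c : ℝ} (h0 : 0 ≤ c) (h1 : c ≤ 1) {b d T : ℕ}
    (hd : d ≤ T) (Γ : ℝ) :
    (runTraj A Ts k m ℓ T).toOuterMeasure {h | Γ < ∑ x ∈ Finset.Ico b d,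
      (c * ℓ (x + 1) (h.2 (x + 1) (j + 1)).2 - (c + c ^ 2) *
        mean (mixLaw (h.1 x) j (h.2 (x + 1) j).2 (h.2 (x + 1) (j + 1)).1) (ℓ (x + 1)))} ≤
      ENNReal.ofReal (Real.exp (-Γ)) := by
  refine toOuterMeasure_le_of_ev_exp_le_one _ _ _ (ev_exp_sum_le_one A Ts k m ℓ
    (fun u s y => c * ℓ u (y (j + 1)).2 - (c + c ^ 2) *
      mean (mixLaw s j (y j).2 (y (j + 1)).1) (ℓ u)) (fun u s => ?_) b d T hd)
  exact ev_getPredictions_mix_le s (Nat.le_sub_one_of_lt hj) (fun p e q => ENNReal.ofReal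
    (Real.exp (c * ℓ u q - (c + c ^ 2) * mean (mixLaw s j p e) (ℓ u))))
      fun p e => ev_exp_le_one _ _ (hℓ u) h0 h1

end Concentration

/-! ### Multiplicative weights on one block -/

section BlockHedge

theorem list_sum_map_eq {α : Type*} (L : List α) (f : α → ℝ) :
    (L.map f).sum = ∑ j : Fin L.length, f (L.get j) := by
  rw [← List.sum_ofFn]
  congr 1
  conv_lhs => rw [← List.ofFn_get L, List.map_ofFn]
  rfl

theorem mean_weightedChoice {α : Type} (d : α) (l : List (α × ℝ)) (hl : l ≠ [])
    (hw : ∀ p ∈ l, 0 < p.2) (X : α → ℝ) (hX : ∀ a, 0 ≤ X a) :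
    mean (weightedChoice d l) X =
      (l.map fun p => p.2 * X p.1).sum / (l.map Prod.snd).sum := by
  have hne : Nonempty (Fin l.length) := ⟨⟨0, List.length_pos_iff.2 hl⟩⟩
  have hwj : ∀ j : Fin l.length, 0 < (l.get j).2 := fun j => hw _ (List.get_mem l j)
  have hsum : ∑' j : Fin l.length, ENNReal.ofReal (l.get j).2 =
      ENNReal.ofReal (∑ j : Fin l.length, (l.get j).2) := by
    rw [tsum_fintype, ENNReal.ofReal_sum_of_nonneg fun j _ => (hwj j).le]
  have hpos : 0 < ∑ j : Fin l.length, (l.get j).2 :=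
    Finset.sum_pos (fun j _ => hwj j) Finset.univ_nonempty
  have h0 : ∑' j : Fin l.length, ENNReal.ofReal (l.get j).2 ≠ 0 := by
    rw [hsum]
    exact (ENNReal.ofReal_pos.2 hpos).ne'
  rw [mean, weightedChoice, dif_pos h0, ev_map, ev, tsum_fintype, list_sum_map_eq,
    list_sum_map_eq]
  simp only [PMF.normalize_apply, hsum]
  rw [ENNReal.toReal_sum]
  · rw [Finset.sum_div]
    refine Finset.sum_congr rfl fun j _ => ?_
    rw [ENNReal.toReal_mul, ENNReal.toReal_mul, ENNReal.toReal_inv,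
      ENNReal.toReal_ofReal (hwj j).le, ENNReal.toReal_ofReal hpos.le,
      ENNReal.toReal_ofReal (hX _)]
    ring
  · intro j _
    exact ENNReal.mul_ne_top (ENNReal.mul_ne_top ENNReal.ofReal_ne_top
      (ENNReal.inv_ne_top.2 (ENNReal.ofReal_pos.2 hpos).ne')) ENNReal.ofReal_ne_top

variable {n : ℕ} {A : ArrivalRule} {Ts : ℕ → ℕ} {k m : ℕ} {ℓ : ℕ → Fin n → ℝ}
  {T : ℕ} {h : Traj n}

theorem Consistent.bucket_succ (hc : Consistent A Ts k m ℓ T h) (hS : Sizes Ts k) {t i : ℕ}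
    (ht : t < T) (hi : ¬ Ts i ∣ t + 1) :
    (h.1 (t + 1)).bucket i = (updateWeights Ts (ℓ (t + 1)) (h.2 (t + 1)) (h.1 t)).bucket i := by
  by_cases h0 : Ts 0 ∣ t + 1
  · obtain ⟨S, hs⟩ := hc.update t ht h0
    rw [hs, bucketUpdate]
    simp only
    rw [dif_neg]
    intro hlt
    exact hi (hS.dvd_of_le_topLevel h0 (by omega))
  · rw [hc.noUpdate t ht h0]

theorem Consistent.external_succ (hc : Consistent A Ts k m ℓ T h) (hS : Sizes Ts k) {t i : ℕ}
    (ht : t < T) (hi : ¬ Ts (i + 1) ∣ t + 1) :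
    (h.1 (t + 1)).big i = (updateWeights Ts (ℓ (t + 1)) (h.2 (t + 1)) (h.1 t)).big i ∧
    (h.1 (t + 1)).small i = (updateWeights Ts (ℓ (t + 1)) (h.2 (t + 1)) (h.1 t)).small i := by
  by_cases h0 : Ts 0 ∣ t + 1
  · obtain ⟨S, hs⟩ := hc.update t ht h0
    have hnot : ¬ i + 1 ≤ topLevel Ts k (t + 1) := fun hle => hi (hS.dvd_of_le_topLevel h0 hle)
    rw [hs, bucketUpdate]
    exact ⟨if_neg hnot, if_neg hnot⟩
  · rw [hc.noUpdate t ht h0]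
    exact ⟨rfl, rfl⟩

theorem Consistent.exists_bucketUpdate (hc : Consistent A Ts k m ℓ T h) {b : ℕ} (hb : b ≤ T)
    (h0 : Ts 0 ∣ b) : ∃ s S, h.1 b = bucketUpdate A Ts k m b s S ∧ (b = 0 → s = emptyState n) := by
  rcases Nat.eq_zero_or_pos b with rfl | hpos
  · obtain ⟨S, hs⟩ := hc.init
    exact ⟨_, S, hs, fun _ => rfl⟩
  · obtain ⟨t, rfl⟩ : ∃ t, b = t + 1 := ⟨b - 1, by omega⟩
    obtain ⟨S, hs⟩ := hc.update t hb h0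
    exact ⟨_, S, hs, fun h => absurd h (Nat.succ_ne_zero t)⟩

theorem mem_fresh {arr : ℕ → ℝ} {es : List (Fin n)} {x : Entry n} :
    x ∈ fresh arr es ↔ ∃ r, ∃ hr : r < es.length, x = ⟨es[r], arr r, 0, 1⟩ := by
  unfold fresh
  rw [List.mem_mapIdx]
  exact exists_congr fun r => exists_congr fun hr => eq_comm

theorem mem_evict {ε : ℝ} {τ : ℕ} {b : List (Entry n)} {x : Entry n} :
    x ∈ evict ε τ b ↔ ∃ y ∈ b, ¬ ((τ : ℝ) + 1 / 2 ≤ y.arrival ∧ ∃ x' ∈ b, Dominates ε x' y) ∧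
      x = { y with weight := 1 } := by
  classical
  unfold evict
  simp only [List.mem_map, List.mem_filter, decide_eq_true_eq]
  constructor
  · rintro ⟨y, ⟨h1, h2⟩, h3⟩
    exact ⟨y, h1, h2, h3.symm⟩
  · rintro ⟨y, h1, h2, h3⟩
    exact ⟨y, ⟨h1, h2⟩, h3.symm⟩

theorem Consistent.weight_eq_one (hc : Consistent A Ts k m ℓ T h) (hS : Sizes Ts k) {b i : ℕ}
    (hb : b ≤ T) (hi : i < k) (hd : Ts i ∣ b) : ∀ x ∈ (h.1 b).bucket i, x.weight = 1 := by
  obtain ⟨s, S, hs, -⟩ := hc.exists_bucketUpdate hb (hS.zero_dvd_of_dvd hi.le hd)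
  have hlt : i < topLevel Ts k b + 1 := Nat.lt_succ_of_le (hS.le_topLevel hi hd)
  intro x hx
  rw [hs, bucketUpdate] at hx
  simp only [dif_pos hlt, List.mem_append] at hx
  rcases hx with (hx | hx) | hx
  · obtain ⟨y, -, -, rfl⟩ := mem_evict.1 hx
    rfl
  · obtain ⟨r, hr, rfl⟩ := mem_fresh.1 hx
    rfl
  · obtain ⟨r, hr, rfl⟩ := mem_fresh.1 hx
    rfl

theorem Consistent.external_eq_one (hc : Consistent A Ts k m ℓ T h) (hS : Sizes Ts k) {b i : ℕ}
    (hb : b ≤ T) (hi : i + 1 < k) (hd : Ts (i + 1) ∣ b) :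
    (h.1 b).big i = 1 ∧ (h.1 b).small i = 1 := by
  obtain ⟨s, S, hs, -⟩ := hc.exists_bucketUpdate hb (hS.zero_dvd_of_dvd hi.le hd)
  have hle : i + 1 ≤ topLevel Ts k b := hS.le_topLevel hi hd
  rw [hs, bucketUpdate]
  exact ⟨if_pos hle, if_pos hle⟩

theorem not_dvd_of_mem_block {d b x : ℕ} (hb : d ∣ b) (h1 : b < x) (h2 : x < b + d) : ¬ d ∣ x :=
  fun hx => by
    have := add_le_of_dvd_of_lt hb hx h1
    omega

/-- Inside the block the bucket is not updated, so its length and with it the learning rate are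
constant, and the weights are those of multiplicative weights restarted at `b`. -/
theorem Consistent.bucket_block (hc : Consistent A Ts k m ℓ T h) (hS : Sizes Ts k) {b i d : ℕ}
    (hi : i < k) (hd : Ts i ∣ b) (hdi : d < Ts i) (hT : b + d ≤ T) :
    ((h.1 (b + d)).bucket i).map (fun x => (x.expert, x.weight)) =
      ((h.1 b).bucket i).map fun x => (x.expert,
        Real.exp (-(√(Real.log (((h.1 b).bucket i).length : ℝ) / (Ts i : ℝ)) *
          ∑ u ∈ Finset.range d, ℓ (b + u + 1) x.expert))) := by
  induction d with
  | zero =>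
    refine List.map_congr_left fun x hx => ?_
    simp [hc.weight_eq_one hS hT hi hd x hx]
  | succ d ih =>
    have ih' := ih (by omega) (by omega)
    have hlen : ((h.1 (b + d)).bucket i).length = ((h.1 b).bucket i).length := by
      simpa using congrArg List.length ih'
    rw [← add_assoc, hc.bucket_succ hS (by omega)
      (not_dvd_of_mem_block hd (by omega) (by omega : b + d + 1 < b + Ts i))]
    simp only [updateWeights, List.map_map, hlen]
    set η := √(Real.log (((h.1 b).bucket i).length : ℝ) / (Ts i : ℝ))
    have hmap := congrArg (List.map fun p : Fin n × ℝ =>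
      (p.1, p.2 * Real.exp (-(η * ℓ (b + d + 1) p.1)))) ih'
    simp only [List.map_map] at hmap
    refine Eq.trans ?_ (hmap.trans ?_)
    · rfl
    · refine List.map_congr_left fun x _ => ?_
      simp only [Function.comp, Finset.sum_range_succ, mul_add, neg_add, Real.exp_add]

theorem Consistent.external_block (hc : Consistent A Ts k m ℓ T h) (hS : Sizes Ts k) {b i d : ℕ}
    (hi : i + 1 < k) (hd : Ts (i + 1) ∣ b) (hdi : d < Ts (i + 1)) (hT : b + d ≤ T) :
    (h.1 (b + d)).big i = Real.exp (-(√(2 / (Ts (i + 1) : ℝ)) *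
        ∑ u ∈ Finset.range d, ℓ (b + u + 1) (h.2 (b + u + 1) (i + 1)).1)) ∧
      (h.1 (b + d)).small i = Real.exp (-(√(2 / (Ts (i + 1) : ℝ)) *
        ∑ u ∈ Finset.range d, ℓ (b + u + 1) (h.2 (b + u + 1) i).2)) := by
  induction d with
  | zero => simpa using hc.external_eq_one hS hT hi hd
  | succ d ih =>
    obtain ⟨h1, h2⟩ := ih (by omega) (by omega)
    obtain ⟨h3, h4⟩ := hc.external_succ hS (by omega)
      (not_dvd_of_mem_block hd (by omega) (by omega : b + d + 1 < b + Ts (i + 1)))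
    rw [← add_assoc, h3, h4]
    simp only [updateWeights, h1, h2, Finset.sum_range_succ, mul_add, neg_add, Real.exp_add,
      and_self]

theorem Consistent.mean_pickLaw_eq [NeZero n] (hc : Consistent A Ts k m ℓ T h) (hS : Sizes Ts k)
    (hℓ : ∀ t e, ℓ t e ∈ Set.Icc (0 : ℝ) 1) {b i d : ℕ}
    (hi : i < k) (hd : Ts i ∣ b) (hdi : d < Ts i) (hT : b + d ≤ T)
    (hne : (h.1 b).bucket i ≠ []) :
    mean (pickLaw (h.1 (b + d)) i) (ℓ (b + d + 1)) =
      hedgeLoss (√(Real.log (((h.1 b).bucket i).length : ℝ) / (Ts i : ℝ)))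
        (fun u (j : Fin ((h.1 b).bucket i).length) =>
          ℓ (b + u + 1) (((h.1 b).bucket i).get j).expert) d := by
  rw [pickLaw, hc.bucket_block hS hi hd hdi hT, mean_weightedChoice]
  · simp only [List.map_map, Function.comp_def]
    rw [list_sum_map_eq, list_sum_map_eq]
    rfl
  · simpa using hne
  · intro p hp
    obtain ⟨x, -, rfl⟩ := List.mem_map.1 hp
    exact Real.exp_pos _
  · exact fun a => (hℓ _ a).1

theorem Consistent.mean_mixLaw_eq (hc : Consistent A Ts k m ℓ T h) (hS : Sizes Ts k)
    (hℓ : ∀ t e, ℓ t e ∈ Set.Icc (0 : ℝ) 1) {b i d : ℕ}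
    (hi : i + 1 < k) (hd : Ts (i + 1) ∣ b) (hdi : d < Ts (i + 1)) (hT : b + d ≤ T) :
    mean (mixLaw (h.1 (b + d)) i (h.2 (b + d + 1) i).2 (h.2 (b + d + 1) (i + 1)).1)
        (ℓ (b + d + 1)) =
      hedgeLoss (√(2 / (Ts (i + 1) : ℝ)))
        (fun u (j : Fin 2) => ℓ (b + u + 1)
          (if j = 0 then (h.2 (b + u + 1) (i + 1)).1 else (h.2 (b + u + 1) i).2)) d := by
  obtain ⟨h1, h2⟩ := hc.external_block hS hi hd hdi hT
  rw [mixLaw, h1, h2, mean_weightedChoice]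
  · simp [hedgeLoss, Fin.sum_univ_two]
  · simp
  · intro p hp
    simp only [List.mem_cons, List.not_mem_nil, or_false] at hp
    rcases hp with rfl | rfl <;> exact Real.exp_pos _
  · exact fun a => (hℓ _ a).1

end BlockHedge

/-! ### Bucket contents along a trajectory -/

section Contents

variable {n : ℕ}

/-- The pairs (expert, arrival time) of the entries of a bucket. -/
def entryPairs (b : List (Entry n)) : Set (Fin n × ℝ) := {p | ∃ x ∈ b, p = (x.expert, x.arrival)}

/-- The contents of the buckets of a state. -/
def contents (s : State n) (i : ℕ) : Set (Fin n × ℝ) := entryPairs (s.bucket i)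

variable {A : ArrivalRule} {Ts : ℕ → ℕ} {k m : ℕ} {ℓ : ℕ → Fin n → ℝ}

/-- The entries arrived before time `c` and their losses are up to date at time `t`. -/
def LossesAt (ℓ : ℕ → Fin n → ℝ) (c t : ℕ) (s : State n) : Prop :=
  ∀ i, ∀ x ∈ s.bucket i, 0 ≤ x.arrival ∧ x.arrival < c ∧ x.loss = cumLoss ℓ ⌊x.arrival⌋₊ t x.expert

theorem contents_updateWeights (loss : Fin n → ℝ) (y : ℕ → Fin n × Fin n) (s : State n) (i : ℕ) :
    contents (updateWeights Ts loss y s) i = contents s i := by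
  ext p
  simp only [contents, entryPairs, updateWeights, List.mem_map, Set.mem_ofPred_eq]
  constructor
  · rintro ⟨-, ⟨x, hx, rfl⟩, rfl⟩
    exact ⟨x, hx, rfl⟩
  · rintro ⟨x, hx, rfl⟩
    exact ⟨_, ⟨x, hx, rfl⟩, rfl⟩

theorem lossesAt_updateWeights {t : ℕ} {s : State n} (h : LossesAt ℓ (t + 1) t s)
    (y : ℕ → Fin n × Fin n) :
    LossesAt ℓ (t + 1) (t + 1) (updateWeights Ts (ℓ (t + 1)) y s) := by
  intro i x hx
  simp only [updateWeights, List.mem_map] at hx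
  obtain ⟨x, hx, rfl⟩ := hx
  obtain ⟨h1, h2, h3⟩ := h i x hx
  refine ⟨h1, h2, ?_⟩
  have hfl : ⌊x.arrival⌋₊ ≤ t := Nat.lt_succ_iff.1 ((Nat.floor_lt h1).2 h2)
  simp only [h3]
  rw [cumLoss, cumLoss, Finset.sum_Ico_succ_top hfl]

theorem entryPairs_append (b b' : List (Entry n)) :
    entryPairs (b ++ b') = entryPairs b ∪ entryPairs b' := by
  ext p
  simp only [entryPairs, List.mem_append, Set.mem_union, Set.mem_ofPred_eq]
  constructor
  · rintro ⟨x, hx | hx, rfl⟩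
    · exact Or.inl ⟨x, hx, rfl⟩
    · exact Or.inr ⟨x, hx, rfl⟩
  · rintro (⟨x, hx, rfl⟩ | ⟨x, hx, rfl⟩)
    · exact ⟨x, Or.inl hx, rfl⟩
    · exact ⟨x, Or.inr hx, rfl⟩

theorem entryPairs_fresh_ofFn (arr : ℕ → ℝ) (S : Fin m → Fin n) :
    entryPairs (fresh arr (List.ofFn S)) = sampleSet S fun r => arr r := by
  ext p
  simp only [entryPairs, sampleSet, mem_fresh, Set.mem_ofPred_eq, Set.mem_range]
  constructor
  · rintro ⟨x, ⟨r, hr, rfl⟩, rfl⟩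
    exact ⟨⟨r, by simpa using hr⟩, by simp⟩
  · rintro ⟨r, rfl⟩
    exact ⟨_, ⟨r, by simp, rfl⟩, by simp⟩

/-- When the stored losses are up to date, domination depends only on experts and arrival times, so
eviction can be read off from `contents`. -/
theorem entryPairs_evict {c t : ℕ} {s : State n} (h : LossesAt ℓ c t s) (ε : ℝ) (i : ℕ) :
    entryPairs (evict ε (blockStart Ts k t) (s.bucket i)) = keep Ts k ε ℓ t (contents s i) := by
  have hdom : ∀ y ∈ s.bucket i, (∃ x' ∈ s.bucket i, Dominates ε x' y) ↔
      ∃ z ∈ contents s i, z.2 < y.arrival ∧ cumLoss ℓ ⌊z.2⌋₊ t z.1 ≤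
        (1 + ε) * cumLoss ℓ ⌊y.arrival⌋₊ t y.expert := by
    intro y hy
    have hyl := (h i y hy).2.2
    constructor
    · rintro ⟨x', hx', h1, h2⟩
      refine ⟨_, ⟨x', hx', rfl⟩, h1, ?_⟩
      rw [← (h i x' hx').2.2, ← hyl]
      exact h2
    · rintro ⟨-, ⟨x', hx', rfl⟩, h1, h2⟩
      refine ⟨x', hx', h1, ?_⟩
      rw [(h i x' hx').2.2, hyl]
      exact h2
  ext p
  constructor
  · rintro ⟨x, hx, rfl⟩
    obtain ⟨y, hy, hnot, rfl⟩ := mem_evict.1 hx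
    rw [hdom y hy] at hnot
    exact ⟨⟨y, hy, rfl⟩, hnot⟩
  · rintro ⟨⟨y, hy, rfl⟩, hnot⟩
    refine ⟨_, mem_evict.2 ⟨y, hy, ?_, rfl⟩, rfl⟩
    rw [hdom y hy]
    exact hnot

/-- The entries of bucket `i` after eviction and forwarding. -/
def baseSet (A : ArrivalRule) (Ts : ℕ → ℕ) (k m t : ℕ) (s : State n) (i : ℕ) :
    Set (Fin n × ℝ) :=
  entryPairs (evict (Real.log (Ts k : ℝ) / (m : ℝ)) (blockStart Ts k t) (s.bucket i) ++
    fresh (A.fwd t i) ((List.range i).flatMap fun j =>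
      (evict (Real.log (Ts k : ℝ) / (m : ℝ)) (blockStart Ts k t) (s.bucket j)).map Entry.expert))

/-- Forwarding precedes sampling, so `baseSet` involves no sample of time `t`: changing the samples
of one level leaves the contents of the others untouched. -/
theorem contents_bucketUpdate (t : ℕ) (s : State n)
    (S : Fin (topLevel Ts k t + 1) → Fin m → Fin n) (j : Fin (topLevel Ts k t + 1)) :
    contents (bucketUpdate A Ts k m t s S) j =
      baseSet A Ts k m t s j ∪ sampleSet (S j) fun r => A.smp t j r := by
  have hj : (j : ℕ) < topLevel Ts k t + 1 := j.2
  rw [contents, bucketUpdate]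
  simp only [dif_pos hj]
  rw [entryPairs_append, entryPairs_fresh_ofFn]
  rfl

theorem lossesAt_bucketUpdate {t : ℕ} {s : State n} (h : LossesAt ℓ t t s)
    (S : Fin (topLevel Ts k t + 1) → Fin m → Fin n) :
    LossesAt ℓ (t + 1) t (bucketUpdate A Ts k m t s S) := by
  have ht0 := Nat.cast_nonneg (α := ℝ) t
  intro i x hx
  by_cases hi : i < topLevel Ts k t + 1
  · rw [bucketUpdate] at hx
    simp only [dif_pos hi, List.mem_append] at hx
    have hnew : ∀ (e : Fin n) (r : ℝ), r ∈ Set.Ico (t : ℝ) (t + 1) →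
        0 ≤ r ∧ r < ((t + 1 : ℕ) : ℝ) ∧ 0 = cumLoss ℓ ⌊r⌋₊ t e := by
      intro e r hr
      have hfl : ⌊r⌋₊ = t := (Nat.floor_eq_iff (ht0.trans hr.1)).2 hr
      refine ⟨ht0.trans hr.1, by push_cast; exact hr.2, ?_⟩
      rw [hfl, cumLoss]
      simp
    rcases hx with (hx | hx) | hx
    · obtain ⟨y, hy, -, rfl⟩ := mem_evict.1 hx
      obtain ⟨h1, h2, h3⟩ := h i y hy
      refine ⟨h1, h2.trans ?_, h3⟩
      push_cast
      linarith
    · obtain ⟨r, hr, rfl⟩ := mem_fresh.1 hx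
      have := A.fwd_mem t i r
      exact hnew _ _ ⟨this.1, this.2.trans (by linarith)⟩
    · obtain ⟨r, hr, rfl⟩ := mem_fresh.1 hx
      have := A.smp_mem t i r
      exact hnew _ _ ⟨by linarith [this.1], this.2⟩
  · rw [bucketUpdate] at hx
    simp only [dif_neg hi] at hx
    obtain ⟨h1, h2, h3⟩ := h i x hx
    refine ⟨h1, h2.trans ?_, h3⟩
    push_cast
    linarith

theorem LossesAt.mono {c c' t : ℕ} {s : State n} (h : LossesAt ℓ c t s) (hc : c ≤ c') :
    LossesAt ℓ c' t s := fun i x hx =>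
  ⟨(h i x hx).1, (h i x hx).2.1.trans_le (by exact_mod_cast hc), (h i x hx).2.2⟩

variable {T : ℕ} {h : Traj n}

theorem Consistent.lossesAt (hc : Consistent A Ts k m ℓ T h) {t : ℕ} (ht : t ≤ T) :
    LossesAt ℓ (t + 1) t (h.1 t) := by
  induction t with
  | zero =>
    obtain ⟨S, hs⟩ := hc.init
    rw [hs]
    refine lossesAt_bucketUpdate (fun i x hx => ?_) S
    simp [emptyState] at hx
  | succ t ih =>
    have h1 := lossesAt_updateWeights (Ts := Ts) (ih (by omega)) (h.2 (t + 1))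
    by_cases h0 : Ts 0 ∣ t + 1
    · obtain ⟨S, hs⟩ := hc.update t ht h0
      rw [hs]
      exact lossesAt_bucketUpdate h1 S
    · rw [hc.noUpdate t ht h0]
      exact h1.mono (Nat.le_succ _)

theorem Consistent.bucketPath (hc : Consistent A Ts k m ℓ (Ts k) h) (hS : Sizes Ts k) :
    BucketPath Ts k (Real.log (Ts k : ℝ) / (m : ℝ)) ℓ fun t => contents (h.1 t) where
  arrival_mem t ht i hi := by
    rintro - ⟨x, hx, rfl⟩
    obtain ⟨h1, h2, -⟩ := hc.lossesAt ht.le i x hx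
    exact ⟨h1, by exact_mod_cast h2⟩
  stay t ht i hi hd := by
    rw [contents, hc.bucket_succ hS (by omega) hd]
    exact contents_updateWeights _ _ _ _
  mem_and_lt_iff t ht i hi hd x := by
    have h1 := lossesAt_updateWeights (Ts := Ts) (hc.lossesAt (t := t) (by omega)) (h.2 (t + 1))
    obtain ⟨S, hs⟩ := hc.update t (by omega) (hS.zero_dvd_of_dvd hi.le hd)
    have hlt : i < topLevel Ts k (t + 1) + 1 := Nat.lt_succ_of_le (hS.le_topLevel hi hd)
    have hk := entryPairs_evict (Ts := Ts) (k := k) h1 (Real.log (Ts k : ℝ) / (m : ℝ)) i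
    rw [contents_updateWeights] at hk
    simp only [hs]
    rw [contents_bucketUpdate (A := A) (t + 1) _ S ⟨i, hlt⟩, baseSet, entryPairs_append]
    simp only [hk]
    -- Forwarded and sampled entries arrive at `t + 1` or later, so the bound on arrivals singles
    -- out the survivors.
    constructor
    · rintro ⟨(hx | ⟨y, hy, rfl⟩) | ⟨r, rfl⟩, hxlt⟩
      · exact hx
      · obtain ⟨r, hr, rfl⟩ := mem_fresh.1 hy
        exact absurd hxlt (not_lt.2 (A.fwd_mem (t + 1) i r).1)
      · have := (A.smp_mem (t + 1) i r).1
        simp only at hxlt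
        linarith
    · intro hx
      refine ⟨Or.inl (Or.inl hx), ?_⟩
      obtain ⟨y, hy, rfl⟩ := hx.1
      exact (hc.lossesAt (t := t) (by omega) i y hy).2.1
  forward t ht i hi hd j hj x hx := by
    have h1 := lossesAt_updateWeights (Ts := Ts) (hc.lossesAt (t := t) (by omega)) (h.2 (t + 1))
    obtain ⟨S, hs⟩ := hc.update t (by omega) (hS.zero_dvd_of_dvd hi.le hd)
    have hlt : i < topLevel Ts k (t + 1) + 1 := Nat.lt_succ_of_le (hS.le_topLevel hi hd)
    have hk := entryPairs_evict (Ts := Ts) (k := k) h1 (Real.log (Ts k : ℝ) / (m : ℝ)) j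
    rw [contents_updateWeights] at hk
    rw [← hk] at hx
    obtain ⟨y, hy, rfl⟩ := hx
    simp only [hs]
    rw [contents_bucketUpdate (A := A) (t + 1) _ S ⟨i, hlt⟩, baseSet, entryPairs_append]
    have hmem : y.expert ∈ (List.range i).flatMap fun j =>
        (evict (Real.log (Ts k : ℝ) / (m : ℝ)) (blockStart Ts k (t + 1))
          ((updateWeights Ts (ℓ (t + 1)) (h.2 (t + 1)) (h.1 t)).bucket j)).map Entry.expert :=
      List.mem_flatMap.2 ⟨j, List.mem_range.2 hj, List.mem_map.2 ⟨y, hy, rfl⟩⟩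
    obtain ⟨r, hr, hrr⟩ := List.mem_iff_getElem.1 hmem
    refine ⟨A.fwd (t + 1) i r, A.fwd_mem (t + 1) i r, Or.inl (Or.inr ?_)⟩
    exact ⟨_, mem_fresh.2 ⟨r, hr, rfl⟩, by simp only [hrr]⟩

theorem length_evict_le (ε : ℝ) (τ : ℕ) (b : List (Entry n)) :
    (evict ε τ b).length ≤ b.length := by
  classical
  unfold evict
  rw [List.length_map]
  exact List.length_filter_le _ _

theorem sum_map_range_eq (i : ℕ) (f : ℕ → ℕ) :
    ((List.range i).map f).sum = ∑ j ∈ Finset.range i, f j := by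
  induction i with
  | zero => simp
  | succ i ih => rw [List.sum_range_succ, Finset.sum_range_succ, ih]

/-- Divided by `m`, an updated bucket is bounded by its old size, the sizes of the smaller buckets,
and `1` for the new samples. -/
theorem pow_add_sum_pow_le (x i : ℕ) :
    x ^ (i + 1) + ∑ j ∈ Finset.range i, x ^ (j + 1) + 1 ≤ (x + 1) ^ (i + 1) := by
  induction i with
  | zero => simp
  | succ i ih =>
    rw [Finset.sum_range_succ, pow_succ (x + 1)]
    calc x ^ (i + 1 + 1) + (∑ j ∈ Finset.range i, x ^ (j + 1) + x ^ (i + 1)) + 1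
        ≤ (x ^ (i + 1) + ∑ j ∈ Finset.range i, x ^ (j + 1) + 1) * (x + 1) := by
          have h0 : 0 ≤ (∑ j ∈ Finset.range i, x ^ (j + 1)) * x + x := Nat.zero_le _
          rw [pow_succ x (i + 1)]
          nlinarith
      _ ≤ _ := Nat.mul_le_mul_right _ ih

theorem length_bucketUpdate_le {t : ℕ} {s : State n} {x : ℕ}
    (hs : ∀ i, (s.bucket i).length ≤ m * x ^ (i + 1))
    (S : Fin (topLevel Ts k t + 1) → Fin m → Fin n) (i : ℕ) :
    ((bucketUpdate A Ts k m t s S).bucket i).length ≤ m * (x + 1) ^ (i + 1) := by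
  by_cases hi : i < topLevel Ts k t + 1
  · rw [bucketUpdate]
    simp only [dif_pos hi, List.length_append, fresh, List.length_mapIdx, List.length_ofFn,
      List.length_flatMap, List.length_map]
    rw [sum_map_range_eq]
    have h1 := (length_evict_le (Real.log (Ts k : ℝ) / (m : ℝ)) (blockStart Ts k t)
      (s.bucket i)).trans (hs i)
    have h2 : ∑ j ∈ Finset.range i, (evict (Real.log (Ts k : ℝ) / (m : ℝ)) (blockStart Ts k t)
        (s.bucket j)).length ≤ ∑ j ∈ Finset.range i, m * x ^ (j + 1) :=
      Finset.sum_le_sum fun j _ => (length_evict_le _ _ _).trans (hs j)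
    rw [← Finset.mul_sum] at h2
    calc _ ≤ m * x ^ (i + 1) + m * ∑ j ∈ Finset.range i, x ^ (j + 1) + m :=
          add_le_add (add_le_add h1 h2) le_rfl
      _ = m * (x ^ (i + 1) + ∑ j ∈ Finset.range i, x ^ (j + 1) + 1) := by ring
      _ ≤ _ := Nat.mul_le_mul_left _ (pow_add_sum_pow_le x i)
  · rw [bucketUpdate]
    simp only [dif_neg hi]
    exact (hs i).trans (Nat.mul_le_mul_left _ (Nat.pow_le_pow_left (Nat.le_succ x) _))

/-- A crude bound that ignores evictions; only its logarithm enters the regret. -/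
theorem Consistent.length_le (hc : Consistent A Ts k m ℓ T h) {t : ℕ} (ht : t ≤ T) (i : ℕ) :
    ((h.1 t).bucket i).length ≤ m * (t + 1) ^ (i + 1) := by
  induction t generalizing i with
  | zero =>
    obtain ⟨S, hs⟩ := hc.init
    rw [hs]
    exact length_bucketUpdate_le (x := 0) (fun i => by simp [emptyState]) S i
  | succ t ih =>
    have h1 : ∀ i, ((updateWeights Ts (ℓ (t + 1)) (h.2 (t + 1)) (h.1 t)).bucket i).length ≤
        m * (t + 1) ^ (i + 1) := fun i => by
      simpa [updateWeights] using ih (by omega) i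
    by_cases h0 : Ts 0 ∣ t + 1
    · obtain ⟨S, hs⟩ := hc.update t ht h0
      rw [hs]
      exact length_bucketUpdate_le h1 S i
    · rw [hc.noUpdate t ht h0]
      exact (h1 i).trans (Nat.mul_le_mul_left _ (Nat.pow_le_pow_left (Nat.le_succ _) _))

end Contents

/-! ### The number of bad times -/

section BadCount

variable {n : ℕ} (Ts : ℕ → ℕ) (k : ℕ) (ε : ℝ) (ℓ : ℕ → Fin n → ℝ) (star : Fin n)

open Classical in
/-- The number of bad times of level `i` before time `t`. -/
def badCount (i : ℕ) (X : ℕ → ℕ → Set (Fin n × ℝ)) (t : ℕ) : ℕ :=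
  ((Finset.range t).filter fun s => BadTime Ts k ε ℓ star X i s).card

/-- A potential which is multiplied by `c` at every bad time and vanishes when the walk reaches
the end, frozen when `N` bad times are reached. -/
def potential (c : ℝ≥0∞) (N i : ℕ) (X : ℕ → ℕ → Set (Fin n × ℝ)) (t : ℕ) : ℝ≥0∞ :=
  if N ≤ badCount Ts k ε ℓ star i X t then c ^ N
  else if pos Ts k ε ℓ star X t = Ts k then 0 else c ^ badCount Ts k ε ℓ star i X t

variable {Ts k ε ℓ star}

theorem badCount_congr {i t : ℕ} {X X' : ℕ → ℕ → Set (Fin n × ℝ)} (h : ∀ u < t, X u = X' u) :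
    badCount Ts k ε ℓ star i X t = badCount Ts k ε ℓ star i X' t := by
  classical
  unfold badCount
  congr 1
  refine Finset.filter_congr fun s hs => ?_
  have hs' := Finset.mem_range.1 hs
  exact ⟨fun hb => hb.congr fun u hu => h u (by omega),
    fun hb => hb.congr fun u hu => (h u (by omega)).symm⟩

theorem potential_congr {c : ℝ≥0∞} {N i t : ℕ} {X X' : ℕ → ℕ → Set (Fin n × ℝ)}
    (h : ∀ u < t, X u = X' u) :
    potential Ts k ε ℓ star c N i X t = potential Ts k ε ℓ star c N i X' t := by
  rw [potential, potential, badCount_congr h, pos_congr h]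

open Classical in
theorem badCount_succ (i : ℕ) (X : ℕ → ℕ → Set (Fin n × ℝ)) (t : ℕ) :
    badCount Ts k ε ℓ star i X (t + 1) =
      badCount Ts k ε ℓ star i X t + if BadTime Ts k ε ℓ star X i t then 1 else 0 := by
  unfold badCount
  rw [Finset.range_add_one, Finset.filter_insert]
  split_ifs with h
  · rw [Finset.card_insert_of_notMem (by simp)]
  · rfl

theorem potential_le {c : ℝ≥0∞} {N i t : ℕ} {X : ℕ → ℕ → Set (Fin n × ℝ)}
    (hN : badCount Ts k ε ℓ star i X t ≤ N) :
    potential Ts k ε ℓ star c N i X t ≤ c ^ badCount Ts k ε ℓ star i X t := by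
  unfold potential
  split_ifs with h1 h2
  · rw [le_antisymm hN h1]
  · exact zero_le
  · exact le_rfl

theorem potential_succ_le_of_not_badTime {c : ℝ≥0∞} {N i t : ℕ} {X : ℕ → ℕ → Set (Fin n × ℝ)}
    (ht : t < Ts k) (hbad : ¬ BadTime Ts k ε ℓ star X i t) :
    potential Ts k ε ℓ star c N i X (t + 1) ≤ potential Ts k ε ℓ star c N i X t := by
  have hcount : badCount Ts k ε ℓ star i X (t + 1) = badCount Ts k ε ℓ star i X t := by
    rw [badCount_succ, if_neg hbad, add_zero]
  by_cases h1 : N ≤ badCount Ts k ε ℓ star i X t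
  · simp only [potential, hcount, if_pos h1, le_refl]
  · by_cases h2 : pos Ts k ε ℓ star X t = Ts k
    · have h3 : pos Ts k ε ℓ star X (t + 1) = Ts k := by
        simp only [pos]
        rw [if_neg (by omega), h2]
      simp only [potential, hcount, if_neg h1, if_pos h2, if_pos h3, le_refl]
    · refine (potential_le (by rw [hcount]; omega)).trans (le_of_eq ?_)
      rw [potential, if_neg h1, if_neg h2, hcount]

/-- If `t` can be bad and the potential is not frozen, `ev_uniform_le_of_plant` applies to the
samples of level `i`: bad samples gain the factor `exp (m / n)`, while their plantings keep the
higher levels bad and send the walk to the end, where the potential is zero. In the remaining cases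
it cannot grow. -/
theorem ev_potential_update_le [NeZero n] (A : ArrivalRule) {m : ℕ} (hS : Sizes Ts k) (hε : 0 ≤ ε)
    (hℓ : ∀ t e, 0 ≤ ℓ t e) {N i t : ℕ} (hi : i < k) (ht : t < Ts k)
    (X : ℕ → ℕ → Set (Fin n × ℝ)) (s : State n) :
    ev (updateBuckets A Ts k m t s) (fun s' =>
        potential Ts k ε ℓ star (ENNReal.ofReal (Real.exp (m / n))) N i
          (Function.update X t (contents s')) (t + 1)) ≤
      potential Ts k ε ℓ star (ENNReal.ofReal (Real.exp (m / n))) N i X t := by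
  set c := ENNReal.ofReal (Real.exp ((m : ℝ) / n)) with hc
  have hold : ∀ s' : State n, ∀ u < t, Function.update X t (contents s') u = X u := fun s' u hu =>
    Function.update_of_ne (by omega) _ _
  have hpot : ∀ s' : State n, potential Ts k ε ℓ star c N i (Function.update X t (contents s')) t =
      potential Ts k ε ℓ star c N i X t := fun s' => potential_congr (hold s')
  have hpos : ∀ s' : State n, pos Ts k ε ℓ star (Function.update X t (contents s')) t =
      pos Ts k ε ℓ star X t := fun s' => pos_congr (hold s')
  have hcnt : ∀ s' : State n, badCount Ts k ε ℓ star i (Function.update X t (contents s')) t =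
      badCount Ts k ε ℓ star i X t := fun s' => badCount_congr (hold s')
  have htriv : (∀ s' : State n, ¬ BadTime Ts k ε ℓ star (Function.update X t (contents s')) i t) →
      ev (updateBuckets A Ts k m t s) (fun s' => potential Ts k ε ℓ star c N i
        (Function.update X t (contents s')) (t + 1)) ≤ potential Ts k ε ℓ star c N i X t := by
    intro h
    refine (ev_mono _ fun s' => ?_).trans (ev_const _ _).le
    exact (potential_succ_le_of_not_badTime ht (h s')).trans (hpot s').le
  by_cases hvis : pos Ts k ε ℓ star X t = t
  swap
  · refine htriv fun s' hb => hvis ?_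
    rw [← hpos s']
    exact hb.2.1
  by_cases hdvd : Ts i ∣ t
  swap
  · exact htriv fun s' hb => hdvd hb.1
  by_cases hN : N ≤ badCount Ts k ε ℓ star i X t
  · refine (ev_mono _ fun s' => ?_).trans (ev_const _ _).le
    have h1 : N ≤ badCount Ts k ε ℓ star i (Function.update X t (contents s')) (t + 1) := by
      rw [badCount_succ, hcnt]
      omega
    rw [potential, potential, if_pos h1, if_pos hN]
  push Not at hN
  have hpt : potential Ts k ε ℓ star c N i X t = c ^ badCount Ts k ε ℓ star i X t := by
    rw [potential, if_neg (by omega), if_neg (by omega)]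
  rw [hpt, updateBuckets_eq, ev_map]
  have hit : i < topLevel Ts k t + 1 := Nat.lt_succ_of_le (hS.le_topLevel hi hdvd)
  set K := topLevel Ts k t with hK
  set i' : Fin (K + 1) := ⟨i, hit⟩ with hi'
  set Y : (Fin (K + 1) → Fin m → Fin n) → ℕ → Set (Fin n × ℝ) :=
    fun S => contents (bucketUpdate A Ts k m t s S) with hY
  have hYj : ∀ S, ∀ j : Fin (K + 1), Y S j =
      baseSet A Ts k m t s j ∪ sampleSet (S j) fun r => A.smp t j r := fun S j =>
    contents_bucketUpdate t s S j
  have hbadiff : ∀ S, BadTime Ts k ε ℓ star (Function.update X t (Y S)) i t ↔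
      ∀ j : Fin (K + 1), i ≤ j → Bad Ts k ε ℓ star j t (Y S j) := by
    intro S
    constructor
    · intro hb j hj
      have := hb.2.2 j hj (Nat.lt_succ_iff.1 j.2)
      rwa [Function.update_self] at this
    · intro hb
      refine ⟨hdvd, (hpos _).trans hvis, fun j h1 h2 => ?_⟩
      rw [Function.update_self]
      exact hb ⟨j, Nat.lt_succ_of_le h2⟩ h1
  refine ev_uniform_le_of_plant i' star
    (fun S => ∀ j : Fin (K + 1), i ≤ j → Bad Ts k ε ℓ star j t (Y S j))
    (fun S => (∀ j : Fin (K + 1), i < j → Bad Ts k ε ℓ star j t (Y S j)) ∧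
      CanJump Ts k ε ℓ star i t (Y S i') (Ts k)) ?_ ?_ ?_ _ _ ?_ ?_ ?_
  · intro S hb
    have h1 := hb i' le_rfl
    rw [hYj] at h1
    exact ne_star_of_bad hS hε hℓ hi ht (fun r => A.smp_mem t i r) h1
  · intro S hb R hR
    refine ⟨fun j hj => ?_, ?_⟩
    · have hne : j ≠ i' := fun h => by
        rw [h] at hj
        exact lt_irrefl _ hj
      have h1 := hb j hj.le
      rw [hYj] at h1 ⊢
      rwa [Function.update_of_ne hne]
    · have h1 := hb i' le_rfl
      rw [hYj] at h1 ⊢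
      rw [Function.update_self]
      exact canJump_of_plant hS hε hℓ hi ht (fun r => A.smp_mem t i r) h1 hR
  · intro S hb hd
    exact hb i' le_rfl _ hd.2
  · intro S hb
    have hbt := (hbadiff S).2 hb
    have h1 : badCount Ts k ε ℓ star i (Function.update X t (Y S)) (t + 1) =
        badCount Ts k ε ℓ star i X t + 1 := by
      rw [badCount_succ, if_pos hbt, hcnt]
    refine (potential_le (by rw [h1]; omega)).trans (le_of_eq ?_)
    rw [h1, pow_succ]
  · intro S hd
    have hnb : ¬ BadTime Ts k ε ℓ star (Function.update X t (Y S)) i t := fun hb =>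
      (hbadiff S).1 hb i' le_rfl _ hd.2
    have h1 : badCount Ts k ε ℓ star i (Function.update X t (Y S)) (t + 1) =
        badCount Ts k ε ℓ star i X t := by
      rw [badCount_succ, if_neg hnb, hcnt, add_zero]
    have h2 : pos Ts k ε ℓ star (Function.update X t (Y S)) (t + 1) = Ts k := by
      simp only [pos]
      rw [if_pos ((hpos _).trans hvis), Function.update_self]
      exact nextPos_eq_of_canJump (i := i) (Nat.lt_succ_iff.1 hit)
        (fun j hj1 hj2 => hd.1 ⟨j, Nat.lt_succ_of_le hj2⟩ hj1) hd.2
    rw [potential, h1, if_neg (by omega), if_pos h2]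
  · intro S hb
    have hnb : ¬ BadTime Ts k ε ℓ star (Function.update X t (Y S)) i t := fun h =>
      hb ((hbadiff S).1 h)
    exact (potential_succ_le_of_not_badTime ht hnb).trans ((hpot _).trans hpt).le

theorem ev_potential_le [NeZero n] (A : ArrivalRule) {m : ℕ} (hS : Sizes Ts k) (hε : 0 ≤ ε)
    (hℓ : ∀ t e, 0 ≤ ℓ t e) {N i : ℕ} (hN : 0 < N) (hi : i < k) :
    ev (runTraj A Ts k m ℓ (Ts k)) (fun h => potential Ts k ε ℓ star
      (ENNReal.ofReal (Real.exp (m / n))) N i (fun t => contents (h.1 t)) (Ts k)) ≤ 1 := by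
  set c := ENNReal.ofReal (Real.exp ((m : ℝ) / n)) with hc
  have hTpos := hS.pos (le_refl k)
  -- The potential at time `t + 1` already uses the buckets of time `t`, so its index runs one ahead
  -- of the trajectory; the cap discards the update at the final time.
  have hend : (fun h : Traj n => potential Ts k ε ℓ star c N i (fun t => contents (h.1 t)) (Ts k)) =
      fun h => potential Ts k ε ℓ star c N i (fun t => contents (h.1 t))
        (min (Ts k + 1) (Ts k)) := by
    rw [min_eq_right (Nat.le_succ _)]
  rw [hend]
  refine ev_runTraj_le A Ts k m ℓ (fun t h => potential Ts k ε ℓ star c N i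
    (fun t => contents (h.1 t)) (min (t + 1) (Ts k))) 1 ?_ (Ts k) fun t ht h => ?_
  · rw [runTraj, ev_map]
    rw [min_eq_left (by omega)]
    have h1 := ev_potential_update_le (star := star) (N := N) (m := m) A hS hε hℓ hi hTpos
      (fun _ _ => ∅) (emptyState n)
    have h2 : potential Ts k ε ℓ star c N i (fun _ _ => ∅) 0 = 1 := by
      have h0 : badCount Ts k ε ℓ star i (fun _ _ => ∅) 0 = 0 := by simp [badCount]
      rw [potential, h0, if_neg (by omega), if_neg, pow_zero]
      simp only [pos]
      omega
    rw [← hc, h2] at h1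
    refine (ev_mono _ fun s' => le_of_eq ?_).trans h1
    refine potential_congr fun u hu => ?_
    obtain rfl : u = 0 := by omega
    rw [Function.update_self]
  · have hcont : ∀ s' : State n, (fun u => contents (Function.update h.1 (t + 1) s' u)) =
        Function.update (fun u => contents (h.1 u)) (t + 1) (contents s') := by
      intro s'
      funext u
      by_cases hu : u = t + 1
      · subst hu
        simp
      · simp [hu]
    rw [trajStep, ev_bind]
    simp only [ev_map, hcont]
    rcases (Nat.succ_le_of_lt ht).eq_or_lt with heq | hlt
    · have h1 : min (t + 1 + 1) (Ts k) = t + 1 := by omega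
      have h2 : min (t + 1) (Ts k) = t + 1 := by omega
      rw [h1, h2]
      have h3 : ∀ s' : State n, potential Ts k ε ℓ star c N i
          (Function.update (fun u => contents (h.1 u)) (t + 1) (contents s')) (t + 1) =
          potential Ts k ε ℓ star c N i (fun u => contents (h.1 u)) (t + 1) := fun s' =>
        potential_congr fun u hu => Function.update_of_ne (by omega) _ _
      simp only [h3, ev_const, le_refl]
    · rw [min_eq_left (by omega : t + 1 + 1 ≤ Ts k), min_eq_left (by omega : t + 1 ≤ Ts k)]
      refine (ev_mono _ fun y => ?_).trans (ev_const _ _).le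
      unfold nextState
      split_ifs with h0
      · exact ev_potential_update_le A hS hε hℓ hi hlt _ _
      · rw [ev_pure]
        have hold : ∀ u < t + 1, Function.update (fun u => contents (h.1 u)) (t + 1)
            (contents (updateWeights Ts (ℓ (t + 1)) y (h.1 t))) u = contents (h.1 u) :=
          fun u hu => Function.update_of_ne (by omega) _ _
        refine (potential_succ_le_of_not_badTime hlt fun hb => ?_).trans
          (potential_congr hold).le
        exact h0 (visited_dvd hS _ hb.2.1)

/-- The number of bad times is small with high probability. -/
theorem badCount_concentration [NeZero n] (A : ArrivalRule) {m : ℕ} (hm : 0 < m)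
    (hS : Sizes Ts k) (hε : 0 ≤ ε) (hℓ : ∀ t e, 0 ≤ ℓ t e) {i : ℕ} (hi : i < k) (Γ : ℝ) (hΓ : 0 ≤ Γ) :
    (runTraj A Ts k m ℓ (Ts k)).toOuterMeasure {h | (n : ℝ) / m * Γ <
        badCount Ts k ε ℓ star i (fun t => contents (h.1 t)) (Ts k)} ≤
      ENNReal.ofReal (Real.exp (-Γ)) := by
  have hn : (0 : ℝ) < n := by exact_mod_cast Nat.pos_of_ne_zero (NeZero.ne n)
  have hm' : (0 : ℝ) < m := by exact_mod_cast hm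
  -- The least integer above `n / m * Γ`, so that `exp (m / n) ^ N ≥ exp Γ`.
  set N := ⌊(n : ℝ) / m * Γ⌋₊ + 1 with hN
  have hNlt : (n : ℝ) / m * Γ < N := by
    rw [hN]
    push_cast
    exact Nat.lt_floor_add_one _
  have h1 := mul_toOuterMeasure_le_ev (runTraj A Ts k m ℓ (Ts k)) _
    (ENNReal.ofReal (Real.exp ((m : ℝ) / n)) ^ N) {h | (n : ℝ) / m * Γ <
        badCount Ts k ε ℓ star i (fun t => contents (h.1 t)) (Ts k)} (fun h hh => by
      have h2 : N ≤ badCount Ts k ε ℓ star i (fun t => contents (h.1 t)) (Ts k) :=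
        Nat.succ_le_of_lt ((Nat.floor_lt (by positivity)).2 hh)
      exact (if_pos h2 : potential Ts k ε ℓ star _ N i (fun t => contents (h.1 t)) (Ts k) = _).ge)
  replace h1 := h1.trans (ev_potential_le A hS hε hℓ (Nat.succ_pos _) hi)
  have h2 : ENNReal.ofReal (Real.exp Γ) ≤ ENNReal.ofReal (Real.exp ((m : ℝ) / n)) ^ N := by
    rw [← ENNReal.ofReal_pow (Real.exp_pos _).le, ← Real.exp_nat_mul]
    refine ENNReal.ofReal_le_ofReal (Real.exp_le_exp.2 ?_)
    calc Γ = ((n : ℝ) / m * Γ) * (m / n) := by field_simp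
      _ ≤ N * (m / n) := by gcongr
  have h3 : ENNReal.ofReal (Real.exp (-Γ)) * ENNReal.ofReal (Real.exp Γ) = 1 := by
    rw [← ENNReal.ofReal_mul (Real.exp_pos _).le, ← Real.exp_add]
    simp
  set P := (runTraj A Ts k m ℓ (Ts k)).toOuterMeasure {h | (n : ℝ) / m * Γ <
        badCount Ts k ε ℓ star i (fun t => contents (h.1 t)) (Ts k)}
  calc P = ENNReal.ofReal (Real.exp (-Γ)) * (ENNReal.ofReal (Real.exp Γ) * P) := by
        rw [← mul_assoc, h3, one_mul]
    _ ≤ ENNReal.ofReal (Real.exp (-Γ)) * 1 := by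
        gcongr
        exact (mul_le_mul_left h2 _).trans h1
    _ = _ := mul_one _

end BadCount

/-! ### Regret on one block -/

section BlockRegret

/-- The moment parameter is `1 / √D`: the second order term costs at most `D / √D = √D`, and the
deviation costs `Γ * √D`. -/
theorem sum_le_of_concentration {b D : ℕ} (hD : 0 < D) {f μ : ℕ → ℝ} (hμ : ∀ x, μ x ≤ 1) {Γ : ℝ}
    (h : ∑ x ∈ Finset.Ico b (b + D),
      ((√(D : ℝ))⁻¹ * f x - ((√(D : ℝ))⁻¹ + (√(D : ℝ))⁻¹ ^ 2) * μ x) ≤ Γ) :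
    ∑ x ∈ Finset.Ico b (b + D), f x ≤ ∑ x ∈ Finset.Ico b (b + D), μ x + (1 + Γ) * √(D : ℝ) := by
  set r := √(D : ℝ) with hr
  have hD' : (0 : ℝ) < D := by exact_mod_cast hD
  have hr0 : 0 < r := Real.sqrt_pos.2 hD'
  have hrr : r * r = D := Real.mul_self_sqrt hD'.le
  have hμs : ∑ x ∈ Finset.Ico b (b + D), μ x ≤ D := by
    calc ∑ x ∈ Finset.Ico b (b + D), μ x ≤ ∑ _x ∈ Finset.Ico b (b + D), (1 : ℝ) :=
          Finset.sum_le_sum fun x _ => hμ x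
      _ = D := by simp
  rw [Finset.sum_sub_distrib, ← Finset.mul_sum, ← Finset.mul_sum] at h
  set F := ∑ x ∈ Finset.Ico b (b + D), f x
  set M := ∑ x ∈ Finset.Ico b (b + D), μ x
  have h1 := mul_le_mul_of_nonneg_left h hr0.le
  have h2 : r * (r⁻¹ * F - (r⁻¹ + r⁻¹ ^ 2) * M) = F - M - r⁻¹ * M := by
    field_simp
    ring
  have h3 : r⁻¹ * M ≤ r := by
    calc r⁻¹ * M ≤ r⁻¹ * (r * r) := by
          rw [hrr]
          gcongr
      _ = r := by field_simp
  rw [h2] at h1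
  linarith

variable {n : ℕ} {A : ArrivalRule} {Ts : ℕ → ℕ} {k m : ℕ} {ℓ : ℕ → Fin n → ℝ} {T : ℕ} {h : Traj n}

theorem sum_Ico_eq_sum_range_add (f : ℕ → ℝ) (b D : ℕ) :
    ∑ x ∈ Finset.Ico b (b + D), f x = ∑ d ∈ Finset.range D, f (b + d) := by
  rw [Finset.sum_Ico_eq_sum_range, Nat.add_sub_cancel_left]

theorem Consistent.sum_mean_pickLaw_le [NeZero n] (hc : Consistent A Ts k m ℓ T h)
    (hS : Sizes Ts k) (hℓ : ∀ t e, ℓ t e ∈ Set.Icc (0 : ℝ) 1) {b i : ℕ} (hi : i < k)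
    (hd : Ts i ∣ b) (hT : b + Ts i ≤ T) {B : ℝ} (hB : 0 ≤ B)
    (hlen : Real.log ((h.1 b).bucket i).length ≤ B ^ 2) {z : Fin n × ℝ}
    (hz : z ∈ contents (h.1 b) i) :
    ∑ x ∈ Finset.Ico b (b + Ts i), mean (pickLaw (h.1 x) i) (ℓ (x + 1)) ≤
      cumLoss ℓ b (b + Ts i) z.1 + 2 * B * √(Ts i : ℝ) := by
  obtain ⟨e, he, rfl⟩ := hz
  have hne : (h.1 b).bucket i ≠ [] := List.ne_nil_of_mem he
  have hpos : (0 : ℝ) < Ts i := by exact_mod_cast hS.pos hi.le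
  set L := (h.1 b).bucket i with hL
  obtain ⟨j, hj⟩ := List.get_of_mem he
  have hlen1 : (1 : ℝ) ≤ L.length := by exact_mod_cast List.length_pos_iff.2 hne
  have hlog0 : 0 ≤ Real.log L.length := Real.log_nonneg hlen1
  set η := √(Real.log (L.length : ℝ) / (Ts i : ℝ)) with hη
  set g : ℕ → Fin L.length → ℝ := fun u j => ℓ (b + u + 1) (L.get j).expert with hg
  have hmean : ∑ x ∈ Finset.Ico b (b + Ts i), mean (pickLaw (h.1 x) i) (ℓ (x + 1)) =
      ∑ d ∈ Finset.range (Ts i), hedgeLoss η g d := by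
    rw [sum_Ico_eq_sum_range_add]
    refine Finset.sum_congr rfl fun d hd' => ?_
    have := Finset.mem_range.1 hd'
    exact hc.mean_pickLaw_eq hS hℓ hi hd this (by omega) hne
  have hcum : cumLoss ℓ b (b + Ts i) e.expert = ∑ d ∈ Finset.range (Ts i), g d j := by
    rw [cumLoss, sum_Ico_eq_sum_range_add (fun x => ℓ (x + 1) e.expert)]
    simp only [hg, hj]
  have hη0 : 0 ≤ η := Real.sqrt_nonneg _
  have hηsq : η ^ 2 * Ts i = Real.log L.length := by
    rw [hη, Real.sq_sqrt (by positivity)]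
    field_simp
  have hsq : 0 ≤ √(Ts i : ℝ) := Real.sqrt_nonneg _
  have hηT : η * Ts i ≤ B * √(Ts i : ℝ) := by
    have h1 : η * √(Ts i : ℝ) ≤ B := by
      rw [hη, ← Real.sqrt_mul (by positivity), div_mul_cancel₀ _ hpos.ne']
      exact Real.sqrt_le_iff.2 ⟨hB, hlen⟩
    calc η * Ts i = (η * √(Ts i : ℝ)) * √(Ts i : ℝ) := by
          rw [mul_assoc, Real.mul_self_sqrt hpos.le]
      _ ≤ B * √(Ts i : ℝ) := by gcongr
  have hreg := hedge_regret η g hη0 (fun d x => hℓ _ _) (Ts i) j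
  rw [Fintype.card_fin] at hreg
  rw [hmean]
  simp only [hcum]
  -- Rate zero means a bucket with a single entry, whose loss is then exactly the mean loss.
  rcases hη0.eq_or_lt with h0 | h0
  · have hlen' : L.length = 1 := by
      rw [← h0] at hηsq
      have h1 : Real.log L.length = 0 := by rw [← hηsq]; ring
      rcases Real.log_eq_zero.1 h1 with h2 | h2 | h2
      · linarith
      · exact_mod_cast h2
      · linarith
    have hsub : Subsingleton (Fin L.length) := by
      rw [hlen']
      infer_instance
    have : ∀ d, hedgeLoss η g d = g d j := by
      intro d
      have huniv : (Finset.univ : Finset (Fin L.length)) = {j} :=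
        Finset.eq_singleton_iff_unique_mem.2 ⟨Finset.mem_univ j, fun x _ => Subsingleton.elim x j⟩
      rw [hedgeLoss, huniv, Finset.sum_singleton, Finset.sum_singleton,
        mul_div_cancel_left₀ _ (Real.exp_pos _).ne']
    simp only [this]
    have := mul_nonneg (mul_nonneg zero_le_two hB) hsq
    linarith
  · refine le_of_mul_le_mul_left (hreg.trans ?_) h0
    have h1 := mul_le_mul_of_nonneg_left hηT hη0
    rw [← hηsq]
    nlinarith

theorem Consistent.sum_mean_mixLaw_le (hc : Consistent A Ts k m ℓ T h)
    (hS : Sizes Ts k) (hℓ : ∀ t e, ℓ t e ∈ Set.Icc (0 : ℝ) 1) {b i : ℕ} (hi : i + 1 < k)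
    (hd : Ts (i + 1) ∣ b) (hT : b + Ts (i + 1) ≤ T) (j : Fin 2) :
    ∑ x ∈ Finset.Ico b (b + Ts (i + 1)),
        mean (mixLaw (h.1 x) i (h.2 (x + 1) i).2 (h.2 (x + 1) (i + 1)).1) (ℓ (x + 1)) ≤
      ∑ x ∈ Finset.Ico b (b + Ts (i + 1)), ℓ (x + 1)
          (if j = 0 then (h.2 (x + 1) (i + 1)).1 else (h.2 (x + 1) i).2) +
        2 * √(Ts (i + 1) : ℝ) := by
  have hpos : (0 : ℝ) < Ts (i + 1) := by exact_mod_cast hS.pos hi.le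
  set η := √(2 / (Ts (i + 1) : ℝ)) with hη
  set g : ℕ → Fin 2 → ℝ := fun u j => ℓ (b + u + 1)
    (if j = 0 then (h.2 (b + u + 1) (i + 1)).1 else (h.2 (b + u + 1) i).2) with hg
  have hmean : ∑ x ∈ Finset.Ico b (b + Ts (i + 1)),
      mean (mixLaw (h.1 x) i (h.2 (x + 1) i).2 (h.2 (x + 1) (i + 1)).1) (ℓ (x + 1)) =
      ∑ d ∈ Finset.range (Ts (i + 1)), hedgeLoss η g d := by
    rw [sum_Ico_eq_sum_range_add (fun x =>
      mean (mixLaw (h.1 x) i (h.2 (x + 1) i).2 (h.2 (x + 1) (i + 1)).1) (ℓ (x + 1)))]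
    refine Finset.sum_congr rfl fun d hd' => ?_
    have := Finset.mem_range.1 hd'
    exact hc.mean_mixLaw_eq hS hℓ hi hd this (by omega)
  have hcum : ∑ x ∈ Finset.Ico b (b + Ts (i + 1)), ℓ (x + 1)
      (if j = 0 then (h.2 (x + 1) (i + 1)).1 else (h.2 (x + 1) i).2) =
      ∑ d ∈ Finset.range (Ts (i + 1)), g d j :=
    sum_Ico_eq_sum_range_add (fun x => ℓ (x + 1)
      (if j = 0 then (h.2 (x + 1) (i + 1)).1 else (h.2 (x + 1) i).2)) _ _
  have hη0 : 0 < η := Real.sqrt_pos.2 (by positivity)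
  have hηsq : η ^ 2 * Ts (i + 1) = 2 := by
    rw [hη, Real.sq_sqrt (by positivity)]
    field_simp
  have hηT : 1 ≤ η * √(Ts (i + 1) : ℝ) := by
    rw [hη, ← Real.sqrt_mul (by positivity), div_mul_cancel₀ _ hpos.ne']
    exact Real.one_le_sqrt.2 one_le_two
  have hreg := hedge_regret η g hη0.le (fun d x => hℓ _ _) (Ts (i + 1)) j
  have hlog2 : Real.log (Fintype.card (Fin 2)) ≤ 1 := by
    rw [Fintype.card_fin]
    have := Real.log_two_lt_d9
    push_cast
    linarith
  rw [hmean, hcum]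
  refine le_of_mul_le_mul_left (hreg.trans ?_) hη0
  nlinarith

end BlockRegret

/-! ### The regret on a good trajectory -/

section GoodTrajectory

variable {n : ℕ} [NeZero n] (Ts : ℕ → ℕ) (k m : ℕ) (ℓ : ℕ → Fin n → ℝ) (star : Fin n)

/-- The losses of picks and predictions are close to their conditional means on every block, and
there are few bad times. -/
structure GoodTraj (Γ : ℝ) (h : Traj n) : Prop where
  pick : ∀ i < k, ∀ b < Ts k, b + Ts i ≤ Ts k →
    ∑ x ∈ Finset.Ico b (b + Ts i), ((√(Ts i : ℝ))⁻¹ * ℓ (x + 1) (h.2 (x + 1) i).1 -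
      ((√(Ts i : ℝ))⁻¹ + (√(Ts i : ℝ))⁻¹ ^ 2) * mean (pickLaw (h.1 x) i) (ℓ (x + 1))) ≤ Γ
  mix : ∀ i < k, ∀ b < Ts k, i + 1 < k → b + Ts (i + 1) ≤ Ts k →
    ∑ x ∈ Finset.Ico b (b + Ts (i + 1)),
      ((√(Ts (i + 1) : ℝ))⁻¹ * ℓ (x + 1) (h.2 (x + 1) (i + 1)).2 -
        ((√(Ts (i + 1) : ℝ))⁻¹ + (√(Ts (i + 1) : ℝ))⁻¹ ^ 2) *
          mean (mixLaw (h.1 x) i (h.2 (x + 1) i).2 (h.2 (x + 1) (i + 1)).1) (ℓ (x + 1))) ≤ Γ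
  count : ∀ i < k, (badCount Ts k (Real.log (Ts k : ℝ) / (m : ℝ)) ℓ star i
    (fun t => contents (h.1 t)) (Ts k) : ℝ) ≤ (n : ℝ) / m * Γ

variable {Ts k m ℓ star}

/-- The constant `3 + Γ + 2 * B` covers the deviation `1 + Γ` plus either the regret `2 * B` of a
bucket or the regret `2` of a mixing step, in units of `√(Ts j)`; it is spread evenly over the
block. -/
theorem GoodTraj.loss_le {A : ArrivalRule} {Γ B : ℝ} {h : Traj n}
    (hg : GoodTraj Ts k m ℓ star Γ h) (hc : Consistent A Ts k m ℓ (Ts k) h) (hS : Sizes Ts k)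
    (hℓ : ∀ t e, ℓ t e ∈ Set.Icc (0 : ℝ) 1) (hΓ : 0 ≤ Γ) (hB : 0 ≤ B)
    (hlen : ∀ b < Ts k, ∀ i < k, Real.log ((h.1 b).bucket i).length ≤ B ^ 2) :
    ∑ x ∈ Finset.range (Ts k), ℓ (x + 1) (h.2 (x + 1) (k - 1)).2 ≤
      (1 + Real.log (Ts k : ℝ) / (m : ℝ)) ^ k * cumLoss ℓ 0 (Ts k) star +
        Ts 0 * ((n : ℝ) / m * Γ) + ∑ j ∈ Finset.range k, 2 * ((3 + Γ + 2 * B) / √(Ts j : ℝ)) *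
          (if j + 1 < k then Ts (j + 1) * ((n : ℝ) / m * Γ) else Ts k) := by
  classical
  have hTpos := hS.pos (le_refl k)
  have hblock : ∀ j ≤ k, ∀ b, ∑ _x ∈ Finset.Ico b (b + Ts j),
      (3 + Γ + 2 * B) / √(Ts j : ℝ) = (3 + Γ + 2 * B) * √(Ts j : ℝ) := by
    intro j hj b
    have hpos : (0 : ℝ) < Ts j := by exact_mod_cast hS.pos hj
    rw [Finset.sum_const, Nat.card_Ico, Nat.add_sub_cancel_left, nsmul_eq_mul, mul_div_left_comm,
      Real.div_sqrt]
  have hfit : ∀ j ≤ k, ∀ b, Ts j ∣ b → b < Ts k → b + Ts j ≤ Ts k := fun j hj b hd hb =>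
    add_le_of_dvd_of_lt hd (hS.dvd_of_le hj le_rfl) hb
  have hmixm : ∀ j, j + 1 < k → ∀ b, Ts (j + 1) ∣ b → b < Ts k → ∀ c : Fin 2,
      ∑ x ∈ Finset.Ico b (b + Ts (j + 1)), ℓ (x + 1) (h.2 (x + 1) (j + 1)).2 ≤
      ∑ x ∈ Finset.Ico b (b + Ts (j + 1)), (ℓ (x + 1)
        (if c = 0 then (h.2 (x + 1) (j + 1)).1 else (h.2 (x + 1) j).2) +
          (3 + Γ + 2 * B) / √(Ts (j + 1) : ℝ)) := by
    intro j hj b hd hb c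
    have h1 := sum_le_of_concentration (hS.pos hj.le)
      (fun x => mean_le_one _ _ fun e => (hℓ (x + 1) e).2)
      (hg.mix j (by omega) b hb hj (hfit _ hj.le b hd hb))
    have h2 := hc.sum_mean_mixLaw_le hS hℓ hj hd (hfit _ hj.le b hd hb) c
    rw [Finset.sum_add_distrib, hblock (j + 1) hj.le b]
    have h3 : 0 ≤ B * √(Ts (j + 1) : ℝ) := mul_nonneg hB (Real.sqrt_nonneg _)
    nlinarith
  refine total_loss_le (X := fun t => contents (h.1 t))
    (E := fun j x => ℓ (x + 1) (h.2 (x + 1) j).1) (Y := fun j x => ℓ (x + 1) (h.2 (x + 1) j).2)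
    (ρ := fun j => (3 + Γ + 2 * B) / √(Ts j : ℝ)) hS (hc.bucketPath hS) ?_ (fun t e => (hℓ t e).1)
    ?_ ?_ ?_ ?_ ?_ ?_ ?_
  · exact div_nonneg (Real.log_nonneg (by exact_mod_cast hTpos)) (Nat.cast_nonneg _)
  · intro j
    positivity
  · exact fun x => (hℓ _ _).2
  · intro j hj b hd hb z hz
    have h1 := sum_le_of_concentration (hS.pos hj.le)
      (fun x => mean_le_one _ _ fun e => (hℓ (x + 1) e).2)
      (hg.pick j hj b hb (hfit j hj.le b hd hb))
    have h2 := hc.sum_mean_pickLaw_le hS hℓ hj hd (hfit j hj.le b hd hb) hB (hlen b hb j hj) hz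
    rw [Finset.sum_sub_distrib, hblock j hj.le b]
    have h3 := Real.sqrt_nonneg (Ts j : ℝ)
    nlinarith
  · intro x hx
    simp only [hc.pick_zero x hx]
  · intro j hj b hd hb
    simpa using hmixm j hj b hd hb 0
  · intro j hj b hd hb
    simpa using hmixm j hj b hd hb 1
  · exact fun j hj => hg.count j hj

end GoodTrajectory

/-! ### Good trajectories are likely -/

section Probability

variable {n : ℕ} [NeZero n] {Ts : ℕ → ℕ} {k m : ℕ} {ℓ : ℕ → Fin n → ℝ}

/-- A union bound: for each level, two deviation events per starting time and one event for the bad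
times. -/
theorem toOuterMeasure_not_goodTraj_le (A : ArrivalRule) (hm : 0 < m) (hS : Sizes Ts k)
    (hℓ : ∀ t e, ℓ t e ∈ Set.Icc (0 : ℝ) 1) (star : Fin n) {Γ : ℝ} (hΓ : 0 ≤ Γ) :
    (runTraj A Ts k m ℓ (Ts k)).toOuterMeasure {h | ¬ GoodTraj Ts k m ℓ star Γ h} ≤
      (k * (2 * Ts k + 1) : ℕ) * ENNReal.ofReal (Real.exp (-Γ)) := by
  set μ := (runTraj A Ts k m ℓ (Ts k)).toOuterMeasure with hμ
  set δ := ENNReal.ofReal (Real.exp (-Γ)) with hδ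
  set P : ℕ → ℕ → Set (Traj n) := fun i b => {h | b + Ts i ≤ Ts k ∧
    Γ < ∑ x ∈ Finset.Ico b (b + Ts i), ((√(Ts i : ℝ))⁻¹ * ℓ (x + 1) (h.2 (x + 1) i).1 -
      ((√(Ts i : ℝ))⁻¹ + (√(Ts i : ℝ))⁻¹ ^ 2) * mean (pickLaw (h.1 x) i) (ℓ (x + 1)))} with hP
  set Q : ℕ → ℕ → Set (Traj n) := fun i b => {h | (i + 1 < k ∧ b + Ts (i + 1) ≤ Ts k) ∧
    Γ < ∑ x ∈ Finset.Ico b (b + Ts (i + 1)),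
      ((√(Ts (i + 1) : ℝ))⁻¹ * ℓ (x + 1) (h.2 (x + 1) (i + 1)).2 -
        ((√(Ts (i + 1) : ℝ))⁻¹ + (√(Ts (i + 1) : ℝ))⁻¹ ^ 2) *
          mean (mixLaw (h.1 x) i (h.2 (x + 1) i).2 (h.2 (x + 1) (i + 1)).1) (ℓ (x + 1)))} with hQ
  set Z : ℕ → Set (Traj n) := fun i => {h | (n : ℝ) / m * Γ <
    badCount Ts k (Real.log (Ts k : ℝ) / (m : ℝ)) ℓ star i (fun t => contents (h.1 t)) (Ts k)}
    with hZ
  have hrate : ∀ j ≤ k, 0 ≤ (√(Ts j : ℝ))⁻¹ ∧ (√(Ts j : ℝ))⁻¹ ≤ 1 := by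
    intro j hj
    have h1 : (1 : ℝ) ≤ Ts j := by exact_mod_cast hS.pos hj
    exact ⟨inv_nonneg.2 (Real.sqrt_nonneg _), inv_le_one_of_one_le₀ (Real.one_le_sqrt.2 h1)⟩
  have hε : 0 ≤ Real.log (Ts k : ℝ) / (m : ℝ) :=
    div_nonneg (Real.log_nonneg (by exact_mod_cast hS.pos (le_refl k))) (Nat.cast_nonneg _)
  have hPle : ∀ i < k, ∀ b, μ (P i b) ≤ δ := by
    intro i hi b
    by_cases hb : b + Ts i ≤ Ts k
    · exact (μ.mono fun h hh => hh.2).trans (pick_concentration A Ts k m ℓ hℓ hi (hrate i hi.le).1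
        (hrate i hi.le).2 hb Γ)
    · have : P i b = ∅ := Set.eq_empty_iff_forall_notMem.2 fun h hh => hb hh.1
      rw [this, MeasureTheory.measure_empty]
      exact zero_le
  have hQle : ∀ i < k, ∀ b, μ (Q i b) ≤ δ := by
    intro i hi b
    by_cases hb : i + 1 < k ∧ b + Ts (i + 1) ≤ Ts k
    · exact (μ.mono fun h hh => hh.2).trans (mix_concentration A Ts k m ℓ hℓ hb.1
        (hrate (i + 1) hi).1 (hrate (i + 1) hi).2 hb.2 Γ)
    · have : Q i b = ∅ := Set.eq_empty_iff_forall_notMem.2 fun h hh => hb hh.1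
      rw [this, MeasureTheory.measure_empty]
      exact zero_le
  have hZle : ∀ i < k, μ (Z i) ≤ δ := fun i hi =>
    badCount_concentration A hm hS hε (fun t e => (hℓ t e).1) hi Γ hΓ
  have hsub : {h | ¬ GoodTraj Ts k m ℓ star Γ h} ⊆
      ⋃ i ∈ Finset.range k, ((⋃ b ∈ Finset.range (Ts k), (P i b ∪ Q i b)) ∪ Z i) := by
    intro h hh
    by_contra hnot
    simp only [Set.mem_iUnion, Set.mem_union, Finset.mem_range, not_exists, not_or] at hnot
    refine hh ⟨fun i hi b hb hbi => ?_, fun i hi b hb hik hbi => ?_, fun i hi => ?_⟩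
    · by_contra hlt
      exact ((hnot i hi).1 b hb).1 ⟨hbi, not_le.1 hlt⟩
    · by_contra hlt
      exact ((hnot i hi).1 b hb).2 ⟨⟨hik, hbi⟩, not_le.1 hlt⟩
    · by_contra hlt
      exact (hnot i hi).2 (not_le.1 hlt)
  calc μ {h | ¬ GoodTraj Ts k m ℓ star Γ h}
      ≤ ∑ i ∈ Finset.range k, μ ((⋃ b ∈ Finset.range (Ts k), (P i b ∪ Q i b)) ∪ Z i) :=
        (μ.mono hsub).trans (MeasureTheory.measure_biUnion_finset_le _ _)
    _ ≤ ∑ i ∈ Finset.range k, (2 * Ts k + 1 : ℕ) * δ := by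
        refine Finset.sum_le_sum fun i hi => ?_
        have hi' := Finset.mem_range.1 hi
        refine (MeasureTheory.measure_union_le _ _).trans ?_
        have h1 : μ (⋃ b ∈ Finset.range (Ts k), (P i b ∪ Q i b)) ≤
            ∑ b ∈ Finset.range (Ts k), (δ + δ) :=
          (MeasureTheory.measure_biUnion_finset_le _ _).trans (Finset.sum_le_sum fun b _ =>
            (MeasureTheory.measure_union_le _ _).trans (add_le_add (hPle i hi' b) (hQle i hi' b)))
        refine (add_le_add h1 (hZle i hi')).trans (le_of_eq ?_)
        rw [Finset.sum_const, Finset.card_range, nsmul_eq_mul]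
        push_cast
        ring
    _ = (k * (2 * Ts k + 1) : ℕ) * δ := by
        rw [Finset.sum_const, Finset.card_range, nsmul_eq_mul]
        push_cast
        ring

theorem toOuterMeasure_add_compl {α : Type*} (p : PMF α) (s : Set α) :
    p.toOuterMeasure s + p.toOuterMeasure sᶜ = 1 := by
  rw [PMF.toOuterMeasure_apply, PMF.toOuterMeasure_apply, ← ENNReal.tsum_add, ← p.tsum_coe]
  exact tsum_congr fun a => by
    by_cases ha : a ∈ s <;> simp [ha]

end Probability

/-! ### The regret bound -/

section Regret

variable {n : ℕ} {Ts : ℕ → ℕ} {k m : ℕ} {ℓ : ℕ → Fin n → ℝ}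

theorem sum_Icc_one_eq (f : ℕ → ℝ) (T : ℕ) :
    ∑ t ∈ Finset.Icc 1 T, f t = ∑ x ∈ Finset.range T, f (x + 1) := by
  rw [Finset.range_eq_Ico, Finset.sum_Ico_add' f 0 T 1]
  rfl

theorem half_le_log {T : ℕ} (hT : 2 ≤ T) : 1 / 2 ≤ Real.log T := by
  have h1 : Real.log 2 ≤ Real.log T :=
    Real.log_le_log two_pos (by exact_mod_cast hT)
  linarith [Real.log_two_gt_d9]

theorem Sizes.cast_le_two_mul_log (hS : Sizes Ts k) : (k : ℝ) ≤ 2 * Real.log (Ts k) := by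
  have h1 : (2 : ℝ) ^ k ≤ Ts k := by exact_mod_cast hS.two_pow_le le_rfl
  have h2 := Real.log_le_log (by positivity) h1
  rw [Real.log_pow] at h2
  have h3 := Real.log_two_gt_d9
  have h4 : (0 : ℝ) ≤ k := Nat.cast_nonneg k
  nlinarith

theorem Sizes.two_le (hS : Sizes Ts k) : 2 ≤ Ts k := by
  have h1 := hS.two_pow_le (le_refl k)
  have h2 : 2 ^ 1 ≤ 2 ^ k := Nat.pow_le_pow_right two_pos hS.k_pos
  omega

theorem Consistent.log_length_le {A : ArrivalRule} {h : Traj n} {a : ℝ}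
    (hc : Consistent A Ts k m ℓ (Ts k) h) (hm : 0 < m) (hS : Sizes Ts k) (ha : 0 < a)
    (hma : (m : ℝ) ≤ (Ts k : ℝ) ^ a) {b i : ℕ} (hb : b < Ts k) (hi : i < k) :
    Real.log ((h.1 b).bucket i).length ≤ ((2 * a + 2) * Real.log (Ts k)) ^ 2 := by
  have hL := half_le_log hS.two_le
  have hkL := hS.cast_le_two_mul_log
  set L := Real.log (Ts k) with hLdef
  have hT1 : (1 : ℝ) ≤ Ts k := by exact_mod_cast hS.pos (le_refl k)
  have hm' : (0 : ℝ) < m := by exact_mod_cast hm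
  rcases Nat.eq_zero_or_pos ((h.1 b).bucket i).length with h0 | h0
  · rw [h0]
    simp only [Nat.cast_zero, Real.log_zero]
    positivity
  have h1 : ((h.1 b).bucket i).length ≤ m * (Ts k) ^ k := by
    refine (hc.length_le hb.le i).trans (Nat.mul_le_mul_left _ ?_)
    exact (Nat.pow_le_pow_left hb _).trans (Nat.pow_le_pow_right (hS.pos le_rfl) hi)
  have h2 : (((h.1 b).bucket i).length : ℝ) ≤ m * (Ts k : ℝ) ^ k := by exact_mod_cast h1
  have h3 := Real.log_le_log (by exact_mod_cast h0) h2
  rw [Real.log_mul hm'.ne' (by positivity), Real.log_pow] at h3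
  have h4 : Real.log m ≤ a * L := by
    have := Real.log_le_log hm' hma
    rwa [Real.log_rpow (by linarith)] at this
  have h5 : (k : ℝ) * L ≤ 2 * L * L := mul_le_mul_of_nonneg_right hkL (by linarith)
  have h6 : a * L ≤ 2 * a * L * L := by nlinarith [mul_pos ha (by linarith : 0 < L)]
  have h7 : (2 * a + 2) * (L * L) ≤ (2 * a + 2) ^ 2 * (L * L) := by
    refine mul_le_mul_of_nonneg_right ?_ (mul_self_nonneg L)
    nlinarith
  calc Real.log ((h.1 b).bucket i).length ≤ (2 * a + 2) * (L * L) := by linarith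
    _ ≤ (2 * a + 2) ^ 2 * (L * L) := h7
    _ = _ := by ring

theorem one_add_pow_sub_one_le {ε : ℝ} (hε : 0 ≤ ε) (h : k * ε ≤ 1) :
    (1 + ε) ^ k - 1 ≤ 2 * (k * ε) := by
  have h1 : (1 + ε) ^ k ≤ Real.exp (k * ε) := by
    rw [Real.exp_nat_mul]
    exact pow_le_pow_left₀ (by linarith) (by linarith [Real.add_one_le_exp ε]) k
  have h0 : 0 ≤ k * ε := by positivity
  have h2 := exp_sub_one_le h0 h
  nlinarith

/-- Only the last level pays on all days, so its term is free of the factor `Z`. -/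
theorem sum_sizes_eq (hS : Sizes Ts k) (g Z : ℝ) :
    ∑ j ∈ Finset.range k, 2 * (g / √(Ts j : ℝ)) * (if j + 1 < k then Ts (j + 1) * Z else Ts k) =
      2 * g * Z * ∑ j ∈ Finset.range (k - 1), (Ts (j + 1) : ℝ) / √(Ts j : ℝ) +
        2 * g * ((Ts k : ℝ) / √(prevSize Ts k : ℝ)) := by
  obtain ⟨l, rfl⟩ : ∃ l, k = l + 1 := ⟨k - 1, by have := hS.k_pos; omega⟩
  rw [Finset.sum_range_succ, Nat.add_sub_cancel, Finset.mul_sum]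
  congr 1
  · refine Finset.sum_congr rfl fun j hj => ?_
    have := Finset.mem_range.1 hj
    rw [if_pos (by omega)]
    ring
  · rw [if_neg (by omega), prevSize]
    ring

theorem sum_prevSize_eq (hS : Sizes Ts k) :
    ∑ i ∈ Finset.range k, (Ts i : ℝ) / √(prevSize Ts i : ℝ) =
      ∑ j ∈ Finset.range (k - 1), (Ts (j + 1) : ℝ) / √(Ts j : ℝ) + Ts 0 := by
  obtain ⟨l, rfl⟩ : ∃ l, k = l + 1 := ⟨k - 1, by have := hS.k_pos; omega⟩
  rw [Finset.sum_range_succ', Nat.add_sub_cancel]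
  simp [prevSize]

/-- The regret bound on a good trajectory. -/
theorem GoodTraj.regret_le [NeZero n] {A : ArrivalRule} {a γ : ℝ} {h : Traj n} {star : Fin n}
    (hg : GoodTraj Ts k m ℓ star ((γ + 2) * Real.log (Ts k)) h)
    (hc : Consistent A Ts k m ℓ (Ts k) h) (hm : 0 < m) (hS : Sizes Ts k) (ha : 0 < a) (hγ : 0 < γ)
    (hma : (m : ℝ) ≤ (Ts k : ℝ) ^ a) (hℓ : ∀ t e, ℓ t e ∈ Set.Icc (0 : ℝ) 1)
    (hstar : ∑ t ∈ Finset.Icc 1 (Ts k), ℓ t star = ⨅ e : Fin n, ∑ t ∈ Finset.Icc 1 (Ts k), ℓ t e) :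
    regret ℓ (Ts k) (fun u => (h.2 u (k - 1)).2) ≤
      (4 + 2 * (γ + 4 * a + 12) * (γ + 2)) * Real.log (Ts k : ℝ) ^ 2 * regretBound Ts k n m := by
  have hL := half_le_log hS.two_le
  have hkL := hS.cast_le_two_mul_log
  set L := Real.log (Ts k : ℝ) with hLdef
  set Γ := (γ + 2) * L with hΓdef
  set B := (2 * a + 2) * L with hBdef
  have hΓ1 : 1 ≤ Γ := by nlinarith
  have hB : 0 ≤ B := by positivity
  have hloss := hg.loss_le hc hS hℓ (by linarith) hB
    fun b hb i hi => hc.log_length_le hm hS ha hma hb hi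
  rw [sum_sizes_eq hS] at hloss
  rw [regret, ← hstar, sum_Icc_one_eq (fun t => ℓ t (h.2 t (k - 1)).2),
    sum_Icc_one_eq (fun t => ℓ t star)]
  have hcum : cumLoss ℓ 0 (Ts k) star = ∑ x ∈ Finset.range (Ts k), ℓ (x + 1) star := by
    rw [cumLoss, Finset.range_eq_Ico]
  have hcum0 : 0 ≤ cumLoss ℓ 0 (Ts k) star := cumLoss_nonneg ℓ (fun t e => (hℓ t e).1) _ _ _
  have hcard : ∀ f : ℕ → ℝ, (∀ x, f x ≤ 1) → ∑ x ∈ Finset.range (Ts k), f x ≤ Ts k := by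
    intro f hf
    calc ∑ x ∈ Finset.range (Ts k), f x ≤ ∑ _x ∈ Finset.range (Ts k), (1 : ℝ) :=
          Finset.sum_le_sum fun x _ => hf x
      _ = Ts k := by simp
  have hcumT : cumLoss ℓ 0 (Ts k) star ≤ Ts k := by
    rw [hcum]
    exact hcard _ fun x => (hℓ _ _).2
  have hlossT := hcard (fun x => ℓ (x + 1) (h.2 (x + 1) (k - 1)).2) fun x => (hℓ _ _).2
  rw [← hcum]
  set F := ∑ x ∈ Finset.range (Ts k), ℓ (x + 1) (h.2 (x + 1) (k - 1)).2 with hF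
  set R := cumLoss ℓ 0 (Ts k) star with hR
  rw [regretBound, sum_prevSize_eq hS]
  set V := ∑ j ∈ Finset.range (k - 1), (Ts (j + 1) : ℝ) / √(Ts j : ℝ) with hV
  set W := (Ts k : ℝ) / √(prevSize Ts k : ℝ) with hW
  set g := 3 + Γ + 2 * B with hgdef
  have hV0 : 0 ≤ V := Finset.sum_nonneg fun j _ => by positivity
  have hW0 : 0 ≤ W := by positivity
  have hm' : (0 : ℝ) < m := by exact_mod_cast hm
  have hT0 : (0 : ℝ) ≤ Ts k := Nat.cast_nonneg _
  have hM0 : 0 ≤ (Ts k : ℝ) / m := by positivity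
  have hnm : 0 ≤ (n : ℝ) / m := by positivity
  have hS0 : (0 : ℝ) ≤ Ts 0 := Nat.cast_nonneg _
  have hL2 : 0 ≤ L ^ 2 := sq_nonneg L
  -- Here `g = 3 + (γ + 4 * a + 6) * L`, and `3 ≤ 6 * L` because `L ≥ 1 / 2`.
  have hcoef : 2 * g * Γ ≤ 2 * (γ + 4 * a + 12) * (γ + 2) * L ^ 2 := by
    have h1 : g ≤ (γ + 4 * a + 12) * L := by
      rw [hgdef, hΓdef, hBdef]
      nlinarith
    calc 2 * g * Γ ≤ 2 * ((γ + 4 * a + 12) * L) * Γ := by gcongr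
      _ = _ := by rw [hΓdef]; ring
  have hg1 : 1 ≤ 2 * g := by
    rw [hgdef]
    linarith
  set D := 2 * (γ + 4 * a + 12) * (γ + 2) with hD
  have hD0 : 0 ≤ D := by positivity
  have hkεle : (k : ℝ) * (L / m) * Ts k ≤ 2 * L ^ 2 * ((Ts k : ℝ) / m) := by
    calc (k : ℝ) * (L / m) * Ts k ≤ (2 * L) * (L / m) * Ts k := by gcongr
      _ = _ := by ring
  have hbase : 4 * L ^ 2 * ((Ts k : ℝ) / m) ≤
      (4 + D) * L ^ 2 * ((Ts k : ℝ) / m + W + (n : ℝ) / m * (V + Ts 0)) := by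
    have h1 : (Ts k : ℝ) / m ≤ (Ts k : ℝ) / m + W + (n : ℝ) / m * (V + Ts 0) := by
      have : 0 ≤ (n : ℝ) / m * (V + Ts 0) := by positivity
      linarith
    calc 4 * L ^ 2 * ((Ts k : ℝ) / m) ≤ (4 + D) * L ^ 2 * ((Ts k : ℝ) / m) := by
          gcongr
          linarith
      _ ≤ _ := by gcongr
  -- If `k * ε > 1`, the trivial regret bound `Ts k` is already below the term in `Ts k / m`.
  by_cases hsmall : (k : ℝ) * (L / m) ≤ 1
  · have hε : 0 ≤ L / m := div_nonneg (by linarith) hm'.le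
    have h1 := one_add_pow_sub_one_le hε hsmall
    have h2 : (1 + L / m) ^ k * R - R ≤ 4 * L ^ 2 * ((Ts k : ℝ) / m) := by
      calc (1 + L / m) ^ k * R - R = ((1 + L / m) ^ k - 1) * R := by ring
        _ ≤ (2 * (k * (L / m))) * Ts k := by
            refine mul_le_mul h1 hcumT hcum0 (by positivity)
        _ ≤ _ := by linarith
    have h3 : 2 * g * W ≤ D * L ^ 2 * W := by
      refine mul_le_mul_of_nonneg_right (le_trans ?_ hcoef) hW0
      exact le_mul_of_one_le_right (by linarith) hΓ1
    have h4 : Ts 0 * ((n : ℝ) / m * Γ) + 2 * g * ((n : ℝ) / m * Γ) * V ≤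
        D * L ^ 2 * ((n : ℝ) / m * (V + Ts 0)) := by
      calc Ts 0 * ((n : ℝ) / m * Γ) + 2 * g * ((n : ℝ) / m * Γ) * V
          ≤ 2 * g * (Ts 0 * ((n : ℝ) / m * Γ)) + 2 * g * ((n : ℝ) / m * Γ) * V := by
            refine add_le_add_left (le_mul_of_one_le_left (by positivity) hg1) _
        _ = (2 * g * Γ) * ((n : ℝ) / m * (V + Ts 0)) := by ring
        _ ≤ _ := mul_le_mul_of_nonneg_right hcoef (by positivity)
    have h5 : 0 ≤ D * L ^ 2 * ((Ts k : ℝ) / m) := by positivity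
    have h6 : 0 ≤ 4 * L ^ 2 * (W + (n : ℝ) / m * (V + Ts 0)) := by positivity
    calc F - R ≤ 4 * L ^ 2 * ((Ts k : ℝ) / m) + D * L ^ 2 * W +
          D * L ^ 2 * ((n : ℝ) / m * (V + Ts 0)) := by linarith
      _ ≤ (4 * L ^ 2 * ((Ts k : ℝ) / m) + D * L ^ 2 * W +
          D * L ^ 2 * ((n : ℝ) / m * (V + Ts 0))) + (D * L ^ 2 * ((Ts k : ℝ) / m) +
            4 * L ^ 2 * (W + (n : ℝ) / m * (V + Ts 0))) := by linarith
      _ = _ := by ring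
  · push Not at hsmall
    have h1 : (Ts k : ℝ) ≤ (k : ℝ) * (L / m) * Ts k := le_mul_of_one_le_left hT0 hsmall.le
    have h2 : 0 ≤ 2 * L ^ 2 * ((Ts k : ℝ) / m) := by positivity
    linarith

end Regret

end

end HierBaseline

/-! ### The regret bound with high probability. -/

open HierBaseline in
theorem mainTheorem2 (γ a : ℝ) (hγ : 0 < γ) (ha : 0 < a) :
    ∃ C K : ℝ, ∃ c : ℕ, 0 < C ∧ 0 < K ∧
      ∀ (n : ℕ) [NeZero n] (m k : ℕ) (Ts : ℕ → ℕ),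
        0 < m → 0 < k → 0 < Ts 0 →
        (∀ i < k, Ts i < Ts (i + 1)) →
        (∀ i < k, Ts i ∣ Ts (i + 1)) →
        (m : ℝ) ≤ (Ts k : ℝ) ^ a →
        ∀ (A : HierBaseline.ArrivalRule) (ℓ : ℕ → Fin n → ℝ),
          (∀ t e, ℓ t e ∈ Set.Icc (0 : ℝ) 1) →
          ENNReal.ofReal (1 - K * (Ts k : ℝ) ^ (-γ)) ≤
            (HierBaseline.hierarchicalBaseline A Ts k m ℓ).toOuterMeasure
              {p | HierBaseline.regret ℓ (Ts k) p ≤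
                C * Real.log (Ts k : ℝ) ^ c * HierBaseline.regretBound Ts k n m} := by
  -- With `Γ = (γ + 2) * log T` each bad event has probability at most `T ^ (-γ) / T ^ 2`, and there
  -- are at most `k * (2 * T + 1) ≤ 3 * T ^ 2` of them, whence `K = 3`.
  refine ⟨4 + 2 * (γ + 4 * a + 12) * (γ + 2), 3, 2, by positivity, by norm_num, ?_⟩
  intro n _ m k Ts hm hk h0 hlt hdvd hma A ℓ hℓ
  have hS : Sizes Ts k := ⟨hk, h0, hlt, hdvd⟩
  have hT1 : (1 : ℝ) ≤ Ts k := by exact_mod_cast hS.pos (le_refl k)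
  have hT : (0 : ℝ) < Ts k := by linarith
  obtain ⟨star, hstar⟩ :=
    exists_eq_ciInf_of_finite (f := fun e : Fin n => ∑ t ∈ Finset.Icc 1 (Ts k), ℓ t e)
  set L := Real.log (Ts k : ℝ) with hL
  have hL0 : 0 ≤ L := Real.log_nonneg hT1
  set μ := runTraj A Ts k m ℓ (Ts k) with hμ
  rw [hierarchicalBaseline_eq, PMF.toOuterMeasure_map_apply]
  set G := (fun (h : Traj n) u => (h.2 u (k - 1)).2) ⁻¹' {p | regret ℓ (Ts k) p ≤
    (4 + 2 * (γ + 4 * a + 12) * (γ + 2)) * L ^ 2 * regretBound Ts k n m} with hG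
  have hbad : μ.toOuterMeasure Gᶜ ≤ ENNReal.ofReal (3 * (Ts k : ℝ) ^ (-γ)) := by
    have h1 : μ.toOuterMeasure Gᶜ ≤
        μ.toOuterMeasure {h | ¬ GoodTraj Ts k m ℓ star ((γ + 2) * L) h} := by
      -- The inclusion is needed only on the support, where trajectories are `Consistent`.
      refine PMF.toOuterMeasure_mono μ ?_
      rintro h ⟨hh, hsupp⟩ hgood
      exact hh (hgood.regret_le (consistent_of_mem_support A Ts k m ℓ (Ts k) h hsupp) hm hS ha hγ
        hma hℓ hstar)
    refine h1.trans ((toOuterMeasure_not_goodTraj_le A hm hS hℓ star (by positivity)).trans ?_)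
    rw [← ENNReal.ofReal_natCast, ← ENNReal.ofReal_mul (Nat.cast_nonneg _)]
    refine ENNReal.ofReal_le_ofReal ?_
    have hkT : (k : ℝ) ≤ Ts k := by
      exact_mod_cast (Nat.lt_two_pow_self.le).trans (hS.two_pow_le (le_refl k))
    have h2 : Real.exp (-((γ + 2) * L)) = (Ts k : ℝ) ^ (-γ) * ((Ts k : ℝ) ^ 2)⁻¹ := by
      rw [Real.rpow_def_of_pos hT, ← hL]
      have h3 : ((Ts k : ℝ) ^ 2)⁻¹ = Real.exp (-(2 * L)) := by
        rw [Real.exp_neg, hL, two_mul, Real.exp_add, Real.exp_log hT, sq]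
      rw [h3, ← Real.exp_add]
      congr 1
      ring
    have h3 : 0 ≤ (Ts k : ℝ) ^ (-γ) := Real.rpow_nonneg hT.le _
    rw [h2]
    push_cast
    calc (k : ℝ) * (2 * Ts k + 1) * ((Ts k : ℝ) ^ (-γ) * ((Ts k : ℝ) ^ 2)⁻¹)
        ≤ (Ts k : ℝ) * (2 * Ts k + Ts k) * ((Ts k : ℝ) ^ (-γ) * ((Ts k : ℝ) ^ 2)⁻¹) := by gcongr
      _ = 3 * (Ts k : ℝ) ^ (-γ) := by
          field_simp
          ring
  have hsum := toOuterMeasure_add_compl μ G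
  rw [ENNReal.ofReal_sub _ (by positivity), ENNReal.ofReal_one]
  refine tsub_le_iff_right.2 ?_
  calc (1 : ENNReal) = μ.toOuterMeasure G + μ.toOuterMeasure Gᶜ := hsum.symm
    _ ≤ _ := add_le_add_right hbad _
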